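/- Let $n\ge 3$ and $r_0\ge 0$. Put $M=\{x\in\mathbb{R}^n:|x|\ge r_0\}$ (so $M=\mathbb{R}^n$ if $r_0=0$) and let $M^\circ$ be its manifold interior ($\mathbb{R}^n$ if $r_0=0$, $\{|x|>r_0\}$ if $r_0>0$). Let $g$ be a smooth Riemannian metric and $k$ a smooth symmetric 2-tensor on $M$ such that: (1) (Spherical symmetry) with $r=|x|$, $g=g_{11}(r)\,dr^2+\rho(r)^2g_{S^{n-1}}$ and $k_{ij}=\nu_i\nu_jk_n(r)+(g_{ij}-\nu_i\nu_j)k_t(r)$ for radial functions $g_{11},\rho>0$, $k_n$, $k_t$, where $\nu=\sqrt{g^{11}}\,\partial_r$. (2) (Asymptotic flatness) outside a compact set $M$ has coordinates $y$ with values in $\{|y|>\rho_0\}$ (not necessarily adapted to the symmetry; $|y|\to\infty$ corresponding to infinity of $M$) and there is a constant $C$ with $|\partial^{\beta}(g_{ij}-\delta_{ij})|\le C|y|^{-(n-2+|\beta|)}$ for $|\beta|\le2$, $|\partial^{\beta}k_{ij}|\le C|y|^{-(n-1+|\beta|)}$ for $|\beta|\le 1$, $|R_g|\le C|y|^{-(n+1)}$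 and $|\mathrm{Tr}_gk|\le C|y|^{-n}$. (3) (Dominant energy condition) $\mu\ge|J|_g$, where $16\pi\mu=R_g+(\mathrm{Tr}_gk)^2-|k|_g^2$ and $8\pi J=\mathrm{div}_g(k-(\mathrm{Tr}_gk)g)$. (4) (Complete without horizons, or outermost horizon boundary) with the null expansions $\theta_\pm(r)=(n-1)\big(\sqrt{g^{11}}\,\rho_r/\rho\pm k_t\big)$ of the sphere $S_r$, both $\theta_+(r)\neq0$ and $\theta_-(r)\ne0$ for every $r>r_0$; and if $r_0>0$, then $\theta_+(r_0)=0$ (future horizon) or $\theta_-(r_0)=0$ (past horizon). Then: (a) There is a spherically symmetric $f\in C^\infty(M^\circ)$ solving Jang's equation $$\Big(g^{ab}-\frac{f^af^b}{1+|\nabla f|_g^2}\Big)\Big(\frac{\nabla_{ab}f}{\sqrt{1+|\nabla f|_g^2}}-k_{ab}\Big)=0,$$ with $f\to0$ at infinity and, if $r_0>0$, either $\theta_+(r_0)=0$ and $f\to+\infty$ at $S_{r_0}$, or $\theta_-(r_0)=0$ and $f\to-\infty$ at $S_{r_0}$. (b) For every such $f$, with Jang metric $\bar g=g+df^2$ on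 $M^\circ$, there is a positive $u\in C^\infty(M^\circ)$ with $\Delta_{\bar g}u-\frac{n-2}{4(n-1)}R_{\bar g}u=0$, $u\to1$ at infinity and, if $r_0>0$, $u\to0$ at $S_{r_0}$ (along the cylindrical end of $\bar g$). (c) For every such $f$ and $u$, the conformally transformed Jang deformation $\tilde g=u^{4/(n-2)}\bar g$ is isometric to Euclidean space: if $r_0=0$, $(M^\circ,\tilde g)$ is isometric to $(\mathbb{R}^n,g_{\mathbb{E}})$; if $r_0>0$, there is an isometry $\Phi$ of $(M^\circ,\tilde g)$ onto $(\mathbb{R}^n\setminus\{0\},g_{\mathbb{E}})$ with $\Phi(x)\to0$ as $|x|\to r_0$, so that $\tilde M$, which is $M^\circ$ with the cylindrical end closed up by one point, is isometric to $(\mathbb{R}^n,g_{\mathbb{E}})$. -/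

import Mathlib

open Filter Topology Set Bornology
open scoped ContDiff

noncomputable section

namespace Jang

/-- Euclidean `n`-space. -/
abbrev E (n : ℕ) : Type := EuclideanSpace ℝ (Fin n)

/-- A covariant 2-tensor field, through its components in the standard coordinates of `ℝⁿ`. -/
abbrev Tensor2 (n : ℕ) : Type := E n → Matrix (Fin n) (Fin n) ℝ

/-! ### Riemannian geometry in coordinates -/

/-- The partial derivative `∂ᵢ F`. -/
def pd {n : ℕ} (i : Fin n) (F : E n → ℝ) (x : E n) : ℝ :=
  fderiv ℝ F x (EuclideanSpace.single i 1)

/-- Christoffel symbols `Γᵏᵢⱼ`. -/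
def christoffel {n : ℕ} (g : Tensor2 n) (k i j : Fin n) (x : E n) : ℝ :=
  (1 / 2) * ∑ l, (g x)⁻¹ k l *
    (pd i (fun y => g y j l) x + pd j (fun y => g y i l) x - pd l (fun y => g y i j) x)

/-- Ricci curvature `Rᵢⱼ` (positive on round spheres). -/
def ricci {n : ℕ} (g : Tensor2 n) (i j : Fin n) (x : E n) : ℝ :=
  ∑ k, (pd k (christoffel g k i j) x - pd j (christoffel g k i k) x
    + ∑ l, (christoffel g k k l x * christoffel g l i j x
      - christoffel g k j l x * christoffel g l i k x))

/-- Scalar curvature `R_g`. -/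
def scalarCurv {n : ℕ} (g : Tensor2 n) (x : E n) : ℝ :=
  ∑ i, ∑ j, (g x)⁻¹ i j * ricci g i j x

/-- `Tr_g T`. -/
def trace {n : ℕ} (g T : Tensor2 n) (x : E n) : ℝ :=
  ∑ i, ∑ j, (g x)⁻¹ i j * T x i j

/-- `|T|_g²` for a covariant 2-tensor. -/
def normSq {n : ℕ} (g T : Tensor2 n) (x : E n) : ℝ :=
  ∑ i, ∑ j, ∑ a, ∑ b, (g x)⁻¹ i a * (g x)⁻¹ j b * T x i j * T x a b

/-- The divergence `(div_g T)ⱼ = g^{ia} ∇ᵢ T_{aj}` of a covariant 2-tensor. -/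
def divergence {n : ℕ} (g T : Tensor2 n) (j : Fin n) (x : E n) : ℝ :=
  ∑ i, ∑ a, (g x)⁻¹ i a *
    (pd i (fun y => T y a j) x
      - ∑ l, (christoffel g l i a x * T x l j + christoffel g l i j x * T x a l))

/-- `|η|_g` for a covector with components `η`. -/
def covectorNorm {n : ℕ} (g : Tensor2 n) (x : E n) (η : Fin n → ℝ) : ℝ :=
  Real.sqrt (∑ i, ∑ j, (g x)⁻¹ i j * η i * η j)

/-- The gradient `fᵃ = g^{ab} ∂_b f`. -/
def grad {n : ℕ} (g : Tensor2 n) (f : E n → ℝ) (a : Fin n) (x : E n) : ℝ :=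
  ∑ b, (g x)⁻¹ a b * pd b f x

/-- `|∇f|_g²`. -/
def gradNormSq {n : ℕ} (g : Tensor2 n) (f : E n → ℝ) (x : E n) : ℝ :=
  ∑ a, grad g f a x * pd a f x

/-- The covariant Hessian `∇_{ab} f`. -/
def hessian {n : ℕ} (g : Tensor2 n) (f : E n → ℝ) (a b : Fin n) (x : E n) : ℝ :=
  pd a (pd b f) x - ∑ c, christoffel g c a b x * pd c f x

/-- The Laplace–Beltrami operator `Δ_g f`. -/
def laplacian {n : ℕ} (g : Tensor2 n) (f : E n → ℝ) (x : E n) : ℝ :=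
  ∑ a, ∑ b, (g x)⁻¹ a b * hessian g f a b x

/-! ### Initial data -/

/-- The manifold `ℝⁿ ∖ B₀(r₀)` with its boundary sphere; it is all of `ℝⁿ` when `r₀ = 0`. -/
def M (n : ℕ) (r₀ : ℝ) : Set (E n) := {x | r₀ ≤ ‖x‖}

/-- The manifold interior: `ℝⁿ` when `r₀ = 0`, and `{|x| > r₀}` when `r₀ > 0`. -/
def bulk (n : ℕ) (r₀ : ℝ) : Set (E n) := {x | r₀ = 0 ∨ r₀ < ‖x‖}

/-- A smooth Riemannian metric `g` and a smooth symmetric 2-tensor `k` on `M n r₀`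
(smooth up to the boundary). -/
structure IsInitialData (n : ℕ) (r₀ : ℝ) (g k : Tensor2 n) : Prop where
  smooth_g : ∀ i j, ContDiffOn ℝ ∞ (fun x => g x i j) (M n r₀)
  smooth_k : ∀ i j, ContDiffOn ℝ ∞ (fun x => k x i j) (M n r₀)
  posDef_g : ∀ x ∈ M n r₀, (g x).PosDef
  symm_k : ∀ x ∈ M n r₀, (k x).IsSymm

/-- The energy density: `16 π μ = R_g + (Tr_g k)² - |k|_g²`. -/
def energyDensity {n : ℕ} (g k : Tensor2 n) (x : E n) : ℝ :=
  (scalarCurv g x + trace g k x ^ 2 - normSq g k x) / (16 * Real.pi)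

/-- The momentum density: `8 π J = div_g (k - (Tr_g k) g)`. -/
def momentumDensity {n : ℕ} (g k : Tensor2 n) (x : E n) (j : Fin n) : ℝ :=
  divergence g (fun y => k y - trace g k y • g y) j x / (8 * Real.pi)

/-- The dominant energy condition `μ ≥ |J|_g`. -/
def DominantEnergy (n : ℕ) (r₀ : ℝ) (g k : Tensor2 n) : Prop :=
  ∀ x ∈ bulk n r₀, covectorNorm g x (momentumDensity g k x) ≤ energyDensity g k x

/-- Components of the pull-back `Ψ^* T`. -/
def pullback {n : ℕ} (Ψ : E n → E n) (T : Tensor2 n) (y : E n) (i j : Fin n) : ℝ :=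
  ∑ a, ∑ b, T (Ψ y) a b *
    fderiv ℝ Ψ y (EuclideanSpace.single i 1) a * fderiv ℝ Ψ y (EuclideanSpace.single j 1) b

/-- Asymptotic flatness. The coordinates `φ` of the asymptotic end may be arbitrary; they are not
required to be adapted to any symmetry. -/
def AsymptoticallyFlat (n : ℕ) (r₀ : ℝ) (g k : Tensor2 n) : Prop :=
  ∃ (ρ₀ C : ℝ) (φ : OpenPartialHomeomorph (E n) (E n)), 0 < ρ₀ ∧
    φ.source ⊆ M n r₀ ∧ φ.target = {y | ρ₀ < ‖y‖} ∧
    ContDiffOn ℝ ∞ φ φ.source ∧ ContDiffOn ℝ ∞ φ.symm φ.target ∧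
    -- the sets `{|y| > R}` are neighbourhoods of the infinity of the manifold
    (∀ R, ρ₀ ≤ R → IsCompact (M n r₀ \ φ.symm '' {y | R < ‖y‖})) ∧
    (∀ y, ρ₀ < ‖y‖ →
      (∀ i j, ∀ m ≤ 2,
        ‖iteratedFDeriv ℝ m
          (fun z => pullback φ.symm g z i j - (1 : Matrix (Fin n) (Fin n) ℝ) i j) y‖
          ≤ C / ‖y‖ ^ (n - 2 + m)) ∧
      (∀ i j, ∀ m ≤ 1,
        ‖iteratedFDeriv ℝ m (fun z => pullback φ.symm k z i j) y‖ ≤ C / ‖y‖ ^ (n - 1 + m)) ∧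
      |scalarCurv g (φ.symm y)| ≤ C / ‖y‖ ^ (n + 1) ∧
      |trace g k (φ.symm y)| ≤ C / ‖y‖ ^ n)

/-- Spherical symmetry: with `r = |x|` and `ν = √(g¹¹) ∂_r` (so that `νᵢ νⱼ = g₁₁ xᵢ xⱼ / r²`),
`g = g₁₁(r) dr² + ρ(r)² g_{S^{n-1}}` and `kᵢⱼ = νᵢ νⱼ kₙ(r) + (gᵢⱼ - νᵢ νⱼ) kₜ(r)`. -/
structure IsSphericallySymmetric (n : ℕ) (r₀ : ℝ) (g k : Tensor2 n)
    (g₁₁ ρ kₙ kₜ : ℝ → ℝ) : Prop where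
  g₁₁_pos : ∀ r, r₀ ≤ r → 0 < r → 0 < g₁₁ r
  ρ_pos : ∀ r, r₀ ≤ r → 0 < r → 0 < ρ r
  g_eq : ∀ x ∈ M n r₀, x ≠ 0 → ∀ i j, g x i j =
    g₁₁ ‖x‖ * (x i * x j / ‖x‖ ^ 2)
      + ρ ‖x‖ ^ 2 / ‖x‖ ^ 2 * ((if i = j then 1 else 0) - x i * x j / ‖x‖ ^ 2)
  k_eq : ∀ x ∈ M n r₀, x ≠ 0 → ∀ i j, k x i j =
    g₁₁ ‖x‖ * (x i * x j / ‖x‖ ^ 2) * kₙ ‖x‖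
      + (g x i j - g₁₁ ‖x‖ * (x i * x j / ‖x‖ ^ 2)) * kₜ ‖x‖

/-- The null expansions `H + σ Tr_{S_r} k = (n-1) (√(g¹¹) ρ_r / ρ + σ kₜ)` of the sphere `S_r`, where
`σ = 1` gives `θ₊` and `σ = -1` gives `θ₋`. The derivative is one-sided at `r = r₀`. -/
def nullExpansion (n : ℕ) (r₀ : ℝ) (g₁₁ ρ kₜ : ℝ → ℝ) (σ r : ℝ) : ℝ :=
  ((n : ℝ) - 1) * (derivWithin ρ (Ici r₀) r / (Real.sqrt (g₁₁ r) * ρ r) + σ * kₜ r)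

/-- Either there is no boundary (`r₀ = 0`) and no symmetry sphere is an apparent horizon, or the
boundary `S_{r₀}` is an apparent horizon (`θ₊ = 0` or `θ₋ = 0`) enclosed by no other one. -/
def CompleteOrOutermostHorizon (n : ℕ) (r₀ : ℝ) (g₁₁ ρ kₜ : ℝ → ℝ) : Prop :=
  (∀ r, r₀ < r → nullExpansion n r₀ g₁₁ ρ kₜ 1 r ≠ 0 ∧ nullExpansion n r₀ g₁₁ ρ kₜ (-1) r ≠ 0) ∧
  (0 < r₀ → nullExpansion n r₀ g₁₁ ρ kₜ 1 r₀ = 0 ∨ nullExpansion n r₀ g₁₁ ρ kₜ (-1) r₀ = 0)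

/-! ### The Jang deformation and the conformal change -/

/-- The filter of points of `{|x| > r₀}` approaching the sphere `S_{r₀}`. -/
def towardsBoundary (n : ℕ) (r₀ : ℝ) : Filter (E n) :=
  comap (fun x : E n => ‖x‖) (𝓝[>] r₀)

/-- The left-hand side of Jang's equation. -/
def jangOperator {n : ℕ} (g k : Tensor2 n) (f : E n → ℝ) (x : E n) : ℝ :=
  ∑ a, ∑ b, ((g x)⁻¹ a b - grad g f a x * grad g f b x / (1 + gradNormSq g f x)) *
    (hessian g f a b x / Real.sqrt (1 + gradNormSq g f x) - k x a b)

/-- `f` is a spherically symmetric solution of Jang's equation, smooth in the interior of the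
manifold, with `f → 0` at infinity and, if there is a boundary, with `f → +∞` there
when the boundary is a future horizon, or `f → -∞` there when it is a past horizon (either sign
is allowed if it is both). -/
structure IsJangSolution (n : ℕ) (r₀ : ℝ) (g k : Tensor2 n) (g₁₁ ρ kₜ : ℝ → ℝ)
    (f : E n → ℝ) : Prop where
  smooth : ContDiffOn ℝ ∞ f (bulk n r₀)
  radial : ∀ x ∈ bulk n r₀, ∀ y ∈ bulk n r₀, ‖x‖ = ‖y‖ → f x = f y
  equation : ∀ x ∈ bulk n r₀, jangOperator g k f x = 0
  decay : Tendsto f (cobounded (E n)) (𝓝 0)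
  blowup : 0 < r₀ →
    (nullExpansion n r₀ g₁₁ ρ kₜ 1 r₀ = 0 ∧ Tendsto f (towardsBoundary n r₀) atTop) ∨
    (nullExpansion n r₀ g₁₁ ρ kₜ (-1) r₀ = 0 ∧ Tendsto f (towardsBoundary n r₀) atBot)

/-- The Jang metric `ḡ = g + df²`. -/
def jangMetric {n : ℕ} (g : Tensor2 n) (f : E n → ℝ) : Tensor2 n :=
  fun x => Matrix.of fun a b => g x a b + pd a f x * pd b f x

/-- `u` is a smooth positive solution of
`Δ_ḡ u - (n-2)/(4(n-1)) R_ḡ u = 0` on the interior of the manifold, with `u → 1` at infinity and,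
if there is a boundary, with `u → 0` along the cylindrical end. -/
structure IsConformalFactor (n : ℕ) (r₀ : ℝ) (gbar : Tensor2 n) (u : E n → ℝ) : Prop where
  smooth : ContDiffOn ℝ ∞ u (bulk n r₀)
  pos : ∀ x ∈ bulk n r₀, 0 < u x
  equation : ∀ x ∈ bulk n r₀,
    laplacian gbar u x - ((n : ℝ) - 2) / (4 * ((n : ℝ) - 1)) * scalarCurv gbar x * u x = 0
  asymptotic : Tendsto u (cobounded (E n)) (𝓝 1)
  cylindrical : 0 < r₀ → Tendsto u (towardsBoundary n r₀) (𝓝 0)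

/-- The conformal metric `u^{4/(n-2)} ḡ`. -/
def conformalMetric {n : ℕ} (u : E n → ℝ) (gbar : Tensor2 n) : Tensor2 n :=
  fun x => (u x ^ (4 / ((n : ℝ) - 2))) • gbar x

/-- The metric `h` on the interior of the manifold is isometric to Euclidean space. If `r₀ = 0`, this is
an isometry of `(ℝⁿ, h)` onto `(ℝⁿ, δ)`. If `r₀ > 0`, the end at the sphere `S_{r₀}` is closed up by
one added point: `Φ` is an isometry of `({|x| > r₀}, h)` onto `(ℝⁿ ∖ {0}, δ)` which
tends to `0` at that end, so that it extends to the manifold with the point added, onto `(ℝⁿ, δ)`. -/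
def IsometricToEuclidean (n : ℕ) (r₀ : ℝ) (h : Tensor2 n) : Prop :=
  ∃ Φ : E n → E n, ContDiffOn ℝ ∞ Φ (bulk n r₀) ∧
    (∀ x ∈ bulk n r₀, ∀ i j, pullback Φ (fun _ => 1) x i j = h x i j) ∧
    (r₀ = 0 → BijOn Φ (bulk n r₀) univ) ∧
    (0 < r₀ → BijOn Φ (bulk n r₀) {0}ᶜ ∧ Tendsto Φ (towardsBoundary n r₀) (𝓝 0))

end Jang

end

/-! Everything is reduced to the radius r. Write g = D dr² + ρ² g_{S^{n-1}} with ρ = r√G, and f =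
F(|x|). In terms of the slope v = F'/√(D + F'²), with values in (-1, 1), Jang's equation is the
Riccati equation v' = -(n-1)(ρ'/ρ) v + √D((1 - v²) kₙ + (n-1) kₜ) (`jangOperator_eq`). Its right
side is -√D θ₋ at v = 1 and √D θ₊ at v = -1. Both expansions are positive for r > r₀: they never
vanish, and a negative one would bound log ρ on the end (`expansion_pos`). So v = ±1 are barriers
and solutions exist for all r. If r₀ = 0, the odd solution through the singular point r = 0 is
taken. If r₀ > 0, v starts at the value ±1 where the vanishing expansion makes the right side zero;
then 1 - v² = O((r - r₀)²), so |F'| ≥ c/(r - r₀) and F diverges (`tendsto_atTop_of_riccati`).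

Flatness is a feature of the symmetry. The Jang metric is D̄ dr² + ρ² g_{S^{n-1}} with D̄ = D + F'²,
and e^{2ℓ} times it equals dt² + t² g_{S^{n-1}} with t = ρ e^ℓ as soon as t'/t = √D̄/ρ. This
determines ℓ up to a constant, fixed by ℓ → 0 at infinity, and u₀ = e^{(n-2)ℓ/2} is a conformal
factor; since F blows up, t → 0 at the horizon. For (c) it remains to see that every conformal
factor u equals u₀ (`eq_flatFactor`). The zeroth order term of the equation need not have a sign, so
the maximum principle is applied to (u - u₀)/H with H = u₀ + ρ^{-(n-2)/2}. Here H is a strict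
supersolution: ρ^{-2}ḡ is a cylinder, whose conformal Laplacian sends the constant 1, corresponding
to ρ^{-(n-2)/2}, to a negative constant.

Limits at infinity need estimates in terms of the arclength s, although the flat chart y is not
adapted to the spheres. One has s ≤ b + 2|y|, and ρ ≥ c s because the image of a large symmetry
sphere must surround the origin of the chart (`exists_norm_le`). Gronwall bounds q = dρ/ds. The mass
function ρ^{n-2}(1 - q²) has integrable derivative, whence q = 1 + O(1/s). The equation for ρ^{n-1}
v, with the fast decay of Tr k, gives v² = O(s^{-3}). Then F' and ℓ' are integrable. -/

namespace Jang

variable {n : ℕ}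

/-! ### The partial derivative calculus -/

/-- `F` is differentiable at `x` with partial derivatives `d`. -/
def HasPD (F : E n → ℝ) (d : Fin n → ℝ) (x : E n) : Prop :=
  DifferentiableAt ℝ F x ∧ ∀ k, pd k F x = d k

theorem HasPD.pd_eq {F : E n → ℝ} {d : Fin n → ℝ} {x : E n} (h : HasPD F d x) (k : Fin n) :
    pd k F x = d k := h.2 k

theorem hasPD_of_differentiableAt {F : E n → ℝ} {x : E n} (h : DifferentiableAt ℝ F x) :
    HasPD F (fun k => pd k F x) x := ⟨h, fun _ => rfl⟩

theorem pd_congr {F F' : E n → ℝ} {x : E n} (h : F =ᶠ[𝓝 x] F') (k : Fin n) :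
    pd k F x = pd k F' x := by
  unfold pd; rw [h.fderiv_eq]

theorem HasPD.congr {F F' : E n → ℝ} {d : Fin n → ℝ} {x : E n} (h : HasPD F d x)
    (hF : F' =ᶠ[𝓝 x] F) : HasPD F' d x :=
  ⟨h.1.congr_of_eventuallyEq hF, fun k => (pd_congr hF k).trans (h.2 k)⟩

theorem HasPD.congr_pd {F : E n → ℝ} {d d' : Fin n → ℝ} {x : E n} (h : HasPD F d x)
    (hd : ∀ k, d k = d' k) : HasPD F d' x := ⟨h.1, fun k => (h.2 k).trans (hd k)⟩

theorem HasPD.const (c : ℝ) (x : E n) : HasPD (fun _ => c) (fun _ => 0) x :=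
  ⟨differentiableAt_const c, fun k => by simp [pd]⟩

theorem HasPD.add {F H : E n → ℝ} {d e : Fin n → ℝ} {x : E n} (hF : HasPD F d x)
    (hH : HasPD H e x) : HasPD (fun y => F y + H y) (fun k => d k + e k) x := by
  refine ⟨hF.1.add hH.1, fun k => ?_⟩
  simp only [← hF.2 k, ← hH.2 k]
  unfold pd
  rw [fderiv_fun_add hF.1 hH.1]; rfl

theorem HasPD.sub {F H : E n → ℝ} {d e : Fin n → ℝ} {x : E n} (hF : HasPD F d x)
    (hH : HasPD H e x) : HasPD (fun y => F y - H y) (fun k => d k - e k) x := by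
  refine ⟨hF.1.sub hH.1, fun k => ?_⟩
  simp only [← hF.2 k, ← hH.2 k]
  unfold pd
  rw [fderiv_fun_sub hF.1 hH.1]; rfl

theorem HasPD.mul {F H : E n → ℝ} {d e : Fin n → ℝ} {x : E n} (hF : HasPD F d x)
    (hH : HasPD H e x) : HasPD (fun y => F y * H y) (fun k => F x * e k + H x * d k) x := by
  refine ⟨hF.1.mul hH.1, fun k => ?_⟩
  simp only [← hF.2 k, ← hH.2 k]
  unfold pd
  rw [fderiv_fun_mul hF.1 hH.1]; rfl

/-- The unit radial covector `x / |x|`. -/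
noncomputable def nu (x : E n) (i : Fin n) : ℝ := x i / ‖x‖

/-- The projection to the tangent space of the sphere through `x`. -/
noncomputable def proj (x : E n) (i j : Fin n) : ℝ := (if i = j then 1 else 0) - nu x i * nu x j

theorem proj_comm (x : E n) (i j : Fin n) : proj x i j = proj x j i := by
  unfold proj; simp only [eq_comm (a := i), mul_comm]

theorem sum_nu_sq {x : E n} (hx : x ≠ 0) : ∑ k, nu x k * nu x k = 1 := by
  have h : ‖x‖ ≠ 0 := norm_ne_zero_iff.2 hx
  have h2 := EuclideanSpace.real_norm_sq_eq x
  simp only [nu, ← sq, div_pow, ← Finset.sum_div, ← h2]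
  field_simp

theorem sum_proj_nu {x : E n} (hx : x ≠ 0) (i : Fin n) : ∑ k, proj x i k * nu x k = 0 := by
  have : ∑ k, proj x i k * nu x k = ∑ k, ((if i = k then nu x k else 0)
      - nu x i * (nu x k * nu x k)) := by
    refine Finset.sum_congr rfl fun k _ => ?_
    unfold proj; split_ifs <;> ring
  rw [this, Finset.sum_sub_distrib, ← Finset.mul_sum, sum_nu_sq hx]; simp

theorem sum_proj_proj {x : E n} (hx : x ≠ 0) (i j : Fin n) :
    ∑ k, proj x i k * proj x j k = proj x i j := by
  have : ∑ k, proj x i k * proj x j k = ∑ k, ((if j = k then proj x i k else 0)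
      - nu x j * (proj x i k * nu x k)) := by
    refine Finset.sum_congr rfl fun k _ => ?_
    conv_lhs => rw [proj.eq_1 x j k]
    split_ifs <;> ring
  rw [this, Finset.sum_sub_distrib, ← Finset.mul_sum, sum_proj_nu hx]; simp

theorem sum_proj_self {x : E n} (hx : x ≠ 0) : ∑ k, proj x k k = (n : ℝ) - 1 := by
  simp only [proj, Finset.sum_sub_distrib, sum_nu_sq hx]; simp

theorem hasPD_coord (i : Fin n) (x : E n) :
    HasPD (fun y => y i) (fun k => if i = k then 1 else 0) x := by
  have h : HasFDerivAt (fun y : E n => y i) (EuclideanSpace.proj i : E n →L[ℝ] ℝ) x :=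
    (EuclideanSpace.proj i : E n →L[ℝ] ℝ).hasFDerivAt
  refine ⟨h.differentiableAt, fun k => ?_⟩
  unfold pd; rw [h.fderiv]
  simp

theorem hasPD_norm {x : E n} (hx : x ≠ 0) : HasPD (fun y => ‖y‖) (nu x) x := by
  have h := (hasStrictFDerivAt_norm_sq x).hasFDerivAt.sqrt (by simpa using hx)
  simp only [Real.sqrt_sq (norm_nonneg _)] at h
  refine ⟨h.differentiableAt, fun k => ?_⟩
  unfold pd; rw [h.fderiv]
  have : ‖x‖ ≠ 0 := norm_ne_zero_iff.2 hx
  simp [nu, EuclideanSpace.inner_single_right]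
  field_simp

theorem HasPD.comp_deriv {F : E n → ℝ} {d : Fin n → ℝ} {x : E n} (hF : HasPD F d x)
    {φ : ℝ → ℝ} {φ' : ℝ} (hφ : HasDerivAt φ φ' (F x)) :
    HasPD (fun y => φ (F y)) (fun k => φ' * d k) x := by
  have h := hφ.hasFDerivAt.comp x hF.1.hasFDerivAt
  refine ⟨h.differentiableAt, fun k => ?_⟩
  have e : pd k (fun y => φ (F y)) x = pd k (φ ∘ F) x := rfl
  rw [e]; simp only [← hF.2 k]; unfold pd; rw [h.fderiv]
  simp [mul_comm]

theorem hasPD_radial {x : E n} (hx : x ≠ 0) {φ : ℝ → ℝ} {φ' : ℝ} (hφ : HasDerivAt φ φ' ‖x‖) :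
    HasPD (fun y => φ ‖y‖) (fun k => φ' * nu x k) x :=
  (hasPD_norm hx).comp_deriv hφ

theorem hasPD_nu {x : E n} (hx : x ≠ 0) (i : Fin n) :
    HasPD (fun y => nu y i) (fun k => proj x i k / ‖x‖) x := by
  have h0 : ‖x‖ ≠ 0 := norm_ne_zero_iff.2 hx
  have h := (hasPD_coord i x).mul (hasPD_radial hx (hasDerivAt_inv h0))
  refine (h.congr (Eventually.of_forall fun y => ?_)).congr_pd fun k => ?_
  · simp [nu, div_eq_mul_inv]
  · unfold proj nu
    split_ifs <;> field_simp <;> ring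

theorem hasPD_proj {x : E n} (hx : x ≠ 0) (i j : Fin n) :
    HasPD (fun y => proj y i j)
      (fun k => -(proj x i k * nu x j + nu x i * proj x j k) / ‖x‖) x := by
  refine ((HasPD.const _ x).sub ((hasPD_nu hx i).mul (hasPD_nu hx j))).congr_pd fun k => ?_
  ring

end Jang

namespace Jang

variable {n : ℕ}

/-! ### Rotationally symmetric metrics -/

/-- On the spheres with radius in the open set `U`, `g = D dr² + r² G g_{S^{n-1}}`. -/
structure IsRadialMetric (g : Tensor2 n) (D G : ℝ → ℝ) (U : Set ℝ) : Prop where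
  isOpen : IsOpen U
  pos : ∀ r ∈ U, 0 < r
  D_pos : ∀ r ∈ U, 0 < D r
  G_pos : ∀ r ∈ U, 0 < G r
  D_smooth : ContDiffOn ℝ ∞ D U
  G_smooth : ContDiffOn ℝ ∞ G U
  eq : ∀ x : E n, ‖x‖ ∈ U → ∀ i j, g x i j = D ‖x‖ * (nu x i * nu x j) + G ‖x‖ * proj x i j

/-- The radial logarithmic derivative `φ' / (2 φ)`. -/
noncomputable def halfLogDeriv (φ : ℝ → ℝ) (r : ℝ) : ℝ := deriv φ r / (2 * φ r)

/-- The coefficient of `P_{ij} ν_k` in the Christoffel symbols. -/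
noncomputable def sphereCoeff (D G : ℝ → ℝ) (r : ℝ) : ℝ :=
  1 / r - G r / D r * (halfLogDeriv G r + 1 / r)

/-- The contractions below are brought to this one shape: νν and P are complementary orthogonal
projections, so only ν·ν and P·P survive. -/
theorem sum_nu_proj_mul {x : E n} (hx : x ≠ 0) (i j k m : Fin n) (c d e c' d' e' : ℝ) :
    ∑ l, (c * nu x l + d * proj x k l + e * proj x j l)
      * (c' * nu x l + d' * proj x m l + e' * proj x i l) =
    c * c' + d * d' * proj x k m + d * e' * proj x k i + e * d' * proj x j m
      + e * e' * proj x j i := by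
  have : ∀ l, (c * nu x l + d * proj x k l + e * proj x j l)
      * (c' * nu x l + d' * proj x m l + e' * proj x i l) =
      c * c' * (nu x l * nu x l) + c * d' * (proj x m l * nu x l) + c * e' * (proj x i l * nu x l)
      + d * c' * (proj x k l * nu x l) + d * d' * (proj x k l * proj x m l)
      + d * e' * (proj x k l * proj x i l) + e * c' * (proj x j l * nu x l)
      + e * d' * (proj x j l * proj x m l) + e * e' * (proj x j l * proj x i l) := fun l => by ring
  simp only [this, Finset.sum_add_distrib, ← Finset.mul_sum, sum_nu_sq hx, sum_proj_nu hx,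
    sum_proj_proj hx]
  ring

namespace IsRadialMetric

variable {g : Tensor2 n} {D G : ℝ → ℝ} {U : Set ℝ}

section
variable (h : IsRadialMetric g D G U) {x : E n} (hx : ‖x‖ ∈ U)
include h

theorem hasDerivAt_D {r : ℝ} (hr : r ∈ U) : HasDerivAt D (deriv D r) r :=
  ((h.D_smooth.contDiffAt (h.isOpen.mem_nhds hr)).differentiableAt (by simp)).hasDerivAt

theorem hasDerivAt_G {r : ℝ} (hr : r ∈ U) : HasDerivAt G (deriv G r) r :=
  ((h.G_smooth.contDiffAt (h.isOpen.mem_nhds hr)).differentiableAt (by simp)).hasDerivAt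

theorem contDiffOn_beta : ContDiffOn ℝ ∞ (halfLogDeriv D) U :=
  ((contDiffOn_infty_iff_deriv_of_isOpen h.isOpen).1 h.D_smooth).2.div
    (contDiffOn_const.mul h.D_smooth) fun r hr => by have := h.D_pos r hr; positivity

theorem contDiffOn_a : ContDiffOn ℝ ∞ (halfLogDeriv G) U :=
  ((contDiffOn_infty_iff_deriv_of_isOpen h.isOpen).1 h.G_smooth).2.div
    (contDiffOn_const.mul h.G_smooth) fun r hr => by have := h.G_pos r hr; positivity

theorem contDiffOn_inv_r : ContDiffOn ℝ ∞ (fun r : ℝ => 1 / r) U :=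
  contDiffOn_const.div contDiffOn_id fun r hr => (h.pos r hr).ne'

theorem contDiffOn_b : ContDiffOn ℝ ∞ (sphereCoeff D G) U :=
  h.contDiffOn_inv_r.sub ((h.G_smooth.div h.D_smooth fun r hr => (h.D_pos r hr).ne').mul
    (h.contDiffOn_a.add h.contDiffOn_inv_r))

theorem hasDerivAt_of_contDiffOn {φ : ℝ → ℝ} (hφ : ContDiffOn ℝ ∞ φ U) {r : ℝ} (hr : r ∈ U) :
    HasDerivAt φ (deriv φ r) r :=
  ((hφ.contDiffAt (h.isOpen.mem_nhds hr)).differentiableAt (by simp)).hasDerivAt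

include hx

theorem ne_zero : x ≠ 0 := norm_ne_zero_iff.1 (h.pos _ hx).ne'

theorem eventually_mem : ∀ᶠ y in 𝓝 x, ‖y‖ ∈ U :=
  continuous_norm.continuousAt.preimage_mem_nhds (h.isOpen.mem_nhds hx)

/-- D and G are the eigenvalues of g on the ranges of the complementary projections νν and P, so
inverting g inverts them. -/
theorem inv_apply (i j : Fin n) :
    (g x)⁻¹ i j = (D ‖x‖)⁻¹ * (nu x i * nu x j) + (G ‖x‖)⁻¹ * proj x i j := by
  have h0 := h.ne_zero hx
  have hD := (h.D_pos _ hx).ne'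
  have hG := (h.G_pos _ hx).ne'
  have : (g x)⁻¹ = Matrix.of fun i j =>
      (D ‖x‖)⁻¹ * (nu x i * nu x j) + (G ‖x‖)⁻¹ * proj x i j := by
    apply Matrix.inv_eq_right_inv
    ext i j
    rw [Matrix.mul_apply, Matrix.one_apply]
    -- The zero terms pad both factors to the shape of `sum_nu_proj_mul`.
    have e : ∀ k, g x i k * (Matrix.of fun i j =>
        (D ‖x‖)⁻¹ * (nu x i * nu x j) + (G ‖x‖)⁻¹ * proj x i j) k j =
        (D ‖x‖ * nu x i * nu x k + G ‖x‖ * proj x i k + 0 * proj x i k)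
        * ((D ‖x‖)⁻¹ * nu x j * nu x k + (G ‖x‖)⁻¹ * proj x j k + 0 * proj x i k) := fun k => by
      rw [h.eq x hx, Matrix.of_apply, proj_comm x k j]; ring
    simp only [e, sum_nu_proj_mul h0]
    unfold proj
    split_ifs <;> field_simp <;> ring
  rw [this]; rfl

theorem hasPD_g (i j : Fin n) : HasPD (fun y => g y i j) (fun l =>
    deriv D ‖x‖ * (nu x l * nu x i * nu x j) + deriv G ‖x‖ * (nu x l * proj x i j)
    + (D ‖x‖ - G ‖x‖) / ‖x‖ * (proj x l i * nu x j + nu x i * proj x l j)) x := by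
  have h0 := h.ne_zero hx
  refine ((((hasPD_radial h0 (h.hasDerivAt_D hx)).mul ((hasPD_nu h0 i).mul (hasPD_nu h0 j))).add
    ((hasPD_radial h0 (h.hasDerivAt_G hx)).mul (hasPD_proj h0 i j))).congr ?_).congr_pd ?_
  · filter_upwards [h.eventually_mem hx] with y hy using h.eq y hy i j
  · intro k
    rw [proj_comm x k i, proj_comm x k j]
    ring

theorem christoffel_eq (k i j : Fin n) : christoffel g k i j x =
    halfLogDeriv D ‖x‖ * (nu x i * nu x j * nu x k)
    + halfLogDeriv G ‖x‖ * (nu x i * proj x j k + nu x j * proj x i k)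
    + sphereCoeff D G ‖x‖ * (proj x i j * nu x k) := by
  have h0 := h.ne_zero hx
  have hD := (h.D_pos _ hx).ne'
  have hG := (h.G_pos _ hx).ne'
  have hr := (h.pos _ hx).ne'
  unfold christoffel
  simp only [(h.hasPD_g hx _ _).pd_eq, h.inv_apply hx]
  have e : ∀ l, ((D ‖x‖)⁻¹ * (nu x k * nu x l) + (G ‖x‖)⁻¹ * proj x k l) *
      (deriv D ‖x‖ * (nu x i * nu x j * nu x l) + deriv G ‖x‖ * (nu x i * proj x j l)
        + (D ‖x‖ - G ‖x‖) / ‖x‖ * (proj x i j * nu x l + nu x j * proj x i l)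
        + (deriv D ‖x‖ * (nu x j * nu x i * nu x l) + deriv G ‖x‖ * (nu x j * proj x i l)
        + (D ‖x‖ - G ‖x‖) / ‖x‖ * (proj x j i * nu x l + nu x i * proj x j l))
        - (deriv D ‖x‖ * (nu x l * nu x i * nu x j) + deriv G ‖x‖ * (nu x l * proj x i j)
        + (D ‖x‖ - G ‖x‖) / ‖x‖ * (proj x l i * nu x j + nu x i * proj x l j))) =
      ((D ‖x‖)⁻¹ * nu x k * nu x l + (G ‖x‖)⁻¹ * proj x k l + 0 * proj x i l) *
      ((deriv D ‖x‖ * (nu x i * nu x j) - deriv G ‖x‖ * proj x i j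
        + 2 * ((D ‖x‖ - G ‖x‖) / ‖x‖) * proj x i j) * nu x l + (deriv G ‖x‖ * nu x i) * proj x j l
        + (deriv G ‖x‖ * nu x j) * proj x i l) := fun l => by
    rw [proj_comm x l i, proj_comm x l j, proj_comm x j i]; ring
  simp only [e, sum_nu_proj_mul h0]
  unfold sphereCoeff halfLogDeriv
  rw [proj_comm x k j, proj_comm x k i]
  field_simp
  ring

/-- This trace is ∂ᵢ log √det g, where det g = D G^{n-1}. -/
theorem sum_christoffel (i : Fin n) : ∑ k, christoffel g k i k x =
    (halfLogDeriv D ‖x‖ + (n - 1) * halfLogDeriv G ‖x‖) * nu x i := by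
  have h0 := h.ne_zero hx
  simp only [h.christoffel_eq hx]
  have e : ∀ k, halfLogDeriv D ‖x‖ * (nu x i * nu x k * nu x k)
    + halfLogDeriv G ‖x‖ * (nu x i * proj x k k + nu x k * proj x i k)
    + sphereCoeff D G ‖x‖ * (proj x i k * nu x k) =
    halfLogDeriv D ‖x‖ * nu x i * (nu x k * nu x k) + halfLogDeriv G ‖x‖ * nu x i * proj x k k
    + halfLogDeriv G ‖x‖ * (proj x i k * nu x k)
    + sphereCoeff D G ‖x‖ * (proj x i k * nu x k) := fun k => by ring
  simp only [e, Finset.sum_add_distrib, ← Finset.mul_sum, sum_nu_sq h0, sum_proj_nu h0,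
    sum_proj_self h0]
  ring

theorem hasPD_christoffel (k i j : Fin n) : HasPD (christoffel g k i j) (fun l =>
    deriv (halfLogDeriv D) ‖x‖ * nu x l * (nu x i * nu x j * nu x k)
    + halfLogDeriv D ‖x‖ / ‖x‖ * (proj x i l * nu x j * nu x k + nu x i * proj x j l * nu x k
      + nu x i * nu x j * proj x k l)
    + deriv (halfLogDeriv G) ‖x‖ * nu x l * (nu x i * proj x j k + nu x j * proj x i k)
    + halfLogDeriv G ‖x‖ / ‖x‖ * (proj x i l * proj x j k + proj x j l * proj x i k
      - nu x i * (proj x j l * nu x k + nu x j * proj x k l)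
      - nu x j * (proj x i l * nu x k + nu x i * proj x k l))
    + deriv (sphereCoeff D G) ‖x‖ * nu x l * (proj x i j * nu x k)
    + sphereCoeff D G ‖x‖ / ‖x‖ * (proj x i j * proj x k l
      - (proj x i l * nu x j + nu x i * proj x j l) * nu x k)) x := by
  have h0 := h.ne_zero hx
  have N := hasPD_nu h0
  have Q := hasPD_proj h0
  have hβ := hasPD_radial h0 (h.hasDerivAt_of_contDiffOn h.contDiffOn_beta hx)
  have ha := hasPD_radial h0 (h.hasDerivAt_of_contDiffOn h.contDiffOn_a hx)
  have hb := hasPD_radial h0 (h.hasDerivAt_of_contDiffOn h.contDiffOn_b hx)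
  refine (((hβ.mul (((N i).mul (N j)).mul (N k))).add
    (ha.mul (((N i).mul (Q j k)).add ((N j).mul (Q i k))))).add
    (hb.mul ((Q i j).mul (N k))) |>.congr ?_).congr_pd fun l => ?_
  · filter_upwards [h.eventually_mem hx] with y hy using h.christoffel_eq hy k i j
  · ring

theorem sum_pd_christoffel (i j : Fin n) : ∑ k, pd k (christoffel g k i j) x =
    (deriv (halfLogDeriv D) ‖x‖ + (n - 1) * halfLogDeriv D ‖x‖ / ‖x‖
      - 2 * (n - 1) * halfLogDeriv G ‖x‖ / ‖x‖) * (nu x i * nu x j)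
    + (2 * halfLogDeriv G ‖x‖ / ‖x‖ + deriv (sphereCoeff D G) ‖x‖
      + (n - 1) * sphereCoeff D G ‖x‖ / ‖x‖) * proj x i j := by
  have h0 := h.ne_zero hx
  simp only [(h.hasPD_christoffel hx _ _ _).pd_eq]
  generalize deriv (halfLogDeriv D) ‖x‖ = β'
  generalize deriv (halfLogDeriv G) ‖x‖ = a'
  generalize deriv (sphereCoeff D G) ‖x‖ = b'
  generalize halfLogDeriv D ‖x‖ = β
  generalize halfLogDeriv G ‖x‖ = a
  generalize sphereCoeff D G ‖x‖ = b
  have e : ∀ k, β' * nu x k * (nu x i * nu x j * nu x k)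
    + β / ‖x‖ * (proj x i k * nu x j * nu x k + nu x i * proj x j k * nu x k
      + nu x i * nu x j * proj x k k)
    + a' * nu x k * (nu x i * proj x j k + nu x j * proj x i k)
    + a / ‖x‖ * (proj x i k * proj x j k + proj x j k * proj x i k
      - nu x i * (proj x j k * nu x k + nu x j * proj x k k)
      - nu x j * (proj x i k * nu x k + nu x i * proj x k k))
    + b' * nu x k * (proj x i j * nu x k)
    + b / ‖x‖ * (proj x i j * proj x k k
      - (proj x i k * nu x j + nu x i * proj x j k) * nu x k) =
    (β' * (nu x i * nu x j) + b' * proj x i j) * (nu x k * nu x k)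
    + (β / ‖x‖ * (nu x i * nu x j) - 2 * (a / ‖x‖) * (nu x i * nu x j) + b / ‖x‖ * proj x i j)
      * proj x k k
    + (β / ‖x‖ * nu x j + a' * nu x j - a / ‖x‖ * nu x j - b / ‖x‖ * nu x j)
      * (proj x i k * nu x k)
    + (β / ‖x‖ * nu x i + a' * nu x i - a / ‖x‖ * nu x i - b / ‖x‖ * nu x i)
      * (proj x j k * nu x k)
    + 2 * (a / ‖x‖) * (proj x i k * proj x j k) := fun k => by ring
  simp only [e, Finset.sum_add_distrib, ← Finset.mul_sum, sum_nu_sq h0, sum_proj_nu h0,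
    sum_proj_self h0, sum_proj_proj h0]
  ring

theorem sum_pd_christoffel_trace (i j : Fin n) : ∑ k, pd j (christoffel g k i k) x =
    (deriv (halfLogDeriv D) ‖x‖ + (n - 1) * deriv (halfLogDeriv G) ‖x‖) * (nu x i * nu x j)
    + (halfLogDeriv D ‖x‖ + (n - 1) * halfLogDeriv G ‖x‖) / ‖x‖ * proj x i j := by
  have h0 := h.ne_zero hx
  have e : ∑ k, pd j (christoffel g k i k) x = pd j (fun y => ∑ k, christoffel g k i k y) x := by
    unfold pd
    rw [fderiv_fun_sum fun k _ => (h.hasPD_christoffel hx k i k).1]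
    simp
  rw [e]
  have hβ := hasPD_radial h0 (h.hasDerivAt_of_contDiffOn h.contDiffOn_beta hx)
  have ha := hasPD_radial h0 (h.hasDerivAt_of_contDiffOn h.contDiffOn_a hx)
  rw [(((hβ.add ((HasPD.const ((n : ℝ) - 1) x).mul ha)).mul (hasPD_nu h0 i)).congr ?_).pd_eq]
  · ring
  · filter_upwards [h.eventually_mem hx] with y hy using h.sum_christoffel hy i

theorem sum_christoffel_trace_mul (i j : Fin n) :
    ∑ k, ∑ l, christoffel g k k l x * christoffel g l i j x =
    (halfLogDeriv D ‖x‖ + (n - 1) * halfLogDeriv G ‖x‖) *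
      (halfLogDeriv D ‖x‖ * (nu x i * nu x j) + sphereCoeff D G ‖x‖ * proj x i j) := by
  have h0 := h.ne_zero hx
  rw [Finset.sum_comm]
  simp only [← Finset.sum_mul]
  have e : ∀ l, ∑ k, christoffel g k k l x =
      (halfLogDeriv D ‖x‖ + (n - 1) * halfLogDeriv G ‖x‖) * nu x l := fun l => by
    rw [← h.sum_christoffel hx]
    refine Finset.sum_congr rfl fun k _ => ?_
    rw [h.christoffel_eq hx, h.christoffel_eq hx, proj_comm x k l]; ring
  simp only [e]
  simp only [h.christoffel_eq hx]
  have e : ∀ l, (halfLogDeriv D ‖x‖ + (n - 1) * halfLogDeriv G ‖x‖) * nu x l *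
      (halfLogDeriv D ‖x‖ * (nu x i * nu x j * nu x l)
      + halfLogDeriv G ‖x‖ * (nu x i * proj x j l + nu x j * proj x i l)
      + sphereCoeff D G ‖x‖ * (proj x i j * nu x l)) =
      ((halfLogDeriv D ‖x‖ + (n - 1) * halfLogDeriv G ‖x‖) * nu x l + 0 * proj x i l
        + 0 * proj x i l) *
      ((halfLogDeriv D ‖x‖ * (nu x i * nu x j) + sphereCoeff D G ‖x‖ * proj x i j) * nu x l
      + halfLogDeriv G ‖x‖ * nu x i * proj x j l + halfLogDeriv G ‖x‖ * nu x j * proj x i l) :=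
    fun l => by ring
  simp only [e, sum_nu_proj_mul h0]
  ring

theorem sum_christoffel_mul (i j : Fin n) :
    ∑ k, ∑ l, christoffel g k j l x * christoffel g l i k x =
    (halfLogDeriv D ‖x‖ ^ 2 + (n - 1) * halfLogDeriv G ‖x‖ ^ 2) * (nu x i * nu x j)
    + 2 * halfLogDeriv G ‖x‖ * sphereCoeff D G ‖x‖ * proj x i j := by
  have h0 := h.ne_zero hx
  simp only [h.christoffel_eq hx]
  generalize halfLogDeriv D ‖x‖ = β
  generalize halfLogDeriv G ‖x‖ = a
  generalize sphereCoeff D G ‖x‖ = b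
  have e : ∀ k l, (β * (nu x j * nu x l * nu x k) + a * (nu x j * proj x l k + nu x l * proj x j k)
      + b * (proj x j l * nu x k)) *
      (β * (nu x i * nu x k * nu x l) + a * (nu x i * proj x k l + nu x k * proj x i l)
      + b * (proj x i k * nu x l)) =
      ((β * (nu x j * nu x k) + a * proj x j k) * nu x l + a * nu x j * proj x k l
        + b * nu x k * proj x j l) *
      ((β * (nu x i * nu x k) + b * proj x i k) * nu x l + a * nu x i * proj x k l
        + a * nu x k * proj x i l) := fun k l => by
    rw [proj_comm x l k]; ring
  simp only [e, sum_nu_proj_mul h0]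
  have e : ∀ k, (β * (nu x j * nu x k) + a * proj x j k) * (β * (nu x i * nu x k) + b * proj x i k)
      + a * nu x j * (a * nu x i) * proj x k k + a * nu x j * (a * nu x k) * proj x k i
      + b * nu x k * (a * nu x i) * proj x j k + b * nu x k * (a * nu x k) * proj x j i =
      (β * β * (nu x j * nu x i) + a * b * proj x j i) * (nu x k * nu x k)
      + (β * b * nu x j + a * a * nu x j) * (proj x i k * nu x k)
      + (a * β * nu x i + b * a * nu x i) * (proj x j k * nu x k)
      + a * b * (proj x i k * proj x j k) + a * a * (nu x i * nu x j) * proj x k k := fun k => by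
    rw [proj_comm x k i]; ring
  simp only [e, Finset.sum_add_distrib, ← Finset.mul_sum, sum_nu_sq h0, sum_proj_nu h0,
    sum_proj_self h0, sum_proj_proj h0]
  rw [proj_comm x j i]
  ring

theorem ricci_eq (i j : Fin n) : ricci g i j x =
    ((n - 1) * (halfLogDeriv D ‖x‖ * (halfLogDeriv G ‖x‖ + 1 / ‖x‖) - 2 * halfLogDeriv G ‖x‖ / ‖x‖
      - deriv (halfLogDeriv G) ‖x‖ - halfLogDeriv G ‖x‖ ^ 2)) * (nu x i * nu x j)
    + (deriv (sphereCoeff D G) ‖x‖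
      + ((n - 1) * sphereCoeff D G ‖x‖ - halfLogDeriv D ‖x‖ - (n - 3) * halfLogDeriv G ‖x‖) / ‖x‖
      + sphereCoeff D G ‖x‖ * (halfLogDeriv D ‖x‖ + (n - 3) * halfLogDeriv G ‖x‖)) *
      proj x i j := by
  unfold ricci
  simp only [Finset.sum_add_distrib, Finset.sum_sub_distrib, h.sum_pd_christoffel hx,
    h.sum_pd_christoffel_trace hx, h.sum_christoffel_trace_mul hx, h.sum_christoffel_mul hx]
  ring

/-- T has eigenvalue p in the radial direction and q in the n - 1 tangential ones. Scalar curvature,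
Laplacian, Tr k and Jang's operator are all traces of this kind. -/
theorem sum_inv_mul (T : Matrix (Fin n) (Fin n) ℝ) (p q : ℝ)
    (hT : ∀ i j, T i j = p * (nu x i * nu x j) + q * proj x i j) :
    ∑ i, ∑ j, (g x)⁻¹ i j * T i j = p / D ‖x‖ + (n - 1) * q / G ‖x‖ := by
  have h0 := h.ne_zero hx
  simp only [h.inv_apply hx, hT]
  have e : ∀ i j, ((D ‖x‖)⁻¹ * (nu x i * nu x j) + (G ‖x‖)⁻¹ * proj x i j) *
      (p * (nu x i * nu x j) + q * proj x i j) =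
      ((D ‖x‖)⁻¹ * nu x i * nu x j + (G ‖x‖)⁻¹ * proj x i j + 0 * proj x i j) *
      (p * nu x i * nu x j + q * proj x i j + 0 * proj x i j) := fun i j => by ring
  simp only [e, sum_nu_proj_mul h0]
  have e : ∀ i, (D ‖x‖)⁻¹ * nu x i * (p * nu x i) + (G ‖x‖)⁻¹ * q * proj x i i
      + (G ‖x‖)⁻¹ * 0 * proj x i i + 0 * q * proj x i i + 0 * 0 * proj x i i =
      (D ‖x‖)⁻¹ * p * (nu x i * nu x i) + (G ‖x‖)⁻¹ * q * proj x i i := fun i => by ring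
  simp only [e, Finset.sum_add_distrib, ← Finset.mul_sum, sum_nu_sq h0, sum_proj_self h0]
  field_simp

theorem scalarCurv_eq : scalarCurv g x =
    ((n - 1) * (halfLogDeriv D ‖x‖ * (halfLogDeriv G ‖x‖ + 1 / ‖x‖) - 2 * halfLogDeriv G ‖x‖ / ‖x‖
      - deriv (halfLogDeriv G) ‖x‖ - halfLogDeriv G ‖x‖ ^ 2)) / D ‖x‖
    + (n - 1) * (deriv (sphereCoeff D G) ‖x‖
      + ((n - 1) * sphereCoeff D G ‖x‖ - halfLogDeriv D ‖x‖ - (n - 3) * halfLogDeriv G ‖x‖) / ‖x‖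
      + sphereCoeff D G ‖x‖ * (halfLogDeriv D ‖x‖ + (n - 3) * halfLogDeriv G ‖x‖)) / G ‖x‖ :=
  h.sum_inv_mul hx (Matrix.of fun i j => ricci g i j x) _ _ fun i j => h.ricci_eq hx i j

end

end IsRadialMetric

end Jang

/-! ### Hessian, Jang's operator and the conformal Laplacian on radial functions. -/

namespace Jang

variable {n : ℕ}

namespace IsRadialMetric

variable {g : Tensor2 n} {D G : ℝ → ℝ} {U : Set ℝ}

section
variable (h : IsRadialMetric g D G U)
include h

theorem hasDerivAt_deriv {φ : ℝ → ℝ} (hφ : ContDiffOn ℝ ∞ φ U) {r : ℝ} (hr : r ∈ U) :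
    HasDerivAt (deriv φ) (deriv (deriv φ) r) r :=
  h.hasDerivAt_of_contDiffOn ((contDiffOn_infty_iff_deriv_of_isOpen h.isOpen).1 hφ).2 hr

variable {f : E n → ℝ} {F : ℝ → ℝ} (hF : ContDiffOn ℝ ∞ F U)
  (hf : ∀ y, ‖y‖ ∈ U → f y = F ‖y‖) {x : E n} (hx : ‖x‖ ∈ U)
include hF hf hx

theorem hasPD_radial_fun : HasPD f (fun k => deriv F ‖x‖ * nu x k) x :=
  (hasPD_radial (h.ne_zero hx) (h.hasDerivAt_of_contDiffOn hF hx)).congr <| by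
    filter_upwards [h.eventually_mem hx] with y hy using hf y hy

theorem hessian_eq (i j : Fin n) : hessian g f i j x =
    (deriv (deriv F) ‖x‖ - halfLogDeriv D ‖x‖ * deriv F ‖x‖) * (nu x i * nu x j)
    + G ‖x‖ / D ‖x‖ * (halfLogDeriv G ‖x‖ + 1 / ‖x‖) * deriv F ‖x‖ * proj x i j := by
  have h0 := h.ne_zero hx
  have e : HasPD (pd j f) _ x :=
    ((hasPD_radial h0 (h.hasDerivAt_deriv hF hx)).mul (hasPD_nu h0 j)).congr <| by
      filter_upwards [h.eventually_mem hx] with y hy using (h.hasPD_radial_fun hF hf hy).pd_eq j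
  unfold hessian
  rw [e.pd_eq]
  simp only [(h.hasPD_radial_fun hF hf hx).pd_eq, h.christoffel_eq hx]
  have e : ∀ c, (halfLogDeriv D ‖x‖ * (nu x i * nu x j * nu x c)
      + halfLogDeriv G ‖x‖ * (nu x i * proj x j c + nu x j * proj x i c)
      + sphereCoeff D G ‖x‖ * (proj x i j * nu x c)) * (deriv F ‖x‖ * nu x c) =
      deriv F ‖x‖ * (halfLogDeriv D ‖x‖ * (nu x i * nu x j) + sphereCoeff D G ‖x‖ * proj x i j)
        * (nu x c * nu x c)
      + deriv F ‖x‖ * halfLogDeriv G ‖x‖ * nu x i * (proj x j c * nu x c)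
      + deriv F ‖x‖ * halfLogDeriv G ‖x‖ * nu x j * (proj x i c * nu x c) := fun c => by ring
  simp only [e, Finset.sum_add_distrib, ← Finset.mul_sum, sum_nu_sq h0, sum_proj_nu h0]
  rw [proj_comm x j i]
  unfold sphereCoeff
  ring

theorem laplacian_eq : laplacian g f x =
    (deriv (deriv F) ‖x‖ - halfLogDeriv D ‖x‖ * deriv F ‖x‖
      + (n - 1) * (halfLogDeriv G ‖x‖ + 1 / ‖x‖) * deriv F ‖x‖) / D ‖x‖ := by
  have hD := (h.D_pos _ hx).ne'
  have hG := (h.G_pos _ hx).ne'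
  rw [show laplacian g f x = _ from h.sum_inv_mul hx (Matrix.of fun i j => hessian g f i j x) _ _
    fun i j => h.hessian_eq hF hf hx i j]
  field_simp

theorem grad_eq (a : Fin n) : grad g f a x = deriv F ‖x‖ / D ‖x‖ * nu x a := by
  have h0 := h.ne_zero hx
  unfold grad
  simp only [(h.hasPD_radial_fun hF hf hx).pd_eq, h.inv_apply hx]
  have e : ∀ b, ((D ‖x‖)⁻¹ * (nu x a * nu x b) + (G ‖x‖)⁻¹ * proj x a b) * (deriv F ‖x‖ * nu x b) =
      (D ‖x‖)⁻¹ * deriv F ‖x‖ * nu x a * (nu x b * nu x b)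
      + (G ‖x‖)⁻¹ * deriv F ‖x‖ * (proj x a b * nu x b) := fun b => by ring
  simp only [e, Finset.sum_add_distrib, ← Finset.mul_sum, sum_nu_sq h0, sum_proj_nu h0]
  ring

theorem gradNormSq_eq : gradNormSq g f x = deriv F ‖x‖ ^ 2 / D ‖x‖ := by
  unfold gradNormSq
  simp only [(h.hasPD_radial_fun hF hf hx).pd_eq, h.grad_eq hF hf hx]
  have e : ∀ a, deriv F ‖x‖ / D ‖x‖ * nu x a * (deriv F ‖x‖ * nu x a) =
      deriv F ‖x‖ ^ 2 / D ‖x‖ * (nu x a * nu x a) := fun b => by ring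
  simp only [e, ← Finset.mul_sum, sum_nu_sq (h.ne_zero hx), mul_one]

-- Since df = F'ν, adding df² changes only the radial coefficient. The Jang metric stays in the same
-- class, with the same area radius.
omit hx in
theorem jangMetric : IsRadialMetric (jangMetric g f) (fun r => D r + deriv F r ^ 2) G U where
  isOpen := h.isOpen
  pos := h.pos
  D_pos r hr := by have := h.D_pos r hr; positivity
  G_pos := h.G_pos
  D_smooth := h.D_smooth.add (((contDiffOn_infty_iff_deriv_of_isOpen h.isOpen).1 hF).2.pow 2)
  G_smooth := h.G_smooth
  eq x hx i j := by
    simp only [Jang.jangMetric, Matrix.of_apply, (h.hasPD_radial_fun hF hf hx).pd_eq, h.eq x hx]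
    ring

end

/-- The radial slope `f_s / √(1 + f_s²)` of a radial function. -/
noncomputable def _root_.Jang.slope (D F : ℝ → ℝ) (r : ℝ) : ℝ :=
  deriv F r / Real.sqrt (D r + deriv F r ^ 2)

theorem hasDerivAt_slope (h : IsRadialMetric g D G U) {F : ℝ → ℝ} (hF : ContDiffOn ℝ ∞ F U)
    {r : ℝ} (hr : r ∈ U) : HasDerivAt (slope D F)
      (D r * (deriv (deriv F) r - halfLogDeriv D r * deriv F r) /
        ((D r + deriv F r ^ 2) * Real.sqrt (D r + deriv F r ^ 2))) r := by
  have hD := h.D_pos r hr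
  have hp : 0 < D r + deriv F r ^ 2 := by positivity
  have hs := Real.sqrt_pos.2 hp
  have hsq := Real.sq_sqrt hp.le
  refine ((h.hasDerivAt_deriv hF hr).div
    (((h.hasDerivAt_D hr).add ((h.hasDerivAt_deriv hF hr).pow 2)).sqrt hp.ne')
      hs.ne').congr_deriv ?_
  simp only [Pi.add_apply, Pi.pow_apply]
  set S := Real.sqrt (D r + deriv F r ^ 2)
  rw [← hsq]
  have h2 : D r = S ^ 2 - deriv F r ^ 2 := by rw [hsq]; ring
  unfold halfLogDeriv
  field_simp
  rw [h2]
  push_cast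
  ring

/-- Jang's operator on radial functions, as a first order operator on the slope. -/
theorem jangOperator_eq (h : IsRadialMetric g D G U) {k : Tensor2 n} {kn kt : ℝ → ℝ}
    (hk : ∀ x : E n, ‖x‖ ∈ U → ∀ i j, k x i j =
      D ‖x‖ * kn ‖x‖ * (nu x i * nu x j) + G ‖x‖ * kt ‖x‖ * proj x i j)
    {f : E n → ℝ} {F : ℝ → ℝ} (hF : ContDiffOn ℝ ∞ F U)
    (hf : ∀ y, ‖y‖ ∈ U → f y = F ‖y‖) {x : E n} (hx : ‖x‖ ∈ U) :
    jangOperator g k f x = (deriv (slope D F) ‖x‖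
      + (n - 1) * (halfLogDeriv G ‖x‖ + 1 / ‖x‖) * slope D F ‖x‖) / Real.sqrt (D ‖x‖)
      - ((1 - slope D F ‖x‖ ^ 2) * kn ‖x‖ + (n - 1) * kt ‖x‖) := by
  have hD := h.D_pos _ hx
  have hG := h.G_pos _ hx
  have hbar := h.jangMetric hF hf
  have hp : 0 < D ‖x‖ + deriv F ‖x‖ ^ 2 := hbar.D_pos _ hx
  -- By the rank-one update formula the coefficient tensor is the inverse of g + df², so the
  -- operator is a trace with respect to the Jang metric.
  have e : ∀ a b, (g x)⁻¹ a b - grad g f a x * grad g f b x / (1 + gradNormSq g f x) =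
      (Jang.jangMetric g f x)⁻¹ a b := fun a b => by
    rw [h.inv_apply hx, hbar.inv_apply hx, h.grad_eq hF hf hx, h.grad_eq hF hf hx,
      h.gradNormSq_eq hF hf hx]
    have : 1 + deriv F ‖x‖ ^ 2 / D ‖x‖ = (D ‖x‖ + deriv F ‖x‖ ^ 2) / D ‖x‖ := by field_simp
    rw [this]
    field_simp
    ring
  unfold jangOperator
  simp only [e]
  have := hbar.sum_inv_mul hx (Matrix.of fun a b =>
    hessian g f a b x / Real.sqrt (1 + gradNormSq g f x) - k x a b)
    ((deriv (deriv F) ‖x‖ - halfLogDeriv D ‖x‖ * deriv F ‖x‖) / Real.sqrt (1 + gradNormSq g f x)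
      - D ‖x‖ * kn ‖x‖)
    (G ‖x‖ / D ‖x‖ * (halfLogDeriv G ‖x‖ + 1 / ‖x‖) * deriv F ‖x‖
      / Real.sqrt (1 + gradNormSq g f x) - G ‖x‖ * kt ‖x‖)
    (fun i j => by
      simp only [Matrix.of_apply]
      rw [hk x hx, h.hessian_eq hF hf hx]; ring)
  simp only [Matrix.of_apply] at this
  rw [this, (h.hasDerivAt_slope hF hx).deriv, h.gradNormSq_eq hF hf hx]
  unfold slope
  have : 1 + deriv F ‖x‖ ^ 2 / D ‖x‖ = (D ‖x‖ + deriv F ‖x‖ ^ 2) / D ‖x‖ := by field_simp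
  rw [this, Real.sqrt_div hp.le]
  have hs := Real.sqrt_pos.2 hp
  have hsq := Real.sq_sqrt hp.le
  have hs' := Real.sqrt_pos.2 hD
  have hsq' := Real.sq_sqrt hD.le
  set S := Real.sqrt (D ‖x‖ + deriv F ‖x‖ ^ 2)
  set T := Real.sqrt (D ‖x‖)
  rw [← hsq]
  have h2 : deriv F ‖x‖ ^ 2 = S ^ 2 - T ^ 2 := by rw [hsq, hsq']; ring
  have h3 : 1 - (deriv F ‖x‖ / S) ^ 2 = T ^ 2 / S ^ 2 := by
    rw [div_pow, h2]; field_simp; ring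
  rw [h3, ← hsq']
  field_simp
  ring

theorem hasDerivAt_sphereCoeff (h : IsRadialMetric g D G U) {r : ℝ} (hx : r ∈ U) :
    HasDerivAt (sphereCoeff D G) (-(1 / r ^ 2) - (G r / D r *
      (2 * (halfLogDeriv G r - halfLogDeriv D r)) * (halfLogDeriv G r + 1 / r)
      + G r / D r * (deriv (halfLogDeriv G) r - 1 / r ^ 2))) r := by
  have hr0 := h.pos r hx
  have hD := h.D_pos r hx
  have hG := h.G_pos r hx
  have hq := ((hasDerivAt_const r (1 : ℝ)).div (hasDerivAt_id r) hr0.ne')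
  refine (hq.sub (((h.hasDerivAt_G hx).div (h.hasDerivAt_D hx) hD.ne').mul
    ((h.hasDerivAt_of_contDiffOn h.contDiffOn_a hx).add hq))).congr_deriv ?_
  simp only [id, Pi.add_apply, Pi.div_apply]
  unfold halfLogDeriv
  field_simp
  ring

/-- The scalar curvature in terms of the logarithmic derivative `η = a + 1 / r` of the area
radius. -/
theorem scalarCurv_eq_area (h : IsRadialMetric g D G U) {x : E n} (hx : ‖x‖ ∈ U) :
    scalarCurv g x = (n - 1) * ((n - 2) * (1 / (‖x‖ ^ 2 * G ‖x‖)
      - (halfLogDeriv G ‖x‖ + 1 / ‖x‖) ^ 2 / D ‖x‖)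
      - 2 * ((halfLogDeriv G ‖x‖ + 1 / ‖x‖) ^ 2 + (deriv (halfLogDeriv G) ‖x‖ - 1 / ‖x‖ ^ 2)
        - (halfLogDeriv G ‖x‖ + 1 / ‖x‖) * halfLogDeriv D ‖x‖) / D ‖x‖) := by
  have hr0 := h.pos _ hx
  have hD := h.D_pos _ hx
  have hG := h.G_pos _ hx
  rw [h.scalarCurv_eq hx, (h.hasDerivAt_sphereCoeff hx).deriv]
  unfold sphereCoeff
  field_simp
  ring

/-- The conformal Laplacian of a radial function `exp (c m(r))` with
`m' = ε √D / ρ - ρ' / ρ` and `c = (n-2)/2`. -/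
theorem conformalLaplacian_exp (h : IsRadialMetric g D G U) (hn : 3 ≤ n) (ε : ℝ) {m : ℝ → ℝ}
    (hm : ∀ r ∈ U, HasDerivAt m
      (ε * (Real.sqrt (D r) / (r * Real.sqrt (G r))) - (halfLogDeriv G r + 1 / r)) r)
    {f : E n → ℝ} (hF : ContDiffOn ℝ ∞ m U)
    (hf : ∀ y, ‖y‖ ∈ U → f y = Real.exp (((n : ℝ) - 2) / 2 * m ‖y‖)) {x : E n} (hx : ‖x‖ ∈ U) :
    laplacian g f x - ((n : ℝ) - 2) / (4 * ((n : ℝ) - 1)) * scalarCurv g x * f x =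
      (ε ^ 2 - 1) * (((n : ℝ) - 2) / 2) ^ 2 / (‖x‖ ^ 2 * G ‖x‖) * f x := by
  set r := ‖x‖ with hr
  have hr0 := h.pos r hx
  have hD := h.D_pos r hx
  have hG := h.G_pos r hx
  have hn1 : (n : ℝ) - 1 ≠ 0 := by
    have : (3 : ℝ) ≤ n := by exact_mod_cast hn
    linarith
  set c : ℝ := ((n : ℝ) - 2) / 2 with hc
  -- Conceptually, ρ^{-2}g is the cylinder dτ² + g_{S^{n-1}} with dτ = √D dr/ρ, and its conformal
  -- Laplacian on functions of τ is ∂_τ² - c². It sends e^{cετ} to (ε² - 1)c² e^{cετ}; conformal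
  -- covariance supplies the weight ρ^{-c}. The verification is by direct differentiation.
  set F : ℝ → ℝ := fun r => Real.exp (c * m r) with hFdef
  have hFs : ContDiffOn ℝ ∞ F U := (contDiffOn_const.mul hF).exp
  set m' : ℝ → ℝ := fun r => ε * (Real.sqrt (D r) / (r * Real.sqrt (G r)))
    - (halfLogDeriv G r + 1 / r) with hm'
  have hd1 : ∀ r ∈ U, HasDerivAt F (c * m' r * F r) r := fun r hr => by
    convert ((hm r hr).const_mul c).exp using 1
    simp only [hFdef, hm']; ring
  have hsD := Real.sqrt_pos.2 hD
  have hsG := Real.sqrt_pos.2 hG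
  have hm2 : HasDerivAt m' (ε * (Real.sqrt (D r) / (r * Real.sqrt (G r)) *
      (halfLogDeriv D r - halfLogDeriv G r - 1 / r)) - (deriv (halfLogDeriv G) r - 1 / r ^ 2)) r := by
    have hq : r * Real.sqrt (G r) ≠ 0 := by positivity
    refine ((((h.hasDerivAt_D hx).sqrt hD.ne').div ((hasDerivAt_id r).mul
      ((h.hasDerivAt_G hx).sqrt hG.ne')) hq).const_mul ε |>.sub
      ((h.hasDerivAt_of_contDiffOn h.contDiffOn_a hx).add
        ((hasDerivAt_const r (1 : ℝ)).div (hasDerivAt_id r) hr0.ne'))).congr_deriv ?_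
    simp only [id, Pi.mul_apply]
    unfold halfLogDeriv
    have e1 := Real.sq_sqrt hD.le
    have e2 := Real.sq_sqrt hG.le
    set S := Real.sqrt (D r)
    set T := Real.sqrt (G r)
    rw [← e1, ← e2]
    field_simp
    ring
  have hd2 : HasDerivAt (deriv F) _ r :=
    (((hm2.const_mul c).mul (hd1 r hx))).congr_of_eventuallyEq <| by
      filter_upwards [h.isOpen.mem_nhds hx] with y hy using (hd1 y hy).deriv
  have hb := h.hasDerivAt_sphereCoeff hx
  rw [h.laplacian_eq hFs hf hx, h.scalarCurv_eq hx, hf x hx, ← hr, hd2.deriv, (hd1 r hx).deriv,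
    hb.deriv]
  unfold sphereCoeff
  simp only [hm', hFdef]
  generalize halfLogDeriv D r = β
  generalize deriv (halfLogDeriv G) r = a'
  generalize halfLogDeriv G r = a
  generalize Real.exp (c * m r) = X
  have e1 := Real.sq_sqrt hD.le
  have e2 := Real.sq_sqrt hG.le
  set S := Real.sqrt (D r)
  set T := Real.sqrt (G r)
  rw [← e1, ← e2]
  have hn2 : (n : ℝ) = 2 * c + 2 := by rw [hc]; ring
  rw [hn2] at hn1 ⊢
  have hn1' : (2 * c + 1) ≠ 0 := by
    intro hz; apply hn1; linarith
  clear_value c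
  rw [show 2 * c + 2 - 1 = 2 * c + 1 by ring]
  generalize hN : 2 * c + 1 = N at hn1' ⊢
  obtain rfl : c = (N - 1) / 2 := by rw [← hN]; ring
  field_simp
  ring

end IsRadialMetric

end Jang

namespace Jang

variable {n : ℕ}

/-! ### Smoothness of the curvature operators -/

section Smooth

variable {U : Set (E n)} {g k : Tensor2 n} {f : E n → ℝ}

theorem contDiffOn_pd (hU : IsOpen U) (hf : ContDiffOn ℝ ∞ f U) (i : Fin n) :
    ContDiffOn ℝ ∞ (pd i f) U :=
  (hf.fderiv_of_isOpen hU (m := ∞) (by simp)).clm_apply contDiffOn_const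

theorem contDiffOn_det {A : E n → Matrix (Fin n) (Fin n) ℝ}
    (hA : ∀ i j, ContDiffOn ℝ ∞ (fun x => A x i j) U) :
    ContDiffOn ℝ ∞ (fun x => (A x).det) U := by
  simp only [Matrix.det_apply]
  exact ContDiffOn.sum fun σ _ => (contDiffOn_prod fun i _ => hA _ _).const_smul _

theorem contDiffOn_inv (hg : ∀ i j, ContDiffOn ℝ ∞ (fun x => g x i j) U)
    (hd : ∀ x ∈ U, (g x).PosDef) (i j : Fin n) :
    ContDiffOn ℝ ∞ (fun x => (g x)⁻¹ i j) U := by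
  simp only [Matrix.inv_def, Matrix.smul_apply, smul_eq_mul, Ring.inverse_eq_inv',
    Matrix.adjugate_apply]
  refine ((contDiffOn_det hg).inv fun x hx => (hd x hx).det_pos.ne').mul (contDiffOn_det ?_)
  intro a b
  by_cases h : a = j
  · subst h; simpa using contDiffOn_const
  · simpa [Matrix.updateRow_apply, h] using hg a b

variable (hU : IsOpen U) (hg : ∀ i j, ContDiffOn ℝ ∞ (fun x => g x i j) U)
  (hd : ∀ x ∈ U, (g x).PosDef)
include hU hg hd

theorem contDiffOn_christoffel (k i j : Fin n) : ContDiffOn ℝ ∞ (christoffel g k i j) U :=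
  contDiffOn_const.mul <| ContDiffOn.sum fun l _ => (contDiffOn_inv hg hd k l).mul <|
    ((contDiffOn_pd hU (hg _ _) _).add (contDiffOn_pd hU (hg _ _) _)).sub
      (contDiffOn_pd hU (hg _ _) _)

theorem contDiffOn_scalarCurv : ContDiffOn ℝ ∞ (scalarCurv g) U := by
  have c := contDiffOn_christoffel hU hg hd
  exact ContDiffOn.sum fun i _ => ContDiffOn.sum fun j _ => (contDiffOn_inv hg hd i j).mul <|
    ContDiffOn.sum fun k _ => ((contDiffOn_pd hU (c _ _ _) _).sub
      (contDiffOn_pd hU (c _ _ _) _)).add <| ContDiffOn.sum fun l _ =>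
        ((c _ _ _).mul (c _ _ _)).sub ((c _ _ _).mul (c _ _ _))

theorem contDiffOn_hessian (hf : ContDiffOn ℝ ∞ f U) (i j : Fin n) :
    ContDiffOn ℝ ∞ (hessian g f i j) U :=
  (contDiffOn_pd hU (contDiffOn_pd hU hf j) i).sub <| ContDiffOn.sum fun c _ =>
    (contDiffOn_christoffel hU hg hd _ _ _).mul (contDiffOn_pd hU hf c)

theorem contDiffOn_laplacian (hf : ContDiffOn ℝ ∞ f U) : ContDiffOn ℝ ∞ (laplacian g f) U :=
  ContDiffOn.sum fun i _ => ContDiffOn.sum fun j _ => (contDiffOn_inv hg hd i j).mul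
    (contDiffOn_hessian hU hg hd hf i j)

theorem contDiffOn_grad (hf : ContDiffOn ℝ ∞ f U) (a : Fin n) : ContDiffOn ℝ ∞ (grad g f a) U :=
  ContDiffOn.sum fun b _ => (contDiffOn_inv hg hd a b).mul (contDiffOn_pd hU hf b)

theorem contDiffOn_gradNormSq (hf : ContDiffOn ℝ ∞ f U) : ContDiffOn ℝ ∞ (gradNormSq g f) U :=
  ContDiffOn.sum fun a _ => (contDiffOn_grad hU hg hd hf a).mul (contDiffOn_pd hU hf a)

omit hU hg in
theorem gradNormSq_nonneg {x : E n} (hx : x ∈ U) : 0 ≤ gradNormSq g f x := by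
  have := (hd x hx).inv.posSemidef.dotProduct_mulVec_nonneg (fun a => pd a f x)
  simp only [star_trivial] at this
  refine this.trans_eq ?_
  simp only [gradNormSq, grad, dotProduct, Matrix.mulVec, mul_comm]

theorem contDiffOn_jangOperator (hk : ∀ i j, ContDiffOn ℝ ∞ (fun x => k x i j) U)
    (hf : ContDiffOn ℝ ∞ f U) : ContDiffOn ℝ ∞ (jangOperator g k f) U := by
  have hW : ContDiffOn ℝ ∞ (fun x => 1 + gradNormSq g f x) U :=
    contDiffOn_const.add (contDiffOn_gradNormSq hU hg hd hf)
  have hp : ∀ x ∈ U, 0 < 1 + gradNormSq g f x := fun x hx => by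
    have := gradNormSq_nonneg (f := f) hd hx; positivity
  have hγ := contDiffOn_grad hU hg hd hf
  exact ContDiffOn.sum fun i _ => ContDiffOn.sum fun j _ =>
    ((contDiffOn_inv hg hd i j).sub (((hγ i).mul (hγ j)).div hW fun x hx => (hp x hx).ne')).mul
    (((contDiffOn_hessian hU hg hd hf i j).div (hW.sqrt fun x hx => (hp x hx).ne')
      fun x hx => (Real.sqrt_pos.2 (hp x hx)).ne').sub (hk i j))

omit hd in
theorem contDiffOn_jangMetric (hf : ContDiffOn ℝ ∞ f U) (i j : Fin n) :
    ContDiffOn ℝ ∞ (fun x => jangMetric g f x i j) U :=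
  (hg i j).add ((contDiffOn_pd hU hf i).mul (contDiffOn_pd hU hf j))

omit hU hg in
theorem posDef_jangMetric {x : E n} (hx : x ∈ U) : (jangMetric g f x).PosDef := by
  have : jangMetric g f x = g x + Matrix.vecMulVec (fun a => pd a f x) (star fun a => pd a f x) := by
    ext i j
    simp [jangMetric, Matrix.vecMulVec_apply]
  rw [this]
  exact (hd x hx).add_posSemidef (Matrix.posSemidef_vecMulVec_self_star _)

end Smooth

/-! ### The maximum principle -/

theorem pd_eq_zero_of_isLocalMax {y : E n → ℝ} {x : E n} (h : IsLocalMax y x) (i : Fin n) :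
    pd i y x = 0 := by
  unfold pd; rw [h.fderiv_eq_zero]; rfl

/-- With φ'' > 0 the point would also be a local minimum, so φ would be locally constant and φ'' =
0. -/
theorem deriv_deriv_nonpos_of_isLocalMax {φ : ℝ → ℝ} {t : ℝ} (h : IsLocalMax φ t)
    (hc : ContinuousAt φ t) : deriv (deriv φ) t ≤ 0 := by
  by_contra! hpos
  have hmin : IsLocalMin φ t := isLocalMin_of_deriv_deriv_pos hpos h.deriv_eq_zero hc
  have he : φ =ᶠ[𝓝 t] fun _ => φ t := by
    filter_upwards [h, hmin] with s h1 h2 using le_antisymm h1 h2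
  have : deriv φ =ᶠ[𝓝 t] deriv (fun _ => φ t) := he.deriv
  rw [this.deriv_eq] at hpos
  simp at hpos

/-- Restriction to the line t ↦ x + tw reduces this to the one-variable second derivative test. -/
theorem sum_pd_pd_nonpos_of_isLocalMax {U : Set (E n)} (hU : IsOpen U) {y : E n → ℝ}
    (hy : ContDiffOn ℝ ∞ y U) {x : E n} (hx : x ∈ U) (h : IsLocalMax y x) (w : Fin n → ℝ) :
    ∑ i, ∑ j, w i * w j * pd i (pd j y) x ≤ 0 := by
  set W : E n := WithLp.toLp 2 w with hW
  have hWs : W = ∑ i, w i • EuclideanSpace.single i (1 : ℝ) := by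
    ext j; simp [hW, Finset.sum_apply, Pi.single_apply]
  have hγ : ∀ t, HasDerivAt (fun t : ℝ => x + t • W) W t := fun t => by
    simpa using ((hasDerivAt_id t).smul_const W).const_add x
  have hdir : ∀ (F : E n → ℝ), ContDiffOn ℝ ∞ F U → ∀ t, x + t • W ∈ U →
      HasDerivAt (fun t : ℝ => F (x + t • W)) (∑ i, w i * pd i F (x + t • W)) t := by
    intro F hF t ht
    have := (((hF.contDiffAt (hU.mem_nhds ht)).differentiableAt (by simp)).hasFDerivAt).comp_hasDerivAt
      t (hγ t)
    refine this.congr_deriv ?_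
    simp only [hWs, map_sum, map_smul, smul_eq_mul, pd]
  have hmem : ∀ᶠ t : ℝ in 𝓝 0, x + t • W ∈ U := by
    have : ContinuousAt (fun t : ℝ => x + t • W) 0 := (hγ 0).continuousAt
    exact this.preimage_mem_nhds (hU.mem_nhds (by simpa using hx))
  have h0 : x + (0 : ℝ) • W ∈ U := by simpa using hx
  have hmax : IsLocalMax (fun t : ℝ => y (x + t • W)) 0 := by
    have hc : Tendsto (fun t : ℝ => x + t • W) (𝓝 0) (𝓝 x) := by
      simpa using (hγ 0).continuousAt.tendsto
    have := hc.eventually h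
    filter_upwards [this] with t ht
    simpa using ht
  have h2 := deriv_deriv_nonpos_of_isLocalMax hmax (hdir y hy 0 h0).continuousAt
  have h3 : deriv (fun t : ℝ => y (x + t • W)) =ᶠ[𝓝 0]
      fun t => ∑ i, w i * pd i y (x + t • W) := by
    filter_upwards [hmem] with t ht using (hdir y hy t ht).deriv
  have h4 : HasDerivAt (fun t : ℝ => ∑ j, w j * pd j y (x + t • W))
      (∑ j, w j * ∑ i, w i * pd i (pd j y) (x + (0 : ℝ) • W)) 0 :=
    HasDerivAt.fun_sum fun j _ => (hdir _ (contDiffOn_pd hU hy j) 0 h0).const_mul (w j)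
  rw [h3.deriv_eq, h4.deriv] at h2
  refine le_trans (le_of_eq ?_) h2
  rw [Finset.sum_comm]
  refine Finset.sum_congr rfl fun j _ => ?_
  rw [Finset.mul_sum]
  refine Finset.sum_congr rfl fun i _ => ?_
  simp; ring

/-- At a critical point the Christoffel terms drop out, and g⁻¹ is a sum of rank-one squares, each
contributing a second derivative along a line. -/
theorem laplacian_nonpos_of_isLocalMax {U : Set (E n)} (hU : IsOpen U) {g : Tensor2 n}
    {y : E n → ℝ} (hy : ContDiffOn ℝ ∞ y U) {x : E n} (hx : x ∈ U) (hd : (g x).PosDef)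
    (h : IsLocalMax y x) : laplacian g y x ≤ 0 := by
  obtain ⟨m, B, hB⟩ := Matrix.posSemidef_iff_eq_sum_vecMulVec.1 hd.inv.posSemidef
  unfold laplacian hessian
  simp only [pd_eq_zero_of_isLocalMax h, mul_zero, Finset.sum_const_zero, sub_zero]
  have : ∀ a b, (g x)⁻¹ a b = ∑ c, B c a * B c b := fun a b => by
    rw [hB, Matrix.sum_apply]; simp [Matrix.vecMulVec_apply]
  simp only [this, Finset.sum_mul]
  have e : ∀ a, ∑ b, ∑ c, B c a * B c b * pd a (pd b y) x =
      ∑ c, ∑ b, B c a * B c b * pd a (pd b y) x := fun a => Finset.sum_comm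
  simp only [e]
  rw [Finset.sum_comm]
  exact Finset.sum_nonpos fun c _ => sum_pd_pd_nonpos_of_isLocalMax hU hy hx h (B c)

theorem pd_sub_mul {U : Set (E n)} (hU : IsOpen U) {u v : E n → ℝ} (hu : ContDiffOn ℝ ∞ u U)
    (hv : ContDiffOn ℝ ∞ v U) (c : ℝ) {x : E n} (hx : x ∈ U) (i : Fin n) :
    pd i (fun y => u y - c * v y) x = pd i u x - c * pd i v x := by
  have hu' := hasPD_of_differentiableAt
    ((hu.contDiffAt (hU.mem_nhds hx)).differentiableAt (by simp))
  have hv' := hasPD_of_differentiableAt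
    ((hv.contDiffAt (hU.mem_nhds hx)).differentiableAt (by simp))
  rw [(hu'.sub ((HasPD.const c x).mul hv')).pd_eq]
  ring

theorem laplacian_sub_mul {U : Set (E n)} (hU : IsOpen U) (g : Tensor2 n) {u v : E n → ℝ}
    (hu : ContDiffOn ℝ ∞ u U) (hv : ContDiffOn ℝ ∞ v U) (c : ℝ) {x : E n} (hx : x ∈ U) :
    laplacian g (fun y => u y - c * v y) x = laplacian g u x - c * laplacian g v x := by
  have e : ∀ i j, hessian g (fun y => u y - c * v y) i j x =
      hessian g u i j x - c * hessian g v i j x := fun i j => by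
    unfold hessian
    have : pd i (pd j fun y => u y - c * v y) x = pd i (pd j u) x - c * pd i (pd j v) x := by
      rw [← pd_sub_mul hU (contDiffOn_pd hU hu j) (contDiffOn_pd hU hv j) c hx]
      refine pd_congr ?_ i
      filter_upwards [hU.mem_nhds hx] with y hy using pd_sub_mul hU hu hv c hy j
    rw [this]
    simp only [pd_sub_mul hU hu hv c hx, mul_sub, Finset.sum_sub_distrib, Finset.mul_sum]
    simp only [mul_left_comm c]
    ring
  unfold laplacian
  simp only [e, mul_sub, Finset.sum_sub_distrib, Finset.mul_sum, mul_left_comm c]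

/-- If `L H < 0` for a positive function `H` of the domain, then two solutions of `L u = 0` whose
difference is `o(H)` at the ends of the domain agree, where `L = Δ_g - q`. -/
theorem le_of_supersolution {U : Set (E n)} (hU : IsOpen U) {g : Tensor2 n}
    (hd : ∀ x ∈ U, (g x).PosDef) {q u v H : E n → ℝ}
    (hu : ContDiffOn ℝ ∞ u U) (hv : ContDiffOn ℝ ∞ v U) (hH : ContDiffOn ℝ ∞ H U)
    (hH0 : ∀ x ∈ U, 0 < H x)
    (eu : ∀ x ∈ U, laplacian g u x - q x * u x = 0)
    (ev : ∀ x ∈ U, laplacian g v x - q x * v x = 0)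
    (eH : ∀ x ∈ U, laplacian g H x - q x * H x < 0)
    (hends : ∀ ε > 0, ∃ K ⊆ U, IsCompact K ∧ ∀ x ∈ U, x ∉ K → (u x - v x) / H x < ε) :
    ∀ x ∈ U, u x ≤ v x := by
  intro x hx
  by_contra! hlt
  set z : E n → ℝ := fun x => (u x - v x) / H x with hz
  have hzx : 0 < z x := div_pos (sub_pos.2 hlt) (hH0 x hx)
  obtain ⟨K, hKU, hK, hKz⟩ := hends (z x) hzx
  have hxK : x ∈ K := by
    by_contra hxK
    exact lt_irrefl _ (hKz x hx hxK)
  have hzc : ContinuousOn z U := (hu.continuousOn.sub hv.continuousOn).div hH.continuousOn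
    fun x hx => (hH0 x hx).ne'
  obtain ⟨p, hpK, hp⟩ := hK.exists_isMaxOn ⟨x, hxK⟩ (hzc.mono hKU)
  have hpU := hKU hpK
  have hzp : 0 < z p := hzx.trans_le (hp hxK)
  have hmax : ∀ y ∈ U, z y ≤ z p := fun y hy => by
    by_cases hyK : y ∈ K
    · exact hp hyK
    · exact (hKz y hy hyK).le.trans (hp hxK)
  -- At the maximum p of (u - v)/H the function Y = u - v - z(p)H touches 0 from below. So ΔY(p) ≤ 0
  -- and the q-term vanishes there, while LY = -z(p) LH > 0.
  set Y : E n → ℝ := fun y => (u y - 1 * v y) - z p * H y with hY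
  have huv : ContDiffOn ℝ ∞ (fun y => u y - 1 * v y) U := hu.sub (contDiffOn_const.mul hv)
  have hYs : ContDiffOn ℝ ∞ Y U := huv.sub (contDiffOn_const.mul hH)
  have hYp : Y p = 0 := by
    simp only [hY, hz]
    have := (hH0 p hpU).ne'
    field_simp; ring
  have hYmax : IsLocalMax Y p := by
    filter_upwards [hU.mem_nhds hpU] with y hy
    rw [hYp]
    have := hmax y hy
    rw [hz] at this
    simp only [div_le_iff₀ (hH0 y hy)] at this
    simp only [hY, hz]
    linarith
  have h1 := laplacian_nonpos_of_isLocalMax hU hYs hpU (hd p hpU) hYmax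
  rw [laplacian_sub_mul hU g huv hH _ hpU, laplacian_sub_mul hU g hu hv _ hpU] at h1
  have h2 := eu p hpU
  have h3 := ev p hpU
  have h4 := mul_neg_of_pos_of_neg hzp (eH p hpU)
  have h5 : q p * Y p = 0 := by rw [hYp, mul_zero]
  simp only [hY] at h5
  nlinarith

end Jang

namespace Jang

variable {n : ℕ}

/-! ### Even functions of one variable and radial functions -/

/-- Each differentiation under the integral produces one more factor τ; a general power m is carried
so that the induction in `contDiff_integral_pow_mul` closes. -/
theorem hasDerivAt_integral_pow_mul {F : ℝ → ℝ} (hF : ContDiff ℝ 1 F) (m : ℕ) (x : ℝ) :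
    HasDerivAt (fun x => ∫ τ in (0:ℝ)..1, τ ^ m * F (τ * x))
      (∫ τ in (0:ℝ)..1, τ ^ (m + 1) * deriv F (τ * x)) x := by
  have hF' : Continuous (deriv F) := hF.continuous_deriv le_rfl
  obtain ⟨C, hC⟩ := (isCompact_Icc (a := (-(|x| + 1))) (b := |x| + 1)).exists_bound_of_continuousOn
    hF'.continuousOn
  have hbd : ∀ τ ∈ Set.uIoc (0:ℝ) 1, ∀ y ∈ Metric.ball x 1, ‖τ ^ (m + 1) * deriv F (τ * y)‖ ≤ C := by
    intro τ hτ y hy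
    rw [Set.uIoc_of_le zero_le_one] at hτ
    have hy1 : |y| ≤ |x| + 1 := by
      have := abs_sub_abs_le_abs_sub y x
      rw [Metric.mem_ball, Real.dist_eq] at hy
      linarith
    have hty : |τ * y| ≤ |x| + 1 := by
      rw [abs_mul, abs_of_pos hτ.1]
      exact (mul_le_of_le_one_left (abs_nonneg _) hτ.2).trans hy1
    rw [norm_mul, norm_pow, Real.norm_eq_abs, abs_of_pos hτ.1]
    exact (mul_le_of_le_one_left (norm_nonneg _) (pow_le_one₀ hτ.1.le hτ.2)).trans
      (hC _ (abs_le.1 hty))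
  have hc : ∀ (j : ℕ) {f : ℝ → ℝ}, Continuous f → ∀ y, Continuous fun τ : ℝ => τ ^ j * f (τ * y) :=
    fun j f hf y => by fun_prop
  refine (intervalIntegral.hasDerivAt_integral_of_dominated_loc_of_deriv_le
    (F := fun x τ => τ ^ m * F (τ * x)) (F' := fun x τ => τ ^ (m + 1) * deriv F (τ * x))
    (bound := fun _ => C) (Metric.ball_mem_nhds x one_pos) ?_ ?_ ?_ ?_ ?_ ?_).2
  · exact Eventually.of_forall fun y => (hc m hF.continuous y).aestronglyMeasurable
  · exact (hc m hF.continuous x).intervalIntegrable _ _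
  · exact (hc (m + 1) hF' x).aestronglyMeasurable
  · exact Eventually.of_forall fun τ hτ y hy => hbd τ hτ y hy
  · simp
  · refine Eventually.of_forall fun τ _ y _ => ?_
    have h1 : HasDerivAt F (deriv F (τ * y)) (τ * y) :=
      ((hF.differentiable (by simp)) _).hasDerivAt
    have h2 : HasDerivAt (fun y => τ * y) τ y := by simpa using (hasDerivAt_id y).const_mul τ
    refine ((h1.comp y h2).const_mul (τ ^ m)).congr_deriv ?_
    ring

theorem contDiff_integral_pow_mul {F : ℝ → ℝ} {k : ℕ} (hF : ContDiff ℝ k F) (m : ℕ) :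
    ContDiff ℝ k (fun x => ∫ τ in (0:ℝ)..1, τ ^ m * F (τ * x)) := by
  induction k generalizing F m with
  | zero =>
    have hc : Continuous F := hF.continuous
    refine contDiff_zero.2 ?_
    exact intervalIntegral.continuous_parametric_intervalIntegral_of_continuous' (by fun_prop) 0 1
  | succ k ih =>
    have h1 : ContDiff ℝ 1 F := hF.of_le (by simp)
    have hd := hasDerivAt_integral_pow_mul h1 m
    rw [Nat.cast_succ, contDiff_succ_iff_deriv] at hF ⊢
    refine ⟨fun x => (hd x).differentiableAt, by simp, ?_⟩
    rw [funext fun x => (hd x).deriv]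
    exact ih hF.2.2 (m + 1)

/-- Hadamard's lemma on the line. -/
theorem exists_eq_mul_of_contDiff {N : ℝ → ℝ} (hN : ContDiff ℝ ∞ N) (h0 : N 0 = 0) :
    ∃ h : ℝ → ℝ, ContDiff ℝ ∞ h ∧ ∀ r, N r = r * h r := by
  refine ⟨fun x => ∫ τ in (0:ℝ)..1, τ ^ 0 * deriv N (τ * x), ?_, fun r => ?_⟩
  · rw [contDiff_infty]
    exact fun k => contDiff_integral_pow_mul ((contDiff_infty.1
      (contDiff_infty_iff_deriv.1 hN).2) k) 0
  · simp only [pow_zero, one_mul]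
    have e := intervalIntegral.mul_integral_comp_mul_right (f := deriv N) (a := 0) (b := 1) (c := r)
    rw [e, zero_mul, one_mul, intervalIntegral.integral_deriv_eq_sub]
    · rw [h0, sub_zero]
    · exact fun x _ => hN.differentiable (by simp) x
    · exact ((contDiff_infty_iff_deriv.1 hN).2.continuous).intervalIntegrable _ _

theorem deriv_neg_of_even {F : ℝ → ℝ} (hF : Function.Even F) (r : ℝ) :
    deriv F (-r) = -deriv F r := by
  have h := deriv_comp_neg F r
  rw [show (fun x => F (-x)) = F from funext hF] at h
  rw [h, neg_neg]

theorem deriv_zero_of_even {F : ℝ → ℝ} (hF : Function.Even F) : deriv F 0 = 0 := by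
  have := deriv_neg_of_even hF 0
  rw [neg_zero] at this; linarith

/-- An odd smooth function is `r` times an even smooth one. -/
theorem exists_even_of_odd {N : ℝ → ℝ} (hN : ContDiff ℝ ∞ N) (ho : Function.Odd N) :
    ∃ h : ℝ → ℝ, ContDiff ℝ ∞ h ∧ Function.Even h ∧ ∀ r, N r = r * h r := by
  have h0 : N 0 = 0 := by have := ho 0; rw [neg_zero] at this; linarith
  obtain ⟨h, hs, hr⟩ := exists_eq_mul_of_contDiff hN h0
  refine ⟨h, hs, ?_, hr⟩
  have : ∀ r ≠ 0, h (-r) = h r := fun r hr0 => by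
    have h1 := ho r
    rw [hr, hr] at h1
    have : r * (h (-r) - h r) = 0 := by linarith
    rcases mul_eq_zero.1 this with h2 | h2
    · exact absurd h2 hr0
    · linarith
  intro r
  by_cases hr0 : r = 0
  · simp [hr0]
  · exact this r hr0

/-- Away from 0 the differential is F'(r)/r · ⟨x, ·⟩. Writing F' = r h removes the division by r,
and at the origin F'(0) = 0 gives the same formula. -/
theorem hasFDerivAt_comp_norm_of_even {F h : ℝ → ℝ} (hF : ContDiff ℝ ∞ F)
    (hh : ∀ r, deriv F r = r * h r) (x : E n) :
    HasFDerivAt (fun x : E n => F ‖x‖) (h ‖x‖ • innerSL ℝ x) x := by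
  have hd := (hF.differentiable (by simp) ‖x‖).hasDerivAt
  rw [hh] at hd
  by_cases hx : x = 0
  · subst hx
    simp only [norm_zero, zero_mul, map_zero, smul_zero] at hd ⊢
    rw [hasFDerivAt_iff_isLittleO_nhds_zero]
    rw [hasDerivAt_iff_isLittleO_nhds_zero] at hd
    simp only [zero_add, smul_zero, sub_zero, norm_zero, zero_apply] at hd ⊢
    have := hd.comp_tendsto (tendsto_norm_zero (E := E n))
    exact (Asymptotics.isLittleO_norm_right.1 this)
  · have h0 : ‖x‖ ≠ 0 := norm_ne_zero_iff.2 hx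
    have h1 := (hasStrictFDerivAt_norm_sq x).hasFDerivAt.sqrt (by simpa using hx)
    simp only [Real.sqrt_sq (norm_nonneg _)] at h1
    have := hd.hasFDerivAt.comp x h1
    refine this.congr_fderiv ?_
    ext v
    simp
    field_simp

/-- The differential is h(‖x‖)⟨x, ·⟩ with h again smooth and even, so induction on the order of
differentiability applies. -/
theorem contDiff_comp_norm_of_even {F : ℝ → ℝ} (hF : ContDiff ℝ ∞ F) (he : Function.Even F) :
    ContDiff ℝ ∞ (fun x : E n => F ‖x‖) := by
  rw [contDiff_infty]
  intro k
  induction k generalizing F with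
  | zero => exact contDiff_zero.2 (hF.continuous.comp continuous_norm)
  | succ k ih =>
    obtain ⟨h, hs, hev, hr⟩ := exists_even_of_odd (contDiff_infty_iff_deriv.1 hF).2
      (deriv_neg_of_even he)
    have hd := hasFDerivAt_comp_norm_of_even (n := n) hF hr
    rw [Nat.cast_succ, contDiff_succ_iff_fderiv]
    refine ⟨fun x => (hd x).differentiableAt, by simp, ?_⟩
    rw [funext fun x => (hd x).fderiv]
    exact (ih hs hev).smul (innerSL ℝ).contDiff

/-- The radii of the spheres in the interior of the manifold (all reals if `r₀ = 0`). -/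
def radii (r₀ : ℝ) : Set ℝ := {r | r₀ = 0 ∨ r₀ < r}

theorem isOpen_radii (r₀ : ℝ) : IsOpen (radii r₀) := by
  by_cases h : r₀ = 0
  · simp [radii, h]
  · simp only [radii, h, false_or]; exact isOpen_Ioi

theorem isOpen_bulk (n : ℕ) (r₀ : ℝ) : IsOpen (bulk n r₀) :=
  (isOpen_radii r₀).preimage continuous_norm

theorem Ioi_subset_radii (r₀ : ℝ) : Ioi r₀ ⊆ radii r₀ := fun _ h => Or.inr h

theorem contDiffOn_comp_norm {r₀ : ℝ} (hr₀ : 0 ≤ r₀) {F : ℝ → ℝ} (hF : ContDiffOn ℝ ∞ F (radii r₀))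
    (he : r₀ = 0 → Function.Even F) : ContDiffOn ℝ ∞ (fun x : E n => F ‖x‖) (bulk n r₀) := by
  by_cases h : r₀ = 0
  · have : radii r₀ = univ := by simp [radii, h]
    rw [this, contDiffOn_univ] at hF
    exact (contDiff_comp_norm_of_even hF (he h)).contDiffOn
  · intro x hx
    have hx' : r₀ < ‖x‖ := hx.resolve_left h
    have hx0 : x ≠ 0 := norm_ne_zero_iff.1 (hr₀.trans_lt hx').ne'
    exact ((hF.contDiffAt ((isOpen_radii r₀).mem_nhds hx)).comp x
      (contDiffAt_norm ℝ hx0)).contDiffWithinAt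

end Jang

namespace Jang

/-! ### Existence for the slope equation -/

/-- A map which is a half-contraction for the weighted supremum norm has a fixed point. -/
theorem exists_fixedPoint_of_weighted {X : Type*} [TopologicalSpace X] (W : C(X, ℝ))
    (hW : ∀ x, 0 < W x) (T : C(X, ℝ) → C(X, ℝ)) {C : ℝ} (hT0 : ∀ x, |T 0 x| ≤ C * W x)
    (hT : ∀ (v w : C(X, ℝ)) (N : ℝ), 0 ≤ N → (∀ x, |v x - w x| ≤ N * W x) →
      ∀ x, |T v x - T w x| ≤ N / 2 * W x) : ∃ v, T v = v := by
  -- Candidates are W·z with z bounded; in the variable z the weighted estimate is an ordinary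
  -- contraction for the supremum norm.
  obtain ⟨lift, hl⟩ : ∃ lift : BoundedContinuousFunction X ℝ → C(X, ℝ),
      ∀ z x, lift z x = W x * z x := ⟨fun z => W * z.toContinuousMap, fun _ _ => rfl⟩
  have hlift : ∀ z w : BoundedContinuousFunction X ℝ, ∀ x,
      |lift z x - lift w x| ≤ dist z w * W x := fun z w x => by
    have := z.dist_coe_le_dist (g := w) x
    rw [Real.dist_eq] at this
    rw [hl, hl, ← mul_sub, abs_mul, abs_of_pos (hW x), mul_comm]
    exact mul_le_mul_of_nonneg_right this (hW x).le
  have hb : ∀ z : BoundedContinuousFunction X ℝ, ∀ x,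
      ‖T (lift z) x / W x‖ ≤ C + dist z 0 / 2 := fun z x => by
    rw [norm_div, Real.norm_eq_abs, Real.norm_eq_abs, abs_of_pos (hW x), div_le_iff₀ (hW x)]
    have e : lift 0 = 0 := by ext x; simp [hl]
    have h1 := hT (lift z) 0 (dist z 0) dist_nonneg (fun x => by
      have := hlift z 0 x
      rwa [e] at this) x
    have h2 := hT0 x
    have h3 := abs_sub_abs_le_abs_sub (T (lift z) x) (T 0 x)
    linarith
  obtain ⟨S, hSx⟩ : ∃ S : BoundedContinuousFunction X ℝ → BoundedContinuousFunction X ℝ,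
      ∀ z x, S z x = T (lift z) x / W x :=
    ⟨fun z => BoundedContinuousFunction.ofNormedAddCommGroup (fun x => T (lift z) x / W x)
      ((T (lift z)).continuous.div W.continuous fun x => (hW x).ne') _ (hb z), fun _ _ => rfl⟩
  obtain ⟨κ, hκ⟩ : ∃ κ : NNReal, (κ : ℝ) = 1 / 2 := ⟨1 / 2, by norm_num⟩
  have hS : ContractingWith κ S := by
    refine ⟨by rw [← NNReal.coe_lt_coe, hκ]; norm_num, LipschitzWith.of_dist_le_mul fun z w => ?_⟩
    refine (BoundedContinuousFunction.dist_le (by positivity)).2 fun x => ?_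
    have := hT (lift z) (lift w) (dist z w) dist_nonneg (hlift z w) x
    rw [hSx, hSx, Real.dist_eq, ← sub_div, abs_div, abs_of_pos (hW x), div_le_iff₀ (hW x)]
    refine this.trans_eq ?_
    rw [hκ]; ring
  obtain ⟨z, hz⟩ : ∃ z, S z = z := ⟨_, hS.fixedPoint_isFixedPt⟩
  refine ⟨lift z, ContinuousMap.ext fun x => ?_⟩
  have hzx := hSx z x
  rw [hz, eq_div_iff (hW x).ne'] at hzx
  rw [← hzx, hl, mul_comm]

/-- The weight `exp (2 ∫ K)`. -/
noncomputable def odeWeight (K : ℝ → ℝ) (a r : ℝ) : ℝ := Real.exp (2 * ∫ ξ in a..r, K ξ)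

/-- The weight W is chosen with W' = 2KW: integrating a Lipschitz bound K against it returns at most
W/2. This makes the Picard map a half-contraction on the whole line at once. -/
theorem integral_mul_odeWeight {K : ℝ → ℝ} (hK : Continuous K) (a r : ℝ) :
    ∫ ξ in a..r, K ξ * odeWeight K a ξ = (odeWeight K a r - 1) / 2 := by
  have hd : ∀ ξ, HasDerivAt (fun r => odeWeight K a r / 2) (K ξ * odeWeight K a ξ) ξ := fun ξ => by
    have h1 : HasDerivAt (fun r => ∫ ξ in a..r, K ξ) (K ξ) ξ :=
      intervalIntegral.integral_hasDerivAt_right (hK.intervalIntegrable _ _)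
        (hK.stronglyMeasurableAtFilter _ _) hK.continuousAt
    refine ((h1.const_mul 2).exp.div_const 2).congr_deriv ?_
    unfold odeWeight; ring
  have hc : Continuous (odeWeight K a) := by
    have : Continuous fun r => odeWeight K a r / 2 :=
      continuous_iff_continuousAt.2 fun ξ => (hd ξ).continuousAt
    simpa using this.mul_const 2
  rw [intervalIntegral.integral_eq_sub_of_hasDerivAt (fun ξ _ => hd ξ)
    ((hK.mul hc).intervalIntegrable _ _)]
  simp only [odeWeight, intervalIntegral.integral_same, mul_zero, Real.exp_zero]
  ring

theorem continuous_odeWeight {K : ℝ → ℝ} (hK : Continuous K) (a : ℝ) :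
    Continuous (odeWeight K a) := by
  unfold odeWeight
  have : Continuous fun r => ∫ ξ in a..r, K ξ :=
    intervalIntegral.continuous_primitive (fun _ _ => hK.intervalIntegrable _ _) a
  fun_prop

theorem one_le_odeWeight {K : ℝ → ℝ} (hK0 : ∀ r, 0 ≤ K r) {a r : ℝ} (h : a ≤ r) :
    1 ≤ odeWeight K a r :=
  Real.one_le_exp (mul_nonneg zero_le_two (intervalIntegral.integral_nonneg h fun _ _ => hK0 _))

theorem integral_le_odeWeight (K : ℝ → ℝ) (a r : ℝ) (h : 0 ≤ ∫ ξ in a..r, K ξ) :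
    ∫ ξ in a..r, K ξ ≤ odeWeight K a r := by
  have := Real.add_one_le_exp (2 * ∫ ξ in a..r, K ξ)
  unfold odeWeight; linarith

/-- Global existence for `v' = Q(r, v)`, `v(a) = c`, if `Q` is globally Lipschitz in `v`. -/
theorem exists_integral_solution {Q : ℝ → ℝ → ℝ} (hQ : Continuous (Function.uncurry Q))
    {K : ℝ → ℝ} (hK : Continuous K) (hK0 : ∀ r v, |Q r v| ≤ K r)
    (hL : ∀ r v w, |Q r v - Q r w| ≤ K r * |v - w|) (a c : ℝ) :
    ∃ v : ℝ → ℝ, Continuous v ∧ ∀ r, a ≤ r → v r = c + ∫ ξ in a..r, Q ξ (v ξ) := by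
  have hKn : ∀ r, 0 ≤ K r := fun r => (abs_nonneg _).trans (hK0 r 0)
  have hcomp : ∀ v : C(ℝ, ℝ), Continuous fun ξ => Q ξ (v ξ) := fun v =>
    hQ.comp (continuous_id.prodMk v.continuous)
  -- `max r a` freezes the function to the left of a, so that T acts on functions defined on all of
  -- ℝ.
  let T : C(ℝ, ℝ) → C(ℝ, ℝ) := fun v => ⟨fun r => c + ∫ ξ in a..(max r a), Q ξ (v ξ), by
    have : Continuous fun r => ∫ ξ in a..r, Q ξ (v ξ) :=
      intervalIntegral.continuous_primitive (fun _ _ => (hcomp v).intervalIntegrable _ _) a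
    exact continuous_const.add (this.comp (continuous_id.max continuous_const))⟩
  let W : C(ℝ, ℝ) := ⟨fun r => odeWeight K a (max r a),
    (continuous_odeWeight hK a).comp (continuous_id.max continuous_const)⟩
  have hW1 : ∀ r, 1 ≤ W r := fun r => one_le_odeWeight hKn (le_max_right _ _)
  have hWm : ∀ ξ, a ≤ ξ → W ξ = odeWeight K a ξ := fun ξ h => by
    change odeWeight K a (max ξ a) = _
    rw [max_eq_left h]
  obtain ⟨v, hv⟩ := exists_fixedPoint_of_weighted W (fun r => one_pos.trans_le (hW1 r)) T
    (C := |c| + 1) (fun r => by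
      have h1 : |∫ ξ in a..(max r a), Q ξ 0| ≤ ∫ ξ in a..(max r a), K ξ := by
        exact intervalIntegral.norm_integral_le_of_norm_le (f := fun ξ => Q ξ 0)
          (le_max_right r a) (Eventually.of_forall fun ξ _ => hK0 ξ 0)
          (hK.intervalIntegrable (μ := MeasureTheory.volume) _ _)
      have h2 := integral_le_odeWeight K a (max r a) ((abs_nonneg _).trans h1)
      have h3 : |T 0 r| ≤ |c| + |∫ ξ in a..(max r a), Q ξ 0| := abs_add_le _ _
      have h4 : |c| * 1 ≤ |c| * W r := mul_le_mul_of_nonneg_left (hW1 r) (abs_nonneg c)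
      have h5 : W r = odeWeight K a (max r a) := rfl
      linarith)
    (fun v w N hN hvw r => by
      have e : T v r - T w r = ∫ ξ in a..(max r a), (Q ξ (v ξ) - Q ξ (w ξ)) := by
        rw [intervalIntegral.integral_sub ((hcomp v).intervalIntegrable _ _)
          ((hcomp w).intervalIntegrable _ _)]
        change (c + _) - (c + _) = _
        ring
      have h1 : ‖∫ ξ in a..(max r a), (Q ξ (v ξ) - Q ξ (w ξ))‖ ≤
          ∫ ξ in a..(max r a), N * (K ξ * odeWeight K a ξ) := by
        refine intervalIntegral.norm_integral_le_of_norm_le (le_max_right r a)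
          (Eventually.of_forall fun ξ hξ => ?_) ?_
        · have h2 := hvw ξ
          rw [hWm ξ hξ.1.le] at h2
          calc ‖Q ξ (v ξ) - Q ξ (w ξ)‖ ≤ K ξ * |v ξ - w ξ| := hL _ _ _
            _ ≤ K ξ * (N * odeWeight K a ξ) := mul_le_mul_of_nonneg_left h2 (hKn ξ)
            _ = _ := by ring
        · exact (continuous_const.mul (hK.mul (continuous_odeWeight hK a))).intervalIntegrable _ _
      rw [intervalIntegral.integral_const_mul, integral_mul_odeWeight hK, Real.norm_eq_abs,
        ← e] at h1
      have h5 : W r = odeWeight K a (max r a) := rfl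
      rw [h5]
      nlinarith)
  refine ⟨v, v.continuous, fun r hr => ?_⟩
  have := congrArg (fun z : C(ℝ, ℝ) => z r) hv
  change c + ∫ ξ in a..(max r a), Q ξ (v ξ) = v r at this
  rw [max_eq_left hr] at this
  exact this.symm

/-- Global existence for the singular equation `v' = -(m/r) v + Q(r, v)`, in integrated form. -/
theorem exists_integral_solution_singular {Q : ℝ → ℝ → ℝ} (hQ : Continuous (Function.uncurry Q))
    {K : ℝ → ℝ} (hK : Continuous K) (hK0 : ∀ r v, |Q r v| ≤ K r)
    (hL : ∀ r v w, |Q r v - Q r w| ≤ K r * |v - w|) (m : ℕ) :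
    ∃ v : ℝ → ℝ, Continuous v ∧
      ∀ r, v r = r * ∫ τ in (0:ℝ)..1, τ ^ m * Q (τ * |r|) (v (τ * |r|)) := by
  have hKn : ∀ r, 0 ≤ K r := fun r => (abs_nonneg _).trans (hK0 r 0)
  have hcomp : ∀ v : C(ℝ, ℝ), Continuous fun p : ℝ × ℝ =>
      p.2 ^ m * Q (p.2 * |p.1|) (v (p.2 * |p.1|)) := fun v => by
    have h1 : Continuous fun p : ℝ × ℝ => p.2 * |p.1| := by fun_prop
    exact (continuous_snd.pow m).mul (hQ.comp (h1.prodMk (v.continuous.comp h1)))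
  have hcomp1 : ∀ v : C(ℝ, ℝ), ∀ r, Continuous fun τ : ℝ =>
      τ ^ m * Q (τ * |r|) (v (τ * |r|)) := fun v r =>
    (hcomp v).comp (continuous_const.prodMk continuous_id : Continuous fun τ : ℝ => (r, τ))
  -- The equation says (r^m v)' = r^m Q; integrating from 0 and substituting ξ = τr gives this form,
  -- which has no division by r. With |r| inside, only Q on the half-line enters and the solution is
  -- odd.
  let T : C(ℝ, ℝ) → C(ℝ, ℝ) := fun v =>
    ⟨fun r => r * ∫ τ in (0:ℝ)..1, τ ^ m * Q (τ * |r|) (v (τ * |r|)),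
      continuous_id.mul (intervalIntegral.continuous_parametric_intervalIntegral_of_continuous'
        (hcomp v) 0 1)⟩
  let W : C(ℝ, ℝ) := ⟨fun r => odeWeight K 0 |r|, (continuous_odeWeight hK 0).comp continuous_abs⟩
  have hW1 : ∀ r, 1 ≤ W r := fun r => one_le_odeWeight hKn (abs_nonneg _)
  have key : ∀ (r : ℝ) (f : ℝ → ℝ) (k : ℝ → ℝ), Continuous k →
      (∀ τ : ℝ, 0 < τ → |f τ| ≤ k (τ * |r|)) →
      |r * ∫ τ in (0:ℝ)..1, τ ^ m * f τ| ≤ ∫ ξ in (0:ℝ)..|r|, k ξ := by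
    intro r f k hk hf
    have h1 : ‖∫ τ in (0:ℝ)..1, τ ^ m * f τ‖ ≤ ∫ τ in (0:ℝ)..1, k (τ * |r|) := by
      refine intervalIntegral.norm_integral_le_of_norm_le zero_le_one
        (Eventually.of_forall fun τ hτ => ?_) ?_
      · rw [norm_mul, norm_pow, Real.norm_eq_abs, Real.norm_eq_abs, abs_of_pos hτ.1]
        exact (mul_le_of_le_one_left (abs_nonneg _) (pow_le_one₀ hτ.1.le hτ.2)).trans (hf τ hτ.1)
      · exact (hk.comp (by fun_prop : Continuous fun τ : ℝ => τ * |r|)).intervalIntegrable _ _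
    have e := intervalIntegral.mul_integral_comp_mul_right (f := k) (a := 0) (b := 1) (c := |r|)
    rw [zero_mul, one_mul] at e
    rw [abs_mul, ← e]
    exact mul_le_mul_of_nonneg_left h1 (abs_nonneg _)
  obtain ⟨v, hv⟩ := exists_fixedPoint_of_weighted W (fun r => one_pos.trans_le (hW1 r)) T
    (C := 1) (fun r => by
      have h1 : |T 0 r| ≤ ∫ ξ in (0:ℝ)..|r|, K ξ :=
        key r (fun τ => Q (τ * |r|) 0) K hK fun τ _ => hK0 _ _
      rw [one_mul]
      exact h1.trans (integral_le_odeWeight K 0 _ ((abs_nonneg _).trans h1)))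
    (fun v w N hN hvw r => by
      have e : T v r - T w r = r * ∫ τ in (0:ℝ)..1, τ ^ m *
          (Q (τ * |r|) (v (τ * |r|)) - Q (τ * |r|) (w (τ * |r|))) := by
        simp only [mul_sub]
        rw [intervalIntegral.integral_sub ((hcomp1 v r).intervalIntegrable _ _)
          ((hcomp1 w r).intervalIntegrable _ _), mul_sub]
        rfl
      have h1 := key r (fun τ => Q (τ * |r|) (v (τ * |r|)) - Q (τ * |r|) (w (τ * |r|)))
        (fun ξ => N * (K ξ * odeWeight K 0 |ξ|))
        (continuous_const.mul (hK.mul ((continuous_odeWeight hK 0).comp continuous_abs)))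
        fun τ _ => by
          calc _ ≤ K (τ * |r|) * |v (τ * |r|) - w (τ * |r|)| := hL _ _ _
            _ ≤ K (τ * |r|) * (N * odeWeight K 0 (abs (τ * |r|))) :=
              mul_le_mul_of_nonneg_left (hvw _) (hKn _)
            _ = _ := by ring
      have e2 : ∫ ξ in (0:ℝ)..|r|, N * (K ξ * odeWeight K 0 |ξ|) =
          ∫ ξ in (0:ℝ)..|r|, N * (K ξ * odeWeight K 0 ξ) := by
        refine intervalIntegral.integral_congr fun ξ hξ => ?_
        rw [uIcc_of_le (abs_nonneg r)] at hξ
        simp only [abs_of_nonneg hξ.1]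
      rw [← e, e2, intervalIntegral.integral_const_mul, integral_mul_odeWeight hK] at h1
      have h5 : W r = odeWeight K 0 |r| := rfl
      rw [h5]
      nlinarith)
  refine ⟨v, v.continuous, fun r => ?_⟩
  exact (congrArg (fun z : C(ℝ, ℝ) => z r) hv).symm

end Jang

/-! ### Barriers, regularity and global solutions for the Riccati equation. -/

namespace Jang

theorem nonneg_of_hasDerivAt_of_isMax_left {v : ℝ → ℝ} {v' a p : ℝ} (hap : a < p)
    (hd : HasDerivAt v v' p) (hmax : ∀ x ∈ Icc a p, v x ≤ v p) : 0 ≤ v' := by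
  by_contra! hneg
  have h1 := (hasDerivAt_iff_tendsto_slope.1 hd).mono_left (nhdsLT_le_nhdsNE p)
  have h2 : ∀ᶠ x in 𝓝[<] p, _root_.slope v p x < 0 := h1.eventually (gt_mem_nhds hneg)
  have h3 : ∀ᶠ x in 𝓝[<] p, x ∈ Ioo a p := Ioo_mem_nhdsLT hap
  obtain ⟨x, hx2, hx3⟩ := (h2.and h3).exists
  rw [slope_def_field, div_neg_iff] at hx2
  have := hmax x ⟨hx3.1.le, hx3.2.le⟩
  rcases hx2 with h | h
  · linarith [h.1]
  · linarith [h.2, hx3.2]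

/-- A function which decreases wherever it is at least `1` stays below `1`. -/
theorem lt_one_of_barrier {v v' : ℝ → ℝ} {a : ℝ} (hc : ContinuousOn v (Ici a)) (ha : v a ≤ 1)
    (hd : ∀ r, a < r → HasDerivAt v (v' r) r) (hb : ∀ r, a < r → 1 ≤ v r → v' r < 0) {r : ℝ}
    (hr : a < r) : v r < 1 := by
  by_contra! h1
  obtain ⟨p, hp, hmax⟩ := isCompact_Icc.exists_isMaxOn (nonempty_Icc.2 hr.le)
    (hc.mono (Icc_subset_Ici_self : Icc a r ⊆ Ici a))
  have key : ∀ p ∈ Ioc a r, (∀ x ∈ Icc a r, v x ≤ v p) → False := fun p hp hmax => by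
    have h2 : 1 ≤ v p := h1.trans (hmax r ⟨hr.le, le_rfl⟩)
    have := nonneg_of_hasDerivAt_of_isMax_left hp.1 (hd p hp.1)
      fun x hx => hmax x ⟨hx.1, hx.2.trans hp.2⟩
    linarith [hb p hp.1 h2]
  -- If the maximum is at a, then v(a) ≤ 1 ≤ v(r) makes r itself a maximum point, which lies in the
  -- open part.
  rcases hp.1.eq_or_lt with h | h
  · subst h
    exact key r ⟨hr, le_rfl⟩ fun x hx => (hmax hx).trans (ha.trans h1)
  · exact key p ⟨h, hp.2⟩ fun x hx => hmax hx

/-- Bootstrap: the right side is as regular as v, so v gains one derivative each time. -/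
theorem contDiffOn_of_riccati {v q₀ q₁ q₂ : ℝ → ℝ} {I : Set ℝ} (hI : IsOpen I)
    (h₀ : ContDiffOn ℝ ∞ q₀ I) (h₁ : ContDiffOn ℝ ∞ q₁ I) (h₂ : ContDiffOn ℝ ∞ q₂ I)
    (hv : ∀ r ∈ I, HasDerivAt v (q₀ r + q₁ r * v r + q₂ r * v r ^ 2) r) : ContDiffOn ℝ ∞ v I := by
  rw [contDiffOn_infty]
  intro k
  induction k with
  | zero => exact contDiffOn_zero.2 fun r hr => (hv r hr).continuousAt.continuousWithinAt
  | succ k ih =>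
    rw [Nat.cast_succ, contDiffOn_succ_iff_deriv_of_isOpen hI]
    refine ⟨fun r hr => (hv r hr).differentiableAt.differentiableWithinAt, by simp, ?_⟩
    have hk : (k : WithTop ℕ∞) ≤ ∞ := by exact_mod_cast le_top
    refine ((((h₀.of_le hk).add ((h₁.of_le hk).mul ih)).add
      ((h₂.of_le hk).mul (ih.pow 2))).congr fun r hr => ?_)
    rw [(hv r hr).deriv]

/-- Truncation to `[-1, 1]`. -/
noncomputable def clamp (v : ℝ) : ℝ := max (-1) (min 1 v)

theorem continuous_clamp : Continuous clamp := by unfold clamp; fun_prop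

theorem abs_clamp_le (v : ℝ) : |clamp v| ≤ 1 :=
  abs_le.2 ⟨le_max_left _ _, max_le (by norm_num) (min_le_left _ _)⟩

theorem clamp_of_mem {v : ℝ} (h1 : -1 ≤ v) (h2 : v ≤ 1) : clamp v = v := by
  unfold clamp; rw [min_eq_right h2, max_eq_right h1]

theorem clamp_of_one_le {v : ℝ} (h : 1 ≤ v) : clamp v = 1 := by
  unfold clamp; rw [min_eq_left h, max_eq_right (by norm_num)]

theorem clamp_of_le_neg_one {v : ℝ} (h : v ≤ -1) : clamp v = -1 := by
  unfold clamp; rw [min_eq_right (h.trans (by norm_num)), max_eq_left h]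

theorem abs_clamp_sub_le (v w : ℝ) : |clamp v - clamp w| ≤ |v - w| := by
  unfold clamp
  refine (abs_max_sub_max_le_max _ _ _ _).trans ?_
  rw [sub_self, abs_zero, max_eq_right (abs_nonneg _)]
  refine (abs_min_sub_min_le_max _ _ _ _).trans ?_
  rw [sub_self, abs_zero, max_eq_right (abs_nonneg _)]

/-- The truncated Riccati nonlinearity. -/
noncomputable def riccati (q₀ q₁ q₂ : ℝ → ℝ) (r v : ℝ) : ℝ :=
  q₀ r + q₁ r * clamp v + q₂ r * clamp v ^ 2

section
variable {q₀ q₁ q₂ : ℝ → ℝ}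

theorem continuous_riccati (h₀ : Continuous q₀) (h₁ : Continuous q₁) (h₂ : Continuous q₂) :
    Continuous (Function.uncurry (riccati q₀ q₁ q₂)) := by
  have := continuous_clamp
  unfold riccati Function.uncurry
  fun_prop

/-- The factor 2 is slack here; it lets one weight K serve both as bound and as Lipschitz constant,
the latter involving clamp v + clamp w. -/
theorem abs_riccati_le (r v : ℝ) : |riccati q₀ q₁ q₂ r v| ≤ |q₀ r| + |q₁ r| + 2 * |q₂ r| := by
  have hc := abs_clamp_le v
  have h1 : |q₁ r * clamp v| ≤ |q₁ r| := by
    rw [abs_mul]; exact mul_le_of_le_one_right (abs_nonneg _) hc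
  have h2 : |q₂ r * clamp v ^ 2| ≤ |q₂ r| := by
    rw [abs_mul, abs_pow]
    exact mul_le_of_le_one_right (abs_nonneg _) (pow_le_one₀ (abs_nonneg _) hc)
  have h3 := abs_add_le (q₀ r + q₁ r * clamp v) (q₂ r * clamp v ^ 2)
  have h4 := abs_add_le (q₀ r) (q₁ r * clamp v)
  unfold riccati
  linarith [abs_nonneg (q₂ r)]

theorem abs_riccati_sub_le (r v w : ℝ) : |riccati q₀ q₁ q₂ r v - riccati q₀ q₁ q₂ r w| ≤
    (|q₀ r| + |q₁ r| + 2 * |q₂ r|) * |v - w| := by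
  have e : riccati q₀ q₁ q₂ r v - riccati q₀ q₁ q₂ r w =
      (q₁ r + q₂ r * (clamp v + clamp w)) * (clamp v - clamp w) := by unfold riccati; ring
  rw [e, abs_mul]
  refine mul_le_mul ?_ (abs_clamp_sub_le v w) (abs_nonneg _) (by positivity)
  have h1 := abs_add_le (q₁ r) (q₂ r * (clamp v + clamp w))
  have h2 : |q₂ r * (clamp v + clamp w)| ≤ |q₂ r| * 2 := by
    rw [abs_mul]
    refine mul_le_mul_of_nonneg_left ?_ (abs_nonneg _)
    linarith [abs_add_le (clamp v) (clamp w), abs_clamp_le v, abs_clamp_le w]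
  linarith [abs_nonneg (q₀ r)]

/-- For v ≥ 1 the clamped nonlinearity is q₀ + q₁ + q₂ and c v ≤ c, so v' < 0; the case v ≤ -1 is
the reflection. The coefficient c is 0 in the regular problem and -m/r in the singular one. -/
theorem abs_lt_one_of_riccati {v c : ℝ → ℝ} {a : ℝ} (hc : ContinuousOn v (Ici a)) (ha : |v a| ≤ 1)
    (hd : ∀ r, a < r → HasDerivAt v (c r * v r + riccati q₀ q₁ q₂ r (v r)) r)
    (hc0 : ∀ r, a < r → c r ≤ 0)
    (hup : ∀ r, a < r → c r + q₀ r + q₁ r + q₂ r < 0)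
    (hlo : ∀ r, a < r → 0 < -c r + q₀ r - q₁ r + q₂ r) {r : ℝ} (hr : a < r) :
    -1 < v r ∧ v r < 1 := by
  constructor
  · have := lt_one_of_barrier (v := fun r => -v r) hc.neg (by linarith [(abs_le.1 ha).1])
      (fun r hr => (hd r hr).neg) (fun r hr h1 => ?_) hr
    · linarith
    · have h2 : v r ≤ -1 := by linarith
      have h3 := hlo r hr
      have h4 := mul_nonneg_of_nonpos_of_nonpos (hc0 r hr) (by linarith : v r + 1 ≤ 0)
      unfold riccati
      rw [clamp_of_le_neg_one h2]
      nlinarith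
  · refine lt_one_of_barrier hc (abs_le.1 ha).2 hd (fun r hr h1 => ?_) hr
    have h3 := hup r hr
    have h4 := mul_nonpos_of_nonpos_of_nonneg (hc0 r hr) (by linarith : 0 ≤ v r - 1)
    unfold riccati
    rw [clamp_of_one_le h1]
    nlinarith

/-- Solutions of `v' = q₀ + q₁ v + q₂ v²` on `[a, ∞)` with values in `(-1, 1)`. -/
theorem exists_riccati {a c : ℝ} (hc : |c| ≤ 1) (h₀ : ContinuousOn q₀ (Ici a))
    (h₁ : ContinuousOn q₁ (Ici a)) (h₂ : ContinuousOn q₂ (Ici a))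
    (hup : ∀ r, a < r → q₀ r + q₁ r + q₂ r < 0)
    (hlo : ∀ r, a < r → 0 < q₀ r - q₁ r + q₂ r) :
    ∃ v : ℝ → ℝ, ContinuousOn v (Ici a) ∧ v a = c ∧ ∀ r, a < r →
      (-1 < v r ∧ v r < 1) ∧ HasDerivAt v (q₀ r + q₁ r * v r + q₂ r * v r ^ 2) r := by
  have ext : ∀ {q : ℝ → ℝ}, ContinuousOn q (Ici a) → Continuous fun r => q (max r a) := fun hq =>
    hq.comp_continuous (continuous_id.max continuous_const) fun r => le_max_right r a
  have hQ := continuous_riccati (ext h₀) (ext h₁) (ext h₂)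
  set Q := riccati (fun r => q₀ (max r a)) (fun r => q₁ (max r a)) (fun r => q₂ (max r a)) with hQd
  obtain ⟨v, hv, hvi⟩ := exists_integral_solution hQ
    (((ext h₀).abs.add (ext h₁).abs).add (continuous_const.mul (ext h₂).abs))
    (fun r v => abs_riccati_le r v) (fun r v w => abs_riccati_sub_le r v w) a c
  have hcont : Continuous fun ξ => Q ξ (v ξ) := hQ.comp (continuous_id.prodMk hv)
  have hd : ∀ r, a < r → HasDerivAt v (Q r (v r)) r := fun r hr => by
    have h1 : HasDerivAt (fun r => c + ∫ ξ in a..r, Q ξ (v ξ)) (Q r (v r)) r :=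
      (intervalIntegral.integral_hasDerivAt_right (hcont.intervalIntegrable _ _)
        (hcont.stronglyMeasurableAtFilter _ _) hcont.continuousAt).const_add c
    refine h1.congr_of_eventuallyEq ?_
    filter_upwards [lt_mem_nhds hr] with x hx using hvi x hx.le
  have hva : v a = c := by simpa using hvi a le_rfl
  have hb : ∀ r, a < r → -1 < v r ∧ v r < 1 := fun r hr => by
    refine abs_lt_one_of_riccati (c := fun _ => 0) hv.continuousOn (by rw [hva]; exact hc)
      (fun r hr => by simpa using hd r hr) (fun _ _ => le_rfl) (fun r hr => ?_) (fun r hr => ?_) hr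
    · simpa [max_eq_left hr.le] using hup r hr
    · simpa [max_eq_left hr.le] using hlo r hr
  refine ⟨v, hv.continuousOn, hva, fun r hr => ⟨hb r hr, ?_⟩⟩
  refine (hd r hr).congr_deriv ?_
  simp only [hQd, riccati, max_eq_left hr.le, clamp_of_mem (hb r hr).1.le (hb r hr).2.le]

/-- Away from 0 one differentiates r^m v = ∫ ξ^m P. At 0 the difference quotient of v is the
integral itself, with limit P(0)/(m+1), in agreement with the formula. Since the formula has no 1/r,
it can be used for regularity at 0. -/
theorem hasDerivAt_of_singular_integral {P v : ℝ → ℝ} (hP : Continuous P) {m : ℕ}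
    (hv : ∀ r, v r = r * ∫ τ in (0:ℝ)..1, τ ^ m * P (τ * r)) (r : ℝ) :
    HasDerivAt v (P r - m * ∫ τ in (0:ℝ)..1, τ ^ m * P (τ * r)) r := by
  have hc : Continuous fun r => ∫ τ in (0:ℝ)..1, τ ^ m * P (τ * r) :=
    contDiff_zero.1 (contDiff_integral_pow_mul (k := 0) (contDiff_zero.2 hP) m)
  by_cases hr : r = 0
  · subst hr
    have h0 : ∫ τ in (0:ℝ)..1, τ ^ m * P (τ * 0) = P 0 / (m + 1) := by
      simp only [mul_zero, intervalIntegral.integral_mul_const, integral_pow]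
      simp; field_simp
    have e : P 0 - m * ∫ τ in (0:ℝ)..1, τ ^ m * P (τ * 0) =
        ∫ τ in (0:ℝ)..1, τ ^ m * P (τ * 0) := by
      rw [h0]; field_simp; ring
    rw [e, hasDerivAt_iff_tendsto_slope]
    refine (hc.continuousAt (x := 0)).tendsto.mono_left nhdsWithin_le_nhds |>.congr' ?_
    filter_upwards [self_mem_nhdsWithin] with x hx
    have hx : x ≠ 0 := hx
    rw [slope_def_field, hv x, hv 0, zero_mul, sub_zero, sub_zero, mul_div_cancel_left₀ _ hx]
  · have hg : ∀ x, x ^ (m + 1) * ∫ τ in (0:ℝ)..1, τ ^ m * P (τ * x) = ∫ ξ in (0:ℝ)..x, ξ ^ m * P ξ := by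
      intro x
      have e := intervalIntegral.mul_integral_comp_mul_right (f := fun ξ => ξ ^ m * P ξ)
        (a := 0) (b := 1) (c := x)
      rw [zero_mul, one_mul] at e
      rw [← e, pow_succ, mul_comm (x ^ m), mul_assoc, ← intervalIntegral.integral_const_mul]
      simp only [mul_pow]
      congr 1
      refine intervalIntegral.integral_congr fun τ _ => ?_
      ring
    have hcm : Continuous fun ξ : ℝ => ξ ^ m * P ξ := by fun_prop
    have h1 : HasDerivAt (fun x => ∫ ξ in (0:ℝ)..x, ξ ^ m * P ξ) (r ^ m * P r) r :=
      intervalIntegral.integral_hasDerivAt_right (hcm.intervalIntegrable _ _)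
        (hcm.stronglyMeasurableAtFilter _ _) hcm.continuousAt
    have h2 := h1.div (hasDerivAt_pow m r) (pow_ne_zero m hr)
    have h3 : HasDerivAt v _ r := h2.congr_of_eventuallyEq <| by
      filter_upwards [isOpen_ne.mem_nhds hr] with x hx
      have hx : x ≠ 0 := hx
      simp only [Pi.div_apply]
      rw [hv, ← hg, eq_div_iff (pow_ne_zero m hx)]; ring
    refine h3.congr_deriv ?_
    rw [← hg]
    generalize ∫ τ in (0:ℝ)..1, τ ^ m * P (τ * r) = J
    have hm : (m : ℝ) * r ^ (m - 1) * r = m * r ^ m := by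
      rcases m with _ | m
      · simp
      · simp [pow_succ]; ring
    field_simp
    linear_combination (-(r ^ m) * J) * hm

/-- Smooth odd solutions of `v' = -(m/r) v + q₀ + q₁ v + q₂ v²` with values in `(-1, 1)`. -/
theorem exists_riccati_singular {m : ℕ} (h₀ : ContDiff ℝ ∞ q₀) (h₁ : ContDiff ℝ ∞ q₁)
    (h₂ : ContDiff ℝ ∞ q₂) (e₀ : Function.Even q₀) (e₁ : Function.Odd q₁) (e₂ : Function.Even q₂)
    (hup : ∀ r, 0 < r → -(m / r) + q₀ r + q₁ r + q₂ r < 0)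
    (hlo : ∀ r, 0 < r → 0 < m / r + q₀ r - q₁ r + q₂ r) :
    ∃ v : ℝ → ℝ, ContDiff ℝ ∞ v ∧ Function.Odd v ∧ ∀ r, 0 < r → (-1 < v r ∧ v r < 1) ∧
      HasDerivAt v (-(m / r) * v r + (q₀ r + q₁ r * v r + q₂ r * v r ^ 2)) r := by
  have hQ := continuous_riccati h₀.continuous h₁.continuous h₂.continuous
  obtain ⟨v, hv, hvi⟩ := exists_integral_solution_singular hQ
    ((h₀.continuous.abs.add h₁.continuous.abs).add (continuous_const.mul h₂.continuous.abs))
    (fun r v => abs_riccati_le r v) (fun r v w => abs_riccati_sub_le r v w) m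
  have hodd : Function.Odd v := fun r => by rw [hvi, hvi r, abs_neg]; ring
  -- The even extension of Q(ξ, v(ξ)). The barriers control v on r > 0 only; by parity P is
  -- nevertheless the untruncated polynomial expression on the whole line (`hPe`).
  set P : ℝ → ℝ := fun ξ => riccati q₀ q₁ q₂ |ξ| (v |ξ|) with hP
  have hPc : Continuous P := hQ.comp (continuous_abs.prodMk (hv.comp continuous_abs))
  have hvP : ∀ r, v r = r * ∫ τ in (0:ℝ)..1, τ ^ m * P (τ * r) := fun r => by
    rw [hvi]
    congr 1
    refine intervalIntegral.integral_congr fun τ hτ => ?_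
    rw [uIcc_of_le zero_le_one] at hτ
    simp only [hP, abs_mul, abs_of_nonneg hτ.1]
  have hd := hasDerivAt_of_singular_integral hPc hvP
  have hv0 : v 0 = 0 := by rw [hvi, zero_mul]
  have hd' : ∀ r, 0 < r → HasDerivAt v (-(m / r) * v r + riccati q₀ q₁ q₂ r (v r)) r := fun r hr => by
    refine (hd r).congr_deriv ?_
    have : P r = riccati q₀ q₁ q₂ r (v r) := by simp only [hP, abs_of_pos hr]
    rw [this, hvP r]
    field_simp; ring
  have hb : ∀ r, 0 < r → -1 < v r ∧ v r < 1 := fun r hr => by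
    refine abs_lt_one_of_riccati hv.continuousOn (by rw [hv0]; simp) hd' (fun r hr => ?_)
      hup (fun r hr => ?_) hr
    · rw [neg_nonpos]; positivity
    · rw [neg_neg]; exact hlo r hr
  have hb' : ∀ r, 0 ≤ r → -1 ≤ v r ∧ v r ≤ 1 := fun r hr => by
    rcases hr.eq_or_lt with h | h
    · rw [← h, hv0]; norm_num
    · exact ⟨(hb r h).1.le, (hb r h).2.le⟩
  have hPe : ∀ ξ, P ξ = q₀ ξ + q₁ ξ * v ξ + q₂ ξ * v ξ ^ 2 := fun ξ => by
    have h := hb' |ξ| (abs_nonneg ξ)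
    simp only [hP, riccati, clamp_of_mem h.1 h.2]
    rcases abs_choice ξ with h | h <;> rw [h]
    rw [e₀, e₁, e₂, hodd]; ring
  refine ⟨v, ?_, hodd, fun r hr => ⟨hb r hr, ?_⟩⟩
  -- Bootstrap through r = 0: if v is C^k, so are P and its averages, hence so is v'.
  · rw [contDiff_infty]
    intro k
    induction k with
    | zero => exact contDiff_zero.2 hv
    | succ k ih =>
      rw [Nat.cast_succ, contDiff_succ_iff_deriv]
      refine ⟨fun r => (hd r).differentiableAt, by simp, ?_⟩
      rw [funext fun r => (hd r).deriv]
      have hk : (k : WithTop ℕ∞) ≤ ∞ := by exact_mod_cast le_top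
      have hPk : ContDiff ℝ k P := by
        rw [funext hPe]
        exact ((h₀.of_le hk).add ((h₁.of_le hk).mul ih)).add ((h₂.of_le hk).mul (ih.pow 2))
      exact hPk.sub (contDiff_const.mul (contDiff_integral_pow_mul hPk m))
  · have := hd' r hr
    unfold riccati at this
    rwa [clamp_of_mem (hb r hr).1.le (hb r hr).2.le] at this

end

end Jang

namespace Jang

/-! ### Estimates on the asymptotic end -/

theorem le_of_hasDerivAt_nonpos {Z Z' : ℝ → ℝ} {r₁ : ℝ} (hd : ∀ r, r₁ ≤ r → HasDerivAt Z (Z' r) r)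
    (hZ : ∀ r, r₁ ≤ r → Z' r ≤ 0) : AntitoneOn Z (Ici r₁) := by
  refine antitoneOn_of_deriv_nonpos (convex_Ici r₁)
    (fun r hr => (hd r hr).continuousAt.continuousWithinAt) ?_ ?_ <;> rw [interior_Ici]
  · exact fun r hr => (hd r (le_of_lt hr)).differentiableAt.differentiableWithinAt
  · exact fun r hr => by rw [(hd r (le_of_lt hr)).deriv]; exact hZ r (le_of_lt hr)

section Dominated

variable {G G' S S' : ℝ → ℝ} {r₁ : ℝ} (hG : ∀ r, r₁ ≤ r → HasDerivAt G (G' r) r)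
  (hS : ∀ r, r₁ ≤ r → HasDerivAt S (S' r) r) (hS0 : ∀ r, r₁ ≤ r → 0 ≤ S r)
  (hGS : ∀ r, r₁ ≤ r → |G' r| ≤ -S' r)
include hG hS hGS

/-- S plays the role of the tail integral of a majorant of |G'|, which replaces improper integrals
by monotonicity. -/
theorem antitoneOn_add_of_abs_deriv_le : AntitoneOn (fun r => G r + S r) (Ici r₁) :=
  le_of_hasDerivAt_nonpos (fun r hr => (hG r hr).add (hS r hr)) fun r hr => by
    linarith [hGS r hr, le_abs_self (G' r)]

include hS0

theorem abs_le_of_abs_deriv_le {r : ℝ} (hr : r₁ ≤ r) : |G r| ≤ |G r₁| + S r₁ := by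
  have h1 := antitoneOn_add_of_abs_deriv_le hG hS hGS self_mem_Ici hr hr
  have h2 := antitoneOn_add_of_abs_deriv_le (G := fun r => -G r) (G' := fun r => -G' r)
    (fun r hr => (hG r hr).neg) hS (fun r hr => by rw [abs_neg]; exact hGS r hr) self_mem_Ici hr hr
  simp only at h1 h2
  have h3 := hS0 r hr
  rw [abs_le]
  constructor
  · linarith [neg_abs_le (G r₁)]
  · linarith [le_abs_self (G r₁)]

/-- A function whose derivative is dominated by that of a bounded function has a limit. -/
theorem exists_tendsto_of_abs_deriv_le : ∃ l, Tendsto G atTop (𝓝 l) := by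
  have key : ∀ Z : ℝ → ℝ, AntitoneOn Z (Ici r₁) → (∃ b, ∀ r, r₁ ≤ r → b ≤ Z r) →
      ∃ l, Tendsto Z atTop (𝓝 l) := by
    rintro Z hZ ⟨b, hb⟩
    have hmono : Antitone fun r => Z (max r r₁) := fun x y hxy =>
      hZ (mem_Ici.2 (le_max_right _ _)) (mem_Ici.2 (le_max_right _ _)) (max_le_max_right _ hxy)
    refine ⟨_, (tendsto_atTop_ciInf hmono ⟨b, ?_⟩).congr' ?_⟩
    · rintro _ ⟨r, rfl⟩; exact hb _ (le_max_right _ _)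
    · filter_upwards [eventually_ge_atTop r₁] with r hr
      simp only [max_eq_left hr]
  obtain ⟨l₁, h₁⟩ := key S (le_of_hasDerivAt_nonpos hS fun r hr => by
    linarith [hGS r hr, abs_nonneg (G' r)]) ⟨0, hS0⟩
  obtain ⟨l₂, h₂⟩ := key (fun r => G r + S r) (antitoneOn_add_of_abs_deriv_le hG hS hGS)
    ⟨-(|G r₁| + S r₁), fun r hr => by
      linarith [hS0 r hr, (abs_le.1 (abs_le_of_abs_deriv_le hG hS hS0 hGS hr)).1]⟩
  exact ⟨l₂ - l₁, by simpa using h₂.sub h₁⟩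

end Dominated

/-- Squaring makes the positive part differentiable, so that the positive part of q - 1 can enter a
Gronwall argument. -/
theorem hasDerivAt_sq_max_zero (x : ℝ) : HasDerivAt (fun x : ℝ => max x 0 ^ 2) (2 * max x 0) x := by
  rcases lt_trichotomy x 0 with h | h | h
  · refine ((hasDerivAt_const x (0 : ℝ)).congr_deriv (by simp [max_eq_right h.le])).congr_of_eventuallyEq ?_
    filter_upwards [gt_mem_nhds h] with y hy
    simp [max_eq_right (le_of_lt hy)]
  · subst h
    rw [hasDerivAt_iff_isLittleO_nhds_zero]
    simp only [zero_add, max_self, mul_zero, smul_zero, sub_zero, ne_eq, OfNat.ofNat_ne_zero,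
      not_false_eq_true, zero_pow]
    have : (fun h : ℝ => max h 0 ^ 2) =O[𝓝 0] fun h : ℝ => h ^ 2 := by
      refine Asymptotics.IsBigO.of_bound 1 (Eventually.of_forall fun h => ?_)
      rw [one_mul, norm_pow, norm_pow]
      refine pow_le_pow_left₀ (norm_nonneg _) ?_ 2
      rw [Real.norm_eq_abs, Real.norm_eq_abs, abs_of_nonneg (le_max_right _ _)]
      exact max_le (le_abs_self h) (abs_nonneg h)
    exact this.trans_isLittleO (by simpa using Asymptotics.isLittleO_pow_id (𝕜 := ℝ) one_lt_two)
  · refine ((hasDerivAt_pow 2 x).congr_deriv (by simp [max_eq_left h.le])).congr_of_eventuallyEq ?_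
    filter_upwards [lt_mem_nhds h] with y hy
    simp [max_eq_left (le_of_lt hy)]

/-- The radial quantities on the asymptotic end, with `s` the arclength, `α = s'`, `q = dρ/ds` and
`R` the scalar curvature. -/
structure RadialEnd (n : ℕ) (α s ρ q kn kt R : ℝ → ℝ) (r₁ c C : ℝ) : Prop where
  hn : 3 ≤ n
  α_pos : ∀ r, r₁ ≤ r → 0 < α r
  hs : ∀ r, r₁ ≤ r → HasDerivAt s (α r) r
  one_le_s : ∀ r, r₁ ≤ r → 1 ≤ s r
  s_top : Tendsto s atTop atTop
  hρ : ∀ r, r₁ ≤ r → HasDerivAt ρ (α r * q r) r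
  hq : ∀ r, r₁ ≤ r → HasDerivAt q
    (α r * (((n : ℝ) - 2) / 2 * (1 - q r ^ 2) / ρ r - R r * ρ r / (2 * ((n : ℝ) - 1)))) r
  c_pos : 0 < c
  C_pos : 0 < C
  le_ρ : ∀ r, r₁ ≤ r → c * s r ≤ ρ r
  kn_le : ∀ r, r₁ ≤ r → |kn r| ≤ C / s r ^ (n - 1)
  kt_le : ∀ r, r₁ ≤ r → |kt r| ≤ C / s r ^ (n - 1)
  tr_le : ∀ r, r₁ ≤ r → |kn r + ((n : ℝ) - 1) * kt r| ≤ C / s r ^ n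
  R_le : ∀ r, r₁ ≤ r → |R r| ≤ C / s r ^ (n + 1)

namespace RadialEnd

variable {n : ℕ} {α s ρ q kn kt R : ℝ → ℝ} {r₁ c C : ℝ}

section
variable (h : RadialEnd n α s ρ q kn kt R r₁ c C)
include h

theorem s_pos {r : ℝ} (hr : r₁ ≤ r) : 0 < s r := one_pos.trans_le (h.one_le_s r hr)

theorem ρ_pos {r : ℝ} (hr : r₁ ≤ r) : 0 < ρ r :=
  (mul_pos h.c_pos (h.s_pos hr)).trans_le (h.le_ρ r hr)

theorem hasDerivAt_div_s (B : ℝ) {r : ℝ} (hr : r₁ ≤ r) :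
    HasDerivAt (fun r => B / s r) (-(B * α r / s r ^ 2)) r := by
  refine ((hasDerivAt_const r B).div (h.hs r hr) (h.s_pos hr).ne').congr_deriv ?_
  ring

theorem div_pow_le {B : ℝ} (hB : 0 ≤ B) {i j : ℕ} (hij : i ≤ j) {r : ℝ} (hr : r₁ ≤ r) :
    B / s r ^ j ≤ B / s r ^ i :=
  div_le_div_of_nonneg_left hB (pow_pos (h.s_pos hr) _) (pow_le_pow_right₀ (h.one_le_s r hr) hij)

theorem two_le_sub_one : 2 ≤ n - 1 := Nat.le_sub_one_of_lt h.hn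

/-- Gronwall's inequality with the integrable weight `ds / s²`. -/
theorem bounded_of_deriv_le {Y Y' : ℝ → ℝ} {B : ℝ} (hB : 0 ≤ B) (hY0 : ∀ r, r₁ ≤ r → 0 ≤ Y r)
    (hY : ∀ r, r₁ ≤ r → HasDerivAt Y (Y' r) r)
    (hle : ∀ r, r₁ ≤ r → Y' r ≤ α r / s r ^ 2 * (B * Y r)) :
    ∃ b, ∀ r, r₁ ≤ r → Y r ≤ b := by
  refine ⟨Y r₁ * Real.exp (B / s r₁), fun r hr => ?_⟩
  -- B/s is a primitive of -B ds/s², so e^{B/s} is the integrating factor.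
  have := le_of_hasDerivAt_nonpos (Z := fun r => Y r * Real.exp (B / s r))
    (fun r hr => (hY r hr).mul (h.hasDerivAt_div_s B hr).exp) (fun r hr => ?_) self_mem_Ici hr hr
  · refine le_trans (le_mul_of_one_le_right (hY0 r hr) ?_) this
    exact Real.one_le_exp (div_nonneg hB (h.s_pos hr).le)
  · have e := hle r hr
    have he := Real.exp_pos (B / s r)
    have : Y' r * Real.exp (B / s r) + Y r * (Real.exp (B / s r) * -(B * α r / s r ^ 2)) =
      (Y' r - α r / s r ^ 2 * (B * Y r)) * Real.exp (B / s r) := by ring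
    rw [this]
    exact mul_nonpos_of_nonpos_of_nonneg (by linarith) he.le

/-- The mean curvature of the spheres is not dominated by `k`. -/
theorem not_forall_le : ¬ ∀ r, r₁ ≤ r → q r / ρ r ≤ |kt r| := by
  intro hle
  have hlog : ∀ r, r₁ ≤ r → HasDerivAt (fun r => Real.log (ρ r)) (α r * q r / ρ r) r := fun r hr =>
    (h.hρ r hr).log (h.ρ_pos hr).ne'
  -- If dρ/ds ≤ ρ|kₜ| = O(ρ/s²), then log ρ + C/s decreases, against ρ ≥ c s → ∞.
  have hanti := le_of_hasDerivAt_nonpos (Z := fun r => Real.log (ρ r) + C / s r)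
    (fun r hr => (hlog r hr).add (h.hasDerivAt_div_s C hr)) (fun r hr => by
      have h1 := (hle r hr).trans ((h.kt_le r hr).trans (h.div_pow_le h.C_pos.le h.two_le_sub_one hr))
      have h2 := mul_le_mul_of_nonneg_left h1 (h.α_pos r hr).le
      have e1 : α r * (q r / ρ r) = α r * q r / ρ r := by ring
      have e2 : α r * (C / s r ^ 2) = C * α r / s r ^ 2 := by ring
      rw [e1, e2] at h2
      linarith)
  have hρtop : Tendsto ρ atTop atTop := by
    refine tendsto_atTop_mono' _ ?_ (h.s_top.const_mul_atTop h.c_pos)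
    filter_upwards [eventually_ge_atTop r₁] with r hr using h.le_ρ r hr
  have hltop := Real.tendsto_log_atTop.comp hρtop
  obtain ⟨r, h1, h2⟩ := ((hltop.eventually_gt_atTop (Real.log (ρ r₁) + C / s r₁)).and
    (eventually_ge_atTop r₁)).exists
  have h3 := hanti self_mem_Ici h2 h2
  simp only [Function.comp_apply] at h1 h3
  linarith [div_pos h.C_pos (h.s_pos h2)]

theorem n_ge : (3 : ℝ) ≤ n := by exact_mod_cast h.hn

variable (hq0 : ∀ r, r₁ ≤ r → 0 < q r)
include hq0

/-- Where q > 1 the term 1 - q² has the good sign, so q can grow only through Rρ, while ρ grows at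
rate q. The quantity 1 + (q - 1)₊² + (ρ/s²)² controls both: its derivative is at most a multiple of
itself times ds/s². The summand 1 absorbs the linear terms. -/
theorem exists_q_le : ∃ B, 0 < B ∧ ∀ r, r₁ ≤ r → q r ≤ B := by
  have hn := h.n_ge
  have hY : ∀ r, r₁ ≤ r → HasDerivAt (fun r => 1 + max (q r - 1) 0 ^ 2 + ρ r ^ 2 / s r ^ 4) _ r :=
    fun r hr => (((hasDerivAt_sq_max_zero _).comp r ((h.hq r hr).sub_const 1)).const_add 1).add
      (((h.hρ r hr).pow 2).div ((h.hs r hr).pow 4) (pow_ne_zero 4 (h.s_pos hr).ne'))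
  obtain ⟨b, hb⟩ := h.bounded_of_deriv_le (B := C + 2) (by linarith [h.C_pos])
    (fun r hr => by positivity) hY (fun r hr => by
      have hs := h.s_pos hr
      have hρ := h.ρ_pos hr
      have hα := h.α_pos r hr
      have hq := hq0 r hr
      set a := max (q r - 1) 0 with ha
      have ha0 : 0 ≤ a := le_max_right _ _
      have hqa : q r ≤ 1 + a := by linarith [le_max_left (q r - 1) 0]
      set w := ρ r / s r ^ 2 with hw
      have hw0 : 0 < w := by positivity
      have h1 : 2 * a * (((n : ℝ) - 2) / 2 * (1 - q r ^ 2) / ρ r - R r * ρ r / (2 * ((n : ℝ) - 1))) ≤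
          2 * a * (C * w / s r ^ 2) := by
        rcases ha0.eq_or_lt with h0 | h0
        · rw [← h0]; simp
        · refine mul_le_mul_of_nonneg_left ?_ (by positivity)
          have hq1 : 1 < q r := by
            by_contra! hcon
            rw [ha, max_eq_right (by linarith)] at h0
            exact lt_irrefl _ h0
          have i1 : ((n : ℝ) - 2) / 2 * (1 - q r ^ 2) / ρ r ≤ 0 := by
            refine div_nonpos_of_nonpos_of_nonneg (mul_nonpos_of_nonneg_of_nonpos (by linarith) ?_) hρ.le
            nlinarith
          have i2 : |R r| ≤ C / s r ^ 4 :=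
            (h.R_le r hr).trans (h.div_pow_le h.C_pos.le (by have := h.hn; omega) hr)
          have i3 : -(R r * ρ r / (2 * ((n : ℝ) - 1))) ≤ |R r| * ρ r := by
            rw [← neg_div, div_le_iff₀ (by linarith)]
            have j1 : -(R r * ρ r) ≤ |R r| * ρ r := by
              have := neg_abs_le (R r); nlinarith
            have j2 : 0 ≤ |R r| * ρ r := by positivity
            nlinarith
          have i4 : |R r| * ρ r ≤ C * w / s r ^ 2 := by
            refine (mul_le_mul_of_nonneg_right i2 hρ.le).trans_eq ?_
            rw [hw]; field_simp
          linarith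
      have h2 : (2 * ρ r ^ (2 - 1) * (α r * q r) * s r ^ 4 - ρ r ^ 2 * (4 * s r ^ (4 - 1) * α r)) /
          (s r ^ 4) ^ 2 ≤ α r / s r ^ 2 * (2 * w * q r) := by
        have e : (2 * ρ r ^ (2 - 1) * (α r * q r) * s r ^ 4 - ρ r ^ 2 * (4 * s r ^ (4 - 1) * α r)) /
          (s r ^ 4) ^ 2 = α r / s r ^ 2 * (2 * w * q r) - 4 * ρ r ^ 2 * α r / s r ^ 5 := by
          rw [hw]; field_simp; simp; ring
        rw [e]
        have : 0 ≤ 4 * ρ r ^ 2 * α r / s r ^ 5 := by positivity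
        linarith
      have h3 : ρ r ^ 2 / s r ^ 4 = w ^ 2 := by rw [hw]; field_simp
      have h4 : 2 * a * (C * w) + 2 * w * q r ≤ (C + 2) * (1 + a ^ 2 + w ^ 2) := by
        have := h.C_pos
        nlinarith [mul_nonneg h.C_pos.le (sq_nonneg (a - w)), sq_nonneg (a - 1), sq_nonneg (w - q r),
          mul_pos hw0 hq, h.C_pos]
      have h5 := mul_le_mul_of_nonneg_left h4 (show 0 ≤ α r / s r ^ 2 by positivity)
      have h6 := mul_le_mul_of_nonneg_left h1 hα.le
      have e6 : α r * (2 * a * (C * w / s r ^ 2)) = α r / s r ^ 2 * (2 * a * (C * w)) := by ring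
      rw [h3]
      push_cast
      rw [e6] at h6
      rw [mul_add] at h5
      refine le_trans (add_le_add (le_of_eq ?_) h2) (le_trans (add_le_add_left h6 _) h5)
      ring)
  refine ⟨2 + |b|, by positivity, fun r hr => ?_⟩
  have h1 := hb r hr
  have h2 : 0 ≤ ρ r ^ 2 / s r ^ 4 := by positivity
  have h3 := le_max_left (q r - 1) 0
  have h4 := le_abs_self b
  nlinarith [sq_nonneg (max (q r - 1) 0 - 1), abs_nonneg b]

theorem exists_ρ_le : ∃ B, 0 < B ∧ ∀ r, r₁ ≤ r → ρ r ≤ B * s r := by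
  obtain ⟨B, hB, hqB⟩ := h.exists_q_le hq0
  refine ⟨B + ρ r₁, add_pos hB (h.ρ_pos le_rfl), fun r hr => ?_⟩
  have := le_of_hasDerivAt_nonpos (Z := fun r => ρ r - B * s r)
    (fun r hr => (h.hρ r hr).sub ((h.hs r hr).const_mul B)) (fun r hr => by
      nlinarith [hqB r hr, h.α_pos r hr]) self_mem_Ici hr hr
  simp only at this
  nlinarith [h.one_le_s r hr, h.ρ_pos (le_refl r₁), h.s_pos (le_refl r₁)]

/-- Boundedness of the mass function gives `q = 1 + O(1/s)`. -/
theorem exists_one_sub_q_le : ∃ B, 0 < B ∧ ∀ r, r₁ ≤ r → |1 - q r| ≤ B / s r := by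
  obtain ⟨Bq, hBq, hqB⟩ := h.exists_q_le hq0
  obtain ⟨B, hB, hρB⟩ := h.exists_ρ_le hq0
  have hn := h.n_ge
  obtain ⟨m, rfl⟩ : ∃ m, n = m + 3 := ⟨n - 3, by have := h.hn; omega⟩
  -- With n = m + 3 this is the mass function ρ^{n-2}(1 - q²). The curvature-free terms cancel, and
  -- what is left is O(s^{n-1} · s^{-n-1}) = O(s^{-2}) per unit of arclength.
  have hG : ∀ r, r₁ ≤ r → HasDerivAt (fun r => ρ r ^ (m + 1) * (1 - q r ^ 2))
      (α r * (q r * ρ r ^ (m + 2) * R r / (m + 2))) r := fun r hr => by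
    have hρ := (h.ρ_pos hr).ne'
    refine (((h.hρ r hr).pow (m + 1)).mul (((h.hq r hr).pow 2).const_sub 1)).congr_deriv ?_
    simp only [Pi.pow_apply]
    push_cast
    have : (m : ℝ) + 3 - 1 ≠ 0 := by push_cast at hn; linarith
    have : (m : ℝ) + 2 ≠ 0 := by push_cast at hn; linarith
    simp only [pow_one]
    field_simp
    ring
  set A := Bq * B ^ (m + 2) * C with hA
  have hA0 : 0 ≤ A := by have := h.C_pos; positivity
  have hbd : ∀ r, r₁ ≤ r → |α r * (q r * ρ r ^ (m + 2) * R r / (m + 2))| ≤ - -(A * α r / s r ^ 2) :=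
    fun r hr => by
    have hs := h.s_pos hr
    have hρ := h.ρ_pos hr
    have hα := h.α_pos r hr
    have hC := h.C_pos
    have i1 : |R r| ≤ C / s r ^ (m + 4) := h.R_le r hr
    have i2 : ρ r ^ (m + 2) ≤ B ^ (m + 2) * s r ^ (m + 2) := by
      rw [← mul_pow]; exact pow_le_pow_left₀ hρ.le (hρB r hr) _
    have i3 : q r * ρ r ^ (m + 2) * |R r| ≤ Bq * (B ^ (m + 2) * s r ^ (m + 2)) * (C / s r ^ (m + 4)) :=
      mul_le_mul (mul_le_mul (hqB r hr) i2 (by positivity) hBq.le) i1 (abs_nonneg _) (by positivity)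
    have e3 : Bq * (B ^ (m + 2) * s r ^ (m + 2)) * (C / s r ^ (m + 4)) = A / s r ^ 2 := by
      rw [hA]; field_simp; ring
    have i4 : |q r * ρ r ^ (m + 2) * R r / (m + 2)| ≤ q r * ρ r ^ (m + 2) * |R r| := by
      rw [abs_div, abs_mul, abs_of_pos (mul_pos (hq0 r hr) (pow_pos hρ _)),
        abs_of_pos (by positivity : (0:ℝ) < (m : ℝ) + 2)]
      have := hq0 r hr
      exact div_le_self (by positivity) (by linarith [(Nat.cast_nonneg m : (0:ℝ) ≤ m)])
    rw [abs_mul, abs_of_pos hα, neg_neg]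
    calc α r * _ ≤ α r * (A / s r ^ 2) :=
          mul_le_mul_of_nonneg_left (i4.trans (i3.trans_eq e3)) hα.le
      _ = _ := by ring
  have hb := fun r hr => abs_le_of_abs_deriv_le hG (fun r hr => h.hasDerivAt_div_s A hr)
    (fun r hr => div_nonneg hA0 (h.s_pos hr).le) hbd (r := r) hr
  set b := |ρ r₁ ^ (m + 1) * (1 - q r₁ ^ 2)| + A / s r₁ with hbdef
  have hb0 : 0 ≤ b := add_nonneg (abs_nonneg _) (div_nonneg hA0 (h.s_pos le_rfl).le)
  refine ⟨b / c ^ (m + 1) + 1, by have := h.c_pos; positivity, fun r hr => ?_⟩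
  have hs := h.s_pos hr
  have hρ := h.ρ_pos hr
  have hq := hq0 r hr
  have hc := h.c_pos
  have h1 := hb r hr
  rw [abs_mul, abs_of_pos (pow_pos hρ _)] at h1
  have h2 : |1 - q r| ≤ |1 - q r ^ 2| := by
    rw [show 1 - q r ^ 2 = (1 - q r) * (1 + q r) by ring, abs_mul, abs_of_pos (by linarith : 0 < 1 + q r)]
    exact le_mul_of_one_le_right (abs_nonneg _) (by linarith)
  have h3 : c ^ (m + 1) * s r ≤ ρ r ^ (m + 1) := by
    calc c ^ (m + 1) * s r ≤ c ^ (m + 1) * s r ^ (m + 1) :=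
          mul_le_mul_of_nonneg_left (le_self_pow₀ (h.one_le_s r hr) (by simp)) (by positivity)
      _ = (c * s r) ^ (m + 1) := by rw [mul_pow]
      _ ≤ _ := pow_le_pow_left₀ (by positivity) (h.le_ρ r hr) _
  have h4 : c ^ (m + 1) * s r * |1 - q r| ≤ b :=
    (mul_le_mul h3 h2 (abs_nonneg _) (by positivity)).trans h1
  have h5 : |1 - q r| ≤ b / c ^ (m + 1) / s r := by
    rw [div_div, le_div_iff₀ (by positivity)]; linarith
  refine h5.trans (div_le_div_of_nonneg_right (by linarith) hs.le)

/-- Decay of the slope of solutions of Jang's equation. -/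
theorem exists_slope_sq_le {v : ℝ → ℝ} (hv1 : ∀ r, r₁ ≤ r → v r ^ 2 < 1)
    (hv : ∀ r, r₁ ≤ r → HasDerivAt v (-(((n : ℝ) - 1) * (α r * q r / ρ r)) * v r
      + α r * ((1 - v r ^ 2) * kn r + ((n : ℝ) - 1) * kt r)) r) :
    ∃ B, 0 < B ∧ ∀ r, r₁ ≤ r → v r ^ 2 ≤ B / s r ^ 3 := by
  obtain ⟨B, hB, hρB⟩ := h.exists_ρ_le hq0
  have hn := h.n_ge
  obtain ⟨m, rfl⟩ : ∃ m, n = m + 3 := ⟨n - 3, by have := h.hn; omega⟩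
  -- The factor ρ^{n-1} integrates the damping term. The source becomes the trace of k, one order
  -- smaller than k itself, plus a term quadratic in v.
  have hV : ∀ r, r₁ ≤ r → HasDerivAt (fun r => ρ r ^ (m + 2) * v r)
      (α r * ρ r ^ (m + 2) * (kn r + (m + 2) * kt r - v r ^ 2 * kn r)) r := fun r hr => by
    have hρ := (h.ρ_pos hr).ne'
    refine (((h.hρ r hr).pow (m + 2)).mul (hv r hr)).congr_deriv ?_
    simp only [Pi.pow_apply]
    push_cast
    field_simp
    ring
  set A := B ^ (m + 2) * C with hA
  have hC := h.C_pos
  have hA0 : 0 < A := by positivity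
  have hVb : ∀ r, r₁ ≤ r → |ρ r ^ (m + 2) * (kn r + (m + 2) * kt r - v r ^ 2 * kn r)| ≤
      A / s r + C / s r ^ 2 * |ρ r ^ (m + 2) * v r| := fun r hr => by
    have hs := h.s_pos hr
    have hρ := h.ρ_pos hr
    have i1 : |kn r + (m + 2) * kt r| ≤ C / s r ^ (m + 3) := by
      have := h.tr_le r hr
      push_cast at this
      rwa [show (m : ℝ) + 3 - 1 = m + 2 by ring] at this
    have i2 : ρ r ^ (m + 2) ≤ B ^ (m + 2) * s r ^ (m + 2) := by
      rw [← mul_pow]; exact pow_le_pow_left₀ hρ.le (hρB r hr) _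
    have i3 : |kn r| ≤ C / s r ^ 2 :=
      (h.kn_le r hr).trans (h.div_pow_le h.C_pos.le h.two_le_sub_one hr)
    have i4 : ρ r ^ (m + 2) * |kn r + (m + 2) * kt r| ≤ A / s r := by
      refine (mul_le_mul i2 i1 (abs_nonneg _) (by positivity)).trans_eq ?_
      rw [hA]; field_simp; ring
    have i5 : |v r ^ 2 * kn r| ≤ C / s r ^ 2 * |v r| := by
      rw [abs_mul, mul_comm]
      refine mul_le_mul i3 ?_ (abs_nonneg _) (by positivity)
      have hv' : |v r| ≤ 1 := abs_le_one_iff_mul_self_le_one.2 (by nlinarith [hv1 r hr])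
      rw [abs_pow, sq]
      exact mul_le_of_le_one_right (abs_nonneg _) hv'
    rw [abs_mul, abs_mul, abs_of_pos (pow_pos hρ _)]
    calc _ ≤ ρ r ^ (m + 2) * (|kn r + (m + 2) * kt r| + |v r ^ 2 * kn r|) :=
          mul_le_mul_of_nonneg_left (abs_sub _ _) (by positivity)
      _ ≤ A / s r + ρ r ^ (m + 2) * (C / s r ^ 2 * |v r|) := by
          rw [mul_add]
          exact add_le_add i4 (mul_le_mul_of_nonneg_left i5 (by positivity))
      _ = _ := by ring
  set V : ℝ → ℝ := fun r => ρ r ^ (m + 2) * v r with hVdef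
  -- V = O(√s) suffices. Differentiating 1/s yields -V²/s², which absorbs the V² in 2A|V| ≤ V² + A²;
  -- the +1 absorbs A². Then v² = V²/ρ^{2(n-1)} = O(s · s^{-4}) since n ≥ 3.
  obtain ⟨b, hb⟩ := h.bounded_of_deriv_le (B := A ^ 2 + 2 * C) (Y := fun r => V r ^ 2 / s r + 1)
    (by positivity) (fun r hr => by have := h.s_pos hr; positivity)
    (fun r hr => (((hV r hr).pow 2).div (h.hs r hr) (h.s_pos hr).ne').add_const 1) (fun r hr => by
      have hs := h.s_pos hr
      have hα := h.α_pos r hr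
      have i1 := hVb r hr
      set J := ρ r ^ (m + 2) * (kn r + (m + 2) * kt r - v r ^ 2 * kn r) with hJ
      have i2 : V r * J ≤ |V r| * (A / s r) + C / s r ^ 2 * V r ^ 2 := by
        calc V r * J ≤ |V r| * |J| := (le_abs_self _).trans_eq (abs_mul _ _)
          _ ≤ |V r| * (A / s r + C / s r ^ 2 * |V r|) := mul_le_mul_of_nonneg_left i1 (abs_nonneg _)
          _ = _ := by rw [← sq_abs (V r)]; ring
      have i3 : 2 * |V r| * A ≤ V r ^ 2 + A ^ 2 := by
        rw [← sq_abs (V r)]; nlinarith [sq_nonneg (|V r| - A)]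
      simp only [Pi.pow_apply]
      rw [show α r * ρ r ^ (m + 2) * (kn r + (m + 2) * kt r - v r ^ 2 * kn r) = α r * J by
        rw [hJ]; ring]
      have e : (((2 : ℕ) : ℝ) * V r ^ (2 - 1) * (α r * J) * s r - V r ^ 2 * α r) / s r ^ 2 =
          α r / s r ^ 2 * (2 * s r * (V r * J) - V r ^ 2) := by
        push_cast; simp only [pow_one]; ring
      rw [e]
      refine mul_le_mul_of_nonneg_left ?_ (by positivity)
      have i4 : 2 * s r * (V r * J) ≤ 2 * |V r| * A + 2 * C * (V r ^ 2 / s r) := by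
        refine (mul_le_mul_of_nonneg_left i2 (by positivity)).trans_eq ?_
        field_simp
      have i5 : 0 ≤ V r ^ 2 / s r := by positivity
      nlinarith [mul_nonneg (sq_nonneg A) i5])
  have hc := h.c_pos
  refine ⟨(|b| + 1) / c ^ (2 * (m + 2)), by positivity, fun r hr => ?_⟩
  have hs := h.s_pos hr
  have h1 := hb r hr
  have h2 : V r ^ 2 ≤ (|b| + 1) * s r := by
    have : V r ^ 2 / s r ≤ |b| + 1 := by linarith [le_abs_self b]
    rwa [div_le_iff₀ hs] at this
  have h3 : c ^ (2 * (m + 2)) * s r ^ 4 ≤ ρ r ^ (2 * (m + 2)) := by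
    calc c ^ (2 * (m + 2)) * s r ^ 4 ≤ c ^ (2 * (m + 2)) * s r ^ (2 * (m + 2)) :=
          mul_le_mul_of_nonneg_left (pow_le_pow_right₀ (h.one_le_s r hr) (by omega)) (by positivity)
      _ = (c * s r) ^ (2 * (m + 2)) := by rw [mul_pow]
      _ ≤ _ := pow_le_pow_left₀ (by positivity) (h.le_ρ r hr) _
  have h4 : V r ^ 2 = ρ r ^ (2 * (m + 2)) * v r ^ 2 := by simp only [hVdef]; ring
  rw [h4] at h2
  have h5 : c ^ (2 * (m + 2)) * s r ^ 4 * v r ^ 2 ≤ (|b| + 1) * s r :=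
    (mul_le_mul_of_nonneg_right h3 (sq_nonneg _)).trans h2
  rw [div_div, le_div_iff₀ (by positivity)]
  have h6 : s r * (v r ^ 2 * (c ^ (2 * (m + 2)) * s r ^ 3)) ≤ s r * (|b| + 1) := by
    refine le_trans (le_of_eq ?_) (h5.trans_eq ?_) <;> ring
  exact le_of_mul_le_mul_left h6 hs

end

end RadialEnd

end Jang

/-! ### Limits at infinity of the Jang solution and of the conformal exponent. -/

namespace Jang

namespace RadialEnd

variable {n : ℕ} {α s ρ q kn kt R : ℝ → ℝ} {r₁ c C : ℝ}

variable (h : RadialEnd n α s ρ q kn kt R r₁ c C) {v : ℝ → ℝ} {B : ℝ} (hB : 0 < B)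
  (hvB : ∀ r, r₁ ≤ r → v r ^ 2 ≤ B / s r ^ 3)
include h hB hvB

omit hB in
theorem exists_slope_sq_le_half : ∃ r₂, r₁ ≤ r₂ ∧ ∀ r, r₂ ≤ r → v r ^ 2 ≤ 1 / 2 := by
  obtain ⟨r₂, hr₂⟩ := eventually_atTop.1 (h.s_top.eventually_ge_atTop (2 * B))
  refine ⟨max r₁ r₂, le_max_left _ _, fun r hr => ?_⟩
  have h1 : r₁ ≤ r := (le_max_left _ _).trans hr
  have h2 := hr₂ r ((le_max_right _ _).trans hr)
  have h3 : s r ≤ s r ^ 3 := le_self_pow₀ (h.one_le_s r h1) (by norm_num)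
  refine (hvB r h1).trans ?_
  rw [div_le_iff₀ (pow_pos (h.s_pos h1) 3)]
  linarith

/-- Once v² ≤ 1/2, |dF/ds| ≤ 2|v| ≤ 2√B s^{-3/2}, which is the negative derivative of 4√B s^{-1/2}.
-/
theorem exists_tendsto_of_slope {F : ℝ → ℝ}
    (hF : ∀ r, r₁ ≤ r → HasDerivAt F (α r * (v r / Real.sqrt (1 - v r ^ 2))) r) :
    ∃ l, Tendsto F atTop (𝓝 l) := by
  obtain ⟨r₂, h12, hv2⟩ := h.exists_slope_sq_le_half hvB
  have hS : ∀ r, r₂ ≤ r → HasDerivAt (fun r => 4 * Real.sqrt B / Real.sqrt (s r))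
      (-(2 * Real.sqrt B * α r / (s r * Real.sqrt (s r)))) r := fun r hr => by
    have hs := h.s_pos (h12.trans hr)
    have hss := Real.sqrt_pos.2 hs
    refine ((hasDerivAt_const r _).div ((h.hs r (h12.trans hr)).sqrt hs.ne') hss.ne').congr_deriv ?_
    rw [Real.sq_sqrt hs.le]
    field_simp
    ring
  refine exists_tendsto_of_abs_deriv_le (fun r hr => hF r (h12.trans hr)) hS
    (fun r hr => by positivity) fun r hr => ?_
  have hs := h.s_pos (h12.trans hr)
  have hα := h.α_pos r (h12.trans hr)
  have hss := Real.sqrt_pos.2 hs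
  have h1 : |v r| ≤ Real.sqrt B / (s r * Real.sqrt (s r)) := by
    refine abs_le_of_sq_le_sq ?_ (by positivity)
    refine (hvB r (h12.trans hr)).trans_eq ?_
    rw [div_pow, mul_pow, Real.sq_sqrt hB.le, Real.sq_sqrt hs.le]
    congr 1
  have h2 : 1 / 2 ≤ Real.sqrt (1 - v r ^ 2) := by
    refine Real.le_sqrt_of_sq_le ?_
    have := hv2 r hr
    norm_num; linarith
  rw [abs_mul, abs_of_pos hα, abs_div, abs_of_nonneg (Real.sqrt_nonneg _), neg_neg]
  calc α r * (|v r| / Real.sqrt (1 - v r ^ 2)) ≤ α r * (|v r| / (1 / 2)) := by gcongr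
    _ ≤ α r * (Real.sqrt B / (s r * Real.sqrt (s r)) / (1 / 2)) := by gcongr
    _ = _ := by ring

/-- Both 1/√(1 - v²) - 1 = O(v²) and 1 - q are O(1/s), and ρ ≥ c s, so dF/ds = O(s^{-2}). -/
theorem exists_tendsto_of_conformal (hq0 : ∀ r, r₁ ≤ r → 0 < q r) {F : ℝ → ℝ}
    (hF : ∀ r, r₁ ≤ r → HasDerivAt F (α r * (1 / Real.sqrt (1 - v r ^ 2) - q r) / ρ r) r) :
    ∃ l, Tendsto F atTop (𝓝 l) := by
  obtain ⟨r₂, h12, hv2⟩ := h.exists_slope_sq_le_half hvB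
  obtain ⟨A, hA, hqA⟩ := h.exists_one_sub_q_le hq0
  have hc := h.c_pos
  refine exists_tendsto_of_abs_deriv_le (fun r hr => hF r (h12.trans hr))
    (fun r hr => h.hasDerivAt_div_s ((2 * B + A) / c) (h12.trans hr))
    (fun r hr => by have := h.s_pos (h12.trans hr); positivity) fun r hr => ?_
  have hs := h.s_pos (h12.trans hr)
  have hα := h.α_pos r (h12.trans hr)
  have hρ := h.ρ_pos (h12.trans hr)
  have hv := hv2 r hr
  set x := v r ^ 2 with hx
  have hx0 : 0 ≤ x := sq_nonneg _
  have h1 : |1 / Real.sqrt (1 - x) - 1| ≤ 2 * x := by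
    have e1 : 1 - x ≤ Real.sqrt (1 - x) := Real.le_sqrt_of_sq_le (by nlinarith)
    have e2 : Real.sqrt (1 - x) ≤ 1 := Real.sqrt_le_one.2 (by linarith)
    have e3 : 0 < Real.sqrt (1 - x) := by linarith
    rw [abs_of_nonneg (by rw [sub_nonneg, le_div_iff₀ e3]; linarith), sub_le_iff_le_add,
      div_le_iff₀ e3]
    nlinarith
  have h2 : x ≤ B / s r := by
    have := (hvB r (h12.trans hr)).trans (h.div_pow_le hB.le (by norm_num : 1 ≤ 3) (h12.trans hr))
    rwa [pow_one] at this
  have h3 : |1 / Real.sqrt (1 - x) - q r| ≤ (2 * B + A) / s r := by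
    calc |1 / Real.sqrt (1 - x) - q r| = |(1 / Real.sqrt (1 - x) - 1) + (1 - q r)| := by ring_nf
      _ ≤ 2 * (B / s r) + A / s r := (abs_add_le _ _).trans
          (add_le_add (h1.trans (by linarith)) (hqA r (h12.trans hr)))
      _ = _ := by ring
  rw [abs_div, abs_mul, abs_of_pos hα, abs_of_pos hρ, neg_neg]
  calc α r * |1 / Real.sqrt (1 - x) - q r| / ρ r ≤ α r * ((2 * B + A) / s r) / (c * s r) :=
        div_le_div₀ (by positivity) (mul_le_mul_of_nonneg_left h3 hα.le) (by positivity)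
          (h.le_ρ r (h12.trans hr))
    _ = _ := by field_simp

end RadialEnd

end Jang

namespace Jang

variable {n : ℕ}

/-! ### The radial profile of spherically symmetric initial data -/

/-- The line on which the radial profiles of functions on `M n r₀` are defined. -/
def profileLine (r₀ : ℝ) : Set ℝ := {r | r₀ ≤ |r|}

/-- Spherically symmetric data, in terms of radial functions which are smooth up to the boundary
sphere, or even and smooth on the whole line if there is no boundary. -/
structure IsProfile (n : ℕ) (r₀ : ℝ) (g k : Tensor2 n) (D G kn kt : ℝ → ℝ) : Prop where
  D_smooth : ContDiffOn ℝ ∞ D (profileLine r₀)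
  G_smooth : ContDiffOn ℝ ∞ G (profileLine r₀)
  kn_smooth : ContDiffOn ℝ ∞ kn (profileLine r₀)
  kt_smooth : ContDiffOn ℝ ∞ kt (profileLine r₀)
  D_pos : ∀ r ∈ profileLine r₀, 0 < D r
  G_pos : ∀ r ∈ profileLine r₀, 0 < G r
  D_even : r₀ = 0 → Function.Even D
  G_even : r₀ = 0 → Function.Even G
  kn_even : r₀ = 0 → Function.Even kn
  kt_even : r₀ = 0 → Function.Even kt
  D_zero : r₀ = 0 → D 0 = G 0
  g_eq : ∀ x ∈ M n r₀, x ≠ 0 → ∀ i j,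
    g x i j = D ‖x‖ * (nu x i * nu x j) + G ‖x‖ * proj x i j
  k_eq : ∀ x ∈ M n r₀, x ≠ 0 → ∀ i j,
    k x i j = D ‖x‖ * kn ‖x‖ * (nu x i * nu x j) + G ‖x‖ * kt ‖x‖ * proj x i j

theorem nu_single {i : Fin n} {r : ℝ} (j : Fin n) :
    nu (EuclideanSpace.single i r) j = if j = i then r / |r| else 0 := by
  simp only [nu, PiLp.norm_single, Real.norm_eq_abs, PiLp.single_apply]
  split_ifs <;> simp

theorem div_abs_mul_self {r : ℝ} (hr : r ≠ 0) : r / |r| * (r / |r|) = 1 := by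
  have : |r| ≠ 0 := abs_ne_zero.2 hr
  rw [div_mul_div_comm, abs_mul_abs_self, div_self (mul_self_ne_zero.2 hr)]

theorem nu_mul_nu (x : E n) (i j : Fin n) : x i * x j / ‖x‖ ^ 2 = nu x i * nu x j := by
  unfold nu; rw [div_mul_div_comm, sq]

theorem contDiff_single (i : Fin n) : ContDiff ℝ ∞ fun r : ℝ => (EuclideanSpace.single i r : E n) := by
  have : (fun r : ℝ => (EuclideanSpace.single i r : E n)) =
      fun r => r • EuclideanSpace.single i (1 : ℝ) := by
    ext r j; simp
  rw [this]
  exact contDiff_id.smul contDiff_const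

/-- The given radial coefficients carry no regularity. Components of g and k along a full coordinate
axis r ↦ r e₀ are smooth because g and k are, through r = 0 as well when r₀ = 0, and symmetry makes
them even. -/
theorem exists_profile (hn : 3 ≤ n) {r₀ : ℝ} {g k : Tensor2 n}
    {g₁₁ ρ kₙ kₜ : ℝ → ℝ} (hdata : IsInitialData n r₀ g k)
    (hsym : IsSphericallySymmetric n r₀ g k g₁₁ ρ kₙ kₜ) :
    ∃ D G kn kt : ℝ → ℝ, IsProfile n r₀ g k D G kn kt ∧ ∀ r, r₀ ≤ r → 0 < r →
      D r = g₁₁ r ∧ ρ r = r * Real.sqrt (G r) ∧ kt r = kₜ r := by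
  set i₀ : Fin n := ⟨0, by omega⟩ with hi₀
  set i₁ : Fin n := ⟨1, by omega⟩ with hi₁
  have hne : i₁ ≠ i₀ := by simp [hi₀, hi₁]
  set e : Fin n → ℝ → E n := fun i r => EuclideanSpace.single i r with he
  have henorm : ∀ i r, ‖e i r‖ = |r| := fun i r => by
    simp [he]
  have heM : ∀ i r, r₀ ≤ |r| → e i r ∈ M n r₀ := fun i r hr => by
    change r₀ ≤ ‖e i r‖; rwa [henorm]
  have he0 : ∀ i r, r ≠ 0 → e i r ≠ 0 := fun i r hr => by
    rw [← norm_ne_zero_iff, henorm]; exact abs_ne_zero.2 hr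
  have hnu0 : ∀ i r, r ≠ 0 → nu (e i r) i * nu (e i r) i = 1 := fun i r hr => by
    simp only [he, nu_single, if_true]; exact div_abs_mul_self hr
  have hnu1 : ∀ i j r, j ≠ i → nu (e i r) j = 0 := fun i j r hj => by
    simp only [he, nu_single, if_neg hj]
  set D : ℝ → ℝ := fun r => g (e i₀ r) i₀ i₀ with hD
  set G : ℝ → ℝ := fun r => g (e i₀ r) i₁ i₁ with hG
  have gform : ∀ x ∈ M n r₀, x ≠ 0 → ∀ i j, g x i j =
      g₁₁ ‖x‖ * (nu x i * nu x j) + ρ ‖x‖ ^ 2 / ‖x‖ ^ 2 * proj x i j := fun x hx hx0 i j => by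
    rw [hsym.g_eq x hx hx0, nu_mul_nu]; rfl
  have kform : ∀ x ∈ M n r₀, x ≠ 0 → ∀ i j, k x i j =
      g₁₁ ‖x‖ * kₙ ‖x‖ * (nu x i * nu x j) + ρ ‖x‖ ^ 2 / ‖x‖ ^ 2 * kₜ ‖x‖ * proj x i j :=
    fun x hx hx0 i j => by
    rw [hsym.k_eq x hx hx0, gform x hx hx0, nu_mul_nu]; ring
  have hDr : ∀ r, r₀ ≤ |r| → r ≠ 0 → D r = g₁₁ |r| := fun r hr hr0 => by
    simp only [hD]
    rw [gform _ (heM i₀ r hr) (he0 i₀ r hr0), proj, hnu0 i₀ r hr0, henorm]; simp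
  have hGr' : ∀ i j, i ≠ j → ∀ r, r₀ ≤ |r| → r ≠ 0 → g (e i r) j j = ρ |r| ^ 2 / |r| ^ 2 :=
    fun i j hij r hr hr0 => by
    rw [gform _ (heM i r hr) (he0 i r hr0), proj, hnu1 i j r hij.symm, henorm]; simp
  have hGr : ∀ r, r₀ ≤ |r| → r ≠ 0 → G r = ρ |r| ^ 2 / |r| ^ 2 := hGr' i₀ i₁ hne.symm
  have hmaps : ∀ i, MapsTo (e i) (profileLine r₀) (M n r₀) := fun i r hr => heM i r hr
  have hgs : ∀ i a b, ContDiffOn ℝ ∞ (fun r => g (e i r) a b) (profileLine r₀) := fun i a b =>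
    (hdata.smooth_g a b).comp (contDiff_single i).contDiffOn (hmaps i)
  have hks : ∀ i a b, ContDiffOn ℝ ∞ (fun r => k (e i r) a b) (profileLine r₀) := fun i a b =>
    (hdata.smooth_k a b).comp (contDiff_single i).contDiffOn (hmaps i)
  have hDp : ∀ r ∈ profileLine r₀, 0 < D r := fun r hr => (hdata.posDef_g _ (heM i₀ r hr)).diag_pos
  have hGp : ∀ r ∈ profileLine r₀, 0 < G r := fun r hr => (hdata.posDef_g _ (heM i₀ r hr)).diag_pos
  set kn : ℝ → ℝ := fun r => k (e i₀ r) i₀ i₀ / D r with hkn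
  set kt : ℝ → ℝ := fun r => k (e i₀ r) i₁ i₁ / G r with hkt
  have hknr : ∀ r, r₀ ≤ |r| → r ≠ 0 → kn r = kₙ |r| := fun r hr hr0 => by
    have h1 := hDp r hr
    simp only [hkn]
    rw [hDr r hr hr0] at h1 ⊢
    rw [kform _ (heM i₀ r hr) (he0 i₀ r hr0), proj, hnu0 i₀ r hr0, henorm]; simp
    field_simp
  have hktr : ∀ r, r₀ ≤ |r| → r ≠ 0 → kt r = kₜ |r| := fun r hr hr0 => by
    have h1 := hGp r hr
    simp only [hkt]
    rw [hGr r hr hr0] at h1 ⊢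
    rw [kform _ (heM i₀ r hr) (he0 i₀ r hr0), proj, hnu1 i₀ i₁ r hne, henorm]
    rw [div_eq_iff h1.ne']; simp; ring
  have even : ∀ φ ψ : ℝ → ℝ, (∀ r, r₀ ≤ |r| → r ≠ 0 → φ r = ψ |r|) → r₀ = 0 → Function.Even φ := by
    intro φ ψ hφ h0 r
    by_cases hr : r = 0
    · simp [hr]
    · rw [hφ (-r) (by rw [h0]; positivity) (neg_ne_zero.2 hr), abs_neg,
        hφ r (by rw [h0]; positivity) hr]
  have hnorm : ∀ x ∈ M n r₀, x ≠ 0 → r₀ ≤ |‖x‖| ∧ ‖x‖ ≠ 0 := fun x hx hx0 => by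
    rw [abs_of_nonneg (norm_nonneg x)]
    exact ⟨hx, norm_ne_zero_iff.2 hx0⟩
  refine ⟨D, G, kn, kt, ⟨hgs _ _ _, hgs _ _ _, (hks _ _ _).div (hgs _ _ _) fun r hr => (hDp r hr).ne',
    (hks _ _ _).div (hgs _ _ _) fun r hr => (hGp r hr).ne', hDp, hGp, even D _ hDr,
    even G (fun r => ρ r ^ 2 / r ^ 2) hGr, even kn _ hknr, even kt _ hktr, fun h0 => ?_,
    fun x hx hx0 i j => ?_, fun x hx hx0 i j => ?_⟩, fun r hr hr0 => ?_⟩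
  -- The component g₀₀ at the origin is D(0) along the axis e₀, but along the axis e₁ it is a
  -- tangential component and tends to G(0).
  · have hline : profileLine r₀ = univ := by simp [profileLine, h0]
    have c1 : Tendsto (fun r => g (e i₁ r) i₀ i₀) (𝓝[≠] 0) (𝓝 (D 0)) := by
      have h1 := (hgs i₁ i₀ i₀).continuousOn
      rw [hline, continuousOn_univ] at h1
      have h3 : D 0 = g (e i₁ 0) i₀ i₀ := by
        have : e i₁ 0 = e i₀ 0 := by ext j; simp [he]
        rw [this]
      rw [h3]
      exact (h1.tendsto 0).mono_left nhdsWithin_le_nhds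
    have c2 : Tendsto G (𝓝[≠] 0) (𝓝 (G 0)) := by
      have h1 := (hgs i₀ i₁ i₁).continuousOn
      rw [hline, continuousOn_univ] at h1
      exact (h1.continuousAt (x := 0)).tendsto.mono_left nhdsWithin_le_nhds
    refine tendsto_nhds_unique (c1.congr' ?_) c2
    filter_upwards [self_mem_nhdsWithin] with r hr
    have hr : r ≠ 0 := hr
    rw [hGr r (by rw [h0]; positivity) hr, hGr' i₁ i₀ hne r (by rw [h0]; positivity) hr]
  · obtain ⟨h1, h2⟩ := hnorm x hx hx0
    rw [gform x hx hx0, hDr _ h1 h2, hGr _ h1 h2, abs_of_nonneg (norm_nonneg x)]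
  · obtain ⟨h1, h2⟩ := hnorm x hx hx0
    rw [kform x hx hx0, hDr _ h1 h2, hGr _ h1 h2, hknr _ h1 h2, hktr _ h1 h2,
      abs_of_nonneg (norm_nonneg x)]
  · have h1 : r₀ ≤ |r| := by rwa [abs_of_pos hr0]
    have hρ := hsym.ρ_pos r hr hr0
    rw [hDr r h1 hr0.ne', hGr r h1 hr0.ne', hktr r h1 hr0.ne', abs_of_pos hr0, ← div_pow,
      Real.sqrt_sq (by positivity)]
    refine ⟨rfl, ?_, rfl⟩
    field_simp

theorem Ici_subset_profileLine {r₀ : ℝ} (hr₀ : 0 ≤ r₀) : Ici r₀ ⊆ profileLine r₀ := fun r hr => by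
  have hr : r₀ ≤ r := hr
  change r₀ ≤ |r|
  rwa [abs_of_nonneg (hr₀.trans hr)]

theorem radii_subset_profileLine {r₀ : ℝ} : radii r₀ ⊆ profileLine r₀ := fun r hr => by
  change r₀ ≤ |r|
  rcases hr with h | h
  · rw [h]; exact abs_nonneg r
  · exact h.le.trans (le_abs_self r)

namespace IsProfile

variable {r₀ : ℝ} {g k : Tensor2 n} {D G kn kt : ℝ → ℝ} (h : IsProfile n r₀ g k D G kn kt)
  (hr₀ : 0 ≤ r₀)
include h hr₀

theorem isRadialMetric : IsRadialMetric g D G (Ioi r₀) where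
  isOpen := isOpen_Ioi
  pos _ hr := hr₀.trans_lt hr
  D_pos r hr := h.D_pos r (Ici_subset_profileLine hr₀ (mem_Ici.2 (le_of_lt hr)))
  G_pos r hr := h.G_pos r (Ici_subset_profileLine hr₀ (mem_Ici.2 (le_of_lt hr)))
  D_smooth := h.D_smooth.mono (Ioi_subset_Ici_self.trans (Ici_subset_profileLine hr₀))
  G_smooth := h.G_smooth.mono (Ioi_subset_Ici_self.trans (Ici_subset_profileLine hr₀))
  eq x hx := h.g_eq x (le_of_lt hx : r₀ ≤ ‖x‖) (norm_ne_zero_iff.1 (hr₀.trans_lt hx).ne')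

theorem k_eq' (x : E n) (hx : ‖x‖ ∈ Ioi r₀) (i j : Fin n) :
    k x i j = D ‖x‖ * kn ‖x‖ * (nu x i * nu x j) + G ‖x‖ * kt ‖x‖ * proj x i j :=
  h.k_eq x (le_of_lt hx : r₀ ≤ ‖x‖) (norm_ne_zero_iff.1 (hr₀.trans_lt hx).ne') i j

theorem trace_eq {x : E n} (hx : ‖x‖ ∈ Ioi r₀) : trace g k x = kn ‖x‖ + (n - 1) * kt ‖x‖ := by
  have hD := ((h.isRadialMetric hr₀).D_pos _ hx).ne'
  have hG := ((h.isRadialMetric hr₀).G_pos _ hx).ne'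
  unfold trace
  rw [(h.isRadialMetric hr₀).sum_inv_mul hx (k x) _ _ (h.k_eq' hr₀ x hx)]
  field_simp

end IsProfile

/-- The logarithmic derivative of the area radius `r √G`, one-sided at the boundary. -/
noncomputable def areaLogDeriv (r₀ : ℝ) (G : ℝ → ℝ) (r : ℝ) : ℝ :=
  derivWithin G (Ici r₀) r / (2 * G r) + 1 / r

theorem areaLogDeriv_eq {r₀ : ℝ} (G : ℝ → ℝ) {r : ℝ} (hr : r₀ < r) :
    areaLogDeriv r₀ G r = halfLogDeriv G r + 1 / r := by
  unfold areaLogDeriv halfLogDeriv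
  rw [derivWithin_of_mem_nhds (Ici_mem_nhds hr)]

theorem IsProfile.hasDerivWithinAt_area {r₀ : ℝ} (hr₀ : 0 ≤ r₀) {g k : Tensor2 n}
    {D G kn kt : ℝ → ℝ} (h : IsProfile n r₀ g k D G kn kt) {r : ℝ} (hr : r₀ ≤ r) (hr0 : 0 < r) :
    HasDerivWithinAt (fun r => r * Real.sqrt (G r)) (r * Real.sqrt (G r) * areaLogDeriv r₀ G r)
      (Ici r₀) r := by
  have hG := h.G_pos r (Ici_subset_profileLine hr₀ hr)
  have h1 : HasDerivWithinAt G (derivWithin G (Ici r₀) r) (Ici r₀) r :=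
    (((h.G_smooth.mono (Ici_subset_profileLine hr₀)) r hr).differentiableWithinAt
      (by simp)).hasDerivWithinAt
  refine ((hasDerivWithinAt_id r _).mul (h1.sqrt hG.ne')).congr_deriv ?_
  unfold areaLogDeriv
  have h2 := Real.sqrt_pos.2 hG
  have h3 := Real.sq_sqrt hG.le
  set S := Real.sqrt (G r)
  rw [← h3]
  simp only [id]
  field_simp
  ring

theorem IsProfile.nullExpansion_eq {r₀ : ℝ} (hr₀ : 0 ≤ r₀) {g k : Tensor2 n}
    {D G kn kt g₁₁ ρ kₜ : ℝ → ℝ} (h : IsProfile n r₀ g k D G kn kt)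
    (hρ : ∀ r, r₀ ≤ r → 0 < r → D r = g₁₁ r ∧ ρ r = r * Real.sqrt (G r) ∧ kt r = kₜ r)
    (σ : ℝ) {r : ℝ} (hr : r₀ ≤ r) (hr0 : 0 < r) : nullExpansion n r₀ g₁₁ ρ kₜ σ r =
      (n - 1) * (areaLogDeriv r₀ G r / Real.sqrt (D r) + σ * kt r) := by
  obtain ⟨h1, h2, h3⟩ := hρ r hr hr0
  have hG := h.G_pos r (Ici_subset_profileLine hr₀ hr)
  have hd : derivWithin ρ (Ici r₀) r = r * Real.sqrt (G r) * areaLogDeriv r₀ G r := by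
    refine HasDerivWithinAt.derivWithin ?_ (uniqueDiffOn_Ici r₀ r hr)
    refine (h.hasDerivWithinAt_area hr₀ hr hr0).congr_of_eventuallyEq ?_ h2
    filter_upwards [self_mem_nhdsWithin, mem_nhdsWithin_of_mem_nhds (lt_mem_nhds hr0)]
      with y hy hy0 using (hρ y hy hy0).2.1
  unfold nullExpansion
  rw [hd, ← h1, ← h3, h2]
  have := Real.sqrt_pos.2 hG
  field_simp

end Jang

namespace Jang

variable {n : ℕ}

/-! ### The asymptotically flat end -/

theorem fderiv_apply_eq_sum {F : E n → ℝ} {x : E n} (w : E n) :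
    fderiv ℝ F x w = ∑ k, w k * pd k F x := by
  have hw : w = ∑ i, w i • EuclideanSpace.single i (1 : ℝ) := by
    ext j; simp [Finset.sum_apply, Pi.single_apply]
  conv_lhs => rw [hw]
  simp only [map_sum, map_smul, smul_eq_mul, pd]

/-- The quadratic form of a matrix. -/
noncomputable def quad (A : Matrix (Fin n) (Fin n) ℝ) (w : E n) : ℝ :=
  ∑ a, ∑ b, A a b * w a * w b

theorem sum_pullback (Ψ : E n → E n) (T : Tensor2 n) (y ξ : E n) :
    ∑ i, ∑ j, pullback Ψ T y i j * ξ i * ξ j = quad (T (Ψ y)) (fderiv ℝ Ψ y ξ) := by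
  have hw : ∀ a, fderiv ℝ Ψ y ξ a = ∑ i, ξ i * fderiv ℝ Ψ y (EuclideanSpace.single i 1) a := fun a => by
    have hξ : ξ = ∑ i, ξ i • EuclideanSpace.single i (1 : ℝ) := by
      ext j; simp [Finset.sum_apply, Pi.single_apply]
    conv_lhs => rw [hξ]
    simp only [map_sum, map_smul]
    simp
  unfold quad pullback
  simp only [hw]
  simp only [Finset.sum_mul, Finset.mul_sum]
  set L : Fin n → Fin n → ℝ := fun i a => fderiv ℝ Ψ y (EuclideanSpace.single i 1) a
  have e1 : ∀ i, ∑ j, ∑ a, ∑ b, T (Ψ y) a b * L i a * L j b * ξ i * ξ j =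
      ∑ a, ∑ j, ∑ b, T (Ψ y) a b * L i a * L j b * ξ i * ξ j := fun i => Finset.sum_comm
  calc ∑ i, ∑ j, ∑ a, ∑ b, T (Ψ y) a b * L i a * L j b * ξ i * ξ j
      = ∑ a, ∑ i, ∑ b, ∑ j, T (Ψ y) a b * L i a * L j b * ξ i * ξ j := by
        simp only [e1]
        rw [Finset.sum_comm]
        refine Finset.sum_congr rfl fun a _ => Finset.sum_congr rfl fun i _ => Finset.sum_comm
    _ = ∑ a, ∑ b, ∑ i, ∑ j, T (Ψ y) a b * L i a * L j b * ξ i * ξ j :=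
        Finset.sum_congr rfl fun a _ => Finset.sum_comm
    _ = ∑ a, ∑ b, ∑ j, ∑ i, T (Ψ y) a b * (ξ i * L i a) * (ξ j * L j b) := by
        refine Finset.sum_congr rfl fun a _ => Finset.sum_congr rfl fun b _ => ?_
        rw [Finset.sum_comm]
        refine Finset.sum_congr rfl fun j _ => Finset.sum_congr rfl fun i _ => ?_
        ring

theorem sum_sq_eq_norm_sq (ξ : E n) : ∑ i, ξ i * ξ i = ‖ξ‖ ^ 2 := by
  rw [EuclideanSpace.real_norm_sq_eq]; simp only [sq]

theorem quad_one (ξ : E n) : quad 1 ξ = ‖ξ‖ ^ 2 := by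
  unfold quad
  simp only [Matrix.one_apply, ite_mul, one_mul, zero_mul, Finset.sum_ite_eq, Finset.mem_univ,
    if_true, sum_sq_eq_norm_sq]

theorem abs_quad_le {A : Matrix (Fin n) (Fin n) ℝ} {c : ℝ} (hA : ∀ i j, |A i j| ≤ c) (ξ : E n) :
    |quad A ξ| ≤ n * c * ‖ξ‖ ^ 2 := by
  have h1 : |quad A ξ| ≤ ∑ i, ∑ j, c * ((ξ i * ξ i + ξ j * ξ j) / 2) := by
    unfold quad
    refine (Finset.abs_sum_le_sum_abs _ _).trans (Finset.sum_le_sum fun i _ => ?_)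
    refine (Finset.abs_sum_le_sum_abs _ _).trans (Finset.sum_le_sum fun j _ => ?_)
    rw [mul_assoc, abs_mul, abs_mul]
    have hc : 0 ≤ c := (abs_nonneg _).trans (hA i j)
    refine mul_le_mul (hA i j) ?_ (by positivity) hc
    rw [← abs_mul_abs_self (ξ i), ← abs_mul_abs_self (ξ j)]
    nlinarith [sq_nonneg (|ξ i| - |ξ j|)]
  refine h1.trans_eq ?_
  have e : ∀ i, ∑ j, c * ((ξ i * ξ i + ξ j * ξ j) / 2) =
      n * c / 2 * (ξ i * ξ i) + c / 2 * ‖ξ‖ ^ 2 := fun i => by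
    rw [← Finset.mul_sum, ← Finset.sum_div, Finset.sum_add_distrib, sum_sq_eq_norm_sq,
      Finset.sum_const, Finset.card_univ, Fintype.card_fin, nsmul_eq_mul]
    ring
  simp only [e]
  rw [Finset.sum_add_distrib, ← Finset.mul_sum, sum_sq_eq_norm_sq, Finset.sum_const,
    Finset.card_univ, Fintype.card_fin, nsmul_eq_mul]
  ring

theorem quad_radial {x : E n} {A : Matrix (Fin n) (Fin n) ℝ} {p q : ℝ}
    (hA : ∀ i j, A i j = p * (nu x i * nu x j) + q * proj x i j) (w : E n) :
    quad A w = p * (∑ i, nu x i * w i) ^ 2 + q * (‖w‖ ^ 2 - (∑ i, nu x i * w i) ^ 2) := by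
  have e : ∀ i j, A i j * w i * w j = (p - q) * ((nu x i * w i) * (nu x j * w j))
      + q * ((1 : Matrix (Fin n) (Fin n) ℝ) i j * w i * w j) := fun i j => by
    rw [hA, proj, Matrix.one_apply]; ring
  have h1 := quad_one w
  unfold quad at h1 ⊢
  simp only [e, Finset.sum_add_distrib, ← Finset.mul_sum, h1]
  rw [← Finset.sum_mul]
  ring

/-- An asymptotically flat chart, with the first order consequences of the decay conditions. -/
structure IsFlatEnd (n : ℕ) (r₀ : ℝ) (g k : Tensor2 n) (φ : OpenPartialHomeomorph (E n) (E n))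
    (R₁ C : ℝ) : Prop where
  R₁_pos : 0 < R₁
  mem_target : ∀ y, R₁ ≤ ‖y‖ → y ∈ φ.target
  lt_norm : ∀ y, R₁ ≤ ‖y‖ → r₀ < ‖φ.symm y‖
  smooth : ContDiffOn ℝ ∞ φ φ.source
  smooth_symm : ContDiffOn ℝ ∞ φ.symm φ.target
  proper : ∀ R, ∃ r, ∀ x, r ≤ ‖x‖ → x ∈ φ.source ∧ R < ‖φ x‖
  quad_le : ∀ y, R₁ ≤ ‖y‖ → ∀ ξ, quad (g (φ.symm y)) (fderiv ℝ φ.symm y ξ) ≤ 4 * ‖ξ‖ ^ 2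
  le_quad : ∀ y, R₁ ≤ ‖y‖ → ∀ ξ, ‖ξ‖ ^ 2 ≤ 4 * quad (g (φ.symm y)) (fderiv ℝ φ.symm y ξ)
  quad_k_le : ∀ y, R₁ ≤ ‖y‖ → ∀ ξ,
    |quad (k (φ.symm y)) (fderiv ℝ φ.symm y ξ)| ≤ C / ‖y‖ ^ (n - 1) * ‖ξ‖ ^ 2
  scalarCurv_le : ∀ y, R₁ ≤ ‖y‖ → |scalarCurv g (φ.symm y)| ≤ C / ‖y‖ ^ (n + 1)
  trace_le : ∀ y, R₁ ≤ ‖y‖ → |trace g k (φ.symm y)| ≤ C / ‖y‖ ^ n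

theorem exists_isFlatEnd (hn : 3 ≤ n) {r₀ : ℝ} {g k : Tensor2 n}
    (hflat : AsymptoticallyFlat n r₀ g k) : ∃ φ R₁ C, IsFlatEnd n r₀ g k φ R₁ C := by
  obtain ⟨ρ₀, C, φ, hρ₀, hsrc, htgt, hφ, hψ, hcpt, hdecay⟩ := hflat
  -- The source of the chart is open in ℝⁿ and contained in M, so it has no boundary point:
  -- shrinking such a point slightly would leave M.
  have hint : ∀ x ∈ φ.source, x ≠ 0 → r₀ < ‖x‖ := by
    intro x hx hx0
    refine lt_of_le_of_ne (hsrc hx) fun heq => ?_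
    have hc : ContinuousAt (fun t : ℝ => t • x) 1 := by fun_prop
    have h1 : ∀ᶠ t : ℝ in 𝓝 1, t • x ∈ φ.source :=
      hc.preimage_mem_nhds (φ.open_source.mem_nhds (by simpa using hx))
    have h2 : ∀ᶠ t : ℝ in 𝓝[<] 1, t • x ∈ φ.source := nhdsWithin_le_nhds h1
    have h3 : ∀ᶠ t : ℝ in 𝓝[<] 1, t ∈ Ioo (0:ℝ) 1 := Ioo_mem_nhdsLT one_pos
    obtain ⟨t, ht, ht'⟩ := (h2.and h3).exists
    have h4 : r₀ ≤ ‖t • x‖ := hsrc ht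
    rw [norm_smul, Real.norm_eq_abs, abs_of_pos ht'.1, heq] at h4
    have := norm_pos_iff.2 hx0
    nlinarith [ht'.2]
  -- When r₀ = 0 the chart might contain the origin, where polar formulas fail; radii beyond |φ(0)|
  -- exclude it.
  obtain ⟨Rz, hRz⟩ : ∃ Rz, ∀ y, ρ₀ < ‖y‖ → Rz < ‖y‖ → φ.symm y ≠ 0 := by
    refine ⟨‖φ 0‖, fun y hy hy2 h0 => ?_⟩
    have hyt : y ∈ φ.target := by rw [htgt]; exact hy
    have := φ.right_inv hyt
    rw [h0] at this
    rw [this] at hy2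
    exact lt_irrefl _ hy2
  have hnpos : (0 : ℝ) < n := by have : 0 < n := by omega
                                 exact_mod_cast this
  set C₁ : ℝ := |C| with hC₁
  -- The entry 2nC₁ ensures n C₁/|y| ≤ 1/2, which keeps the quadratic form of g in the chart within
  -- half of the Euclidean one.
  set R₁ : ℝ := max (max (ρ₀ + 1) (|Rz| + 1)) (max 1 (2 * n * C₁)) with hR₁
  have hRρ : ρ₀ < R₁ := lt_of_lt_of_le (lt_add_one _) ((le_max_left _ _).trans (le_max_left _ _))
  have hRz' : Rz < R₁ := lt_of_lt_of_le (lt_of_le_of_lt (le_abs_self _) (lt_add_one _))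
    ((le_max_right _ _).trans (le_max_left _ _))
  have hR1 : 1 ≤ R₁ := (le_max_left _ _).trans (le_max_right _ _)
  have hRn : 2 * n * C₁ ≤ R₁ := (le_max_right _ _).trans (le_max_right _ _)
  have hy1 : ∀ y : E n, R₁ ≤ ‖y‖ → 0 < ‖y‖ := fun y hy => by linarith
  have hmem : ∀ y, R₁ ≤ ‖y‖ → y ∈ φ.target := fun y hy => by
    rw [htgt]; exact hRρ.trans_le hy
  have hCle : ∀ (y : E n) (j : ℕ), C / ‖y‖ ^ j ≤ C₁ / ‖y‖ ^ j := fun y j =>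
    div_le_div_of_nonneg_right (le_abs_self C) (by positivity)
  have hgq : ∀ y, R₁ ≤ ‖y‖ → ∀ ξ,
      |quad (g (φ.symm y)) (fderiv ℝ φ.symm y ξ) - ‖ξ‖ ^ 2| ≤ 1 / 2 * ‖ξ‖ ^ 2 := by
    intro y hy ξ
    have hy0 := hy1 y hy
    rw [← sum_pullback, ← quad_one ξ]
    have e : ∑ i, ∑ j, pullback φ.symm g y i j * ξ i * ξ j - quad 1 ξ =
        quad (Matrix.of fun i j => pullback φ.symm g y i j - (1 : Matrix (Fin n) (Fin n) ℝ) i j) ξ := by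
      unfold quad
      simp only [Matrix.of_apply, sub_mul, Finset.sum_sub_distrib]
    rw [e, quad_one]
    have h1 := abs_quad_le (A := Matrix.of fun i j =>
      pullback φ.symm g y i j - (1 : Matrix (Fin n) (Fin n) ℝ) i j) (c := C₁ / ‖y‖) (fun i j => by
        have := (hdecay y (hRρ.trans_le hy)).1 i j 0 (by norm_num)
        rw [norm_iteratedFDeriv_zero, Real.norm_eq_abs] at this
        refine this.trans ((hCle y _).trans ?_)
        exact div_le_div_of_nonneg_left (abs_nonneg C) hy0
          (le_self_pow₀ (hR1.trans hy) (by omega))) ξ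
    refine h1.trans (mul_le_mul_of_nonneg_right ?_ (by positivity))
    rw [← mul_div_assoc, div_le_iff₀ hy0]
    linarith
  refine ⟨φ, R₁, n * C₁ + C₁, ⟨by linarith, hmem, fun y hy => hint _ (φ.map_target (hmem y hy))
    (hRz y (hRρ.trans_le hy) (hRz'.trans_le hy)), hφ, hψ, fun R => ?_, fun y hy ξ => ?_,
    fun y hy ξ => ?_, fun y hy ξ => ?_, fun y hy => ?_, fun y hy => ?_⟩⟩
  · obtain ⟨b, hb⟩ := (hcpt (max R ρ₀) (le_max_right _ _)).isBounded.exists_norm_le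
    refine ⟨max (b + 1) r₀, fun x hx => ?_⟩
    have hxM : x ∈ M n r₀ := (le_max_right _ _).trans hx
    have hxim : x ∈ φ.symm '' {y | max R ρ₀ < ‖y‖} := by
      by_contra hcon
      have := hb x ⟨hxM, hcon⟩
      linarith [(le_max_left (b + 1) r₀).trans hx]
    obtain ⟨y, hy, rfl⟩ := hxim
    have hy : max R ρ₀ < ‖y‖ := hy
    have hyt : y ∈ φ.target := by rw [htgt]; exact (le_max_right _ _).trans_lt hy
    refine ⟨φ.map_target hyt, ?_⟩
    rw [φ.right_inv hyt]
    exact (le_max_left _ _).trans_lt hy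
  · have := (abs_le.1 (hgq y hy ξ)).2
    nlinarith [sq_nonneg ‖ξ‖]
  · have := (abs_le.1 (hgq y hy ξ)).1
    nlinarith [sq_nonneg ‖ξ‖]
  · have hy0 := hy1 y hy
    rw [← sum_pullback]
    have h1 := abs_quad_le (A := Matrix.of fun i j => pullback φ.symm k y i j)
      (c := C₁ / ‖y‖ ^ (n - 1)) (fun i j => by
        have := (hdecay y (hRρ.trans_le hy)).2.1 i j 0 (by norm_num)
        rw [norm_iteratedFDeriv_zero, Real.norm_eq_abs, add_zero] at this
        exact this.trans (hCle y _)) ξ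
    refine le_trans h1 (mul_le_mul_of_nonneg_right ?_ (by positivity))
    rw [← mul_div_assoc]
    exact div_le_div_of_nonneg_right (by linarith [abs_nonneg C]) (by positivity)
  · refine ((hdecay y (hRρ.trans_le hy)).2.2.1.trans (hCle y _)).trans
      (div_le_div_of_nonneg_right ?_ (by positivity))
    have : 0 ≤ n * C₁ := by positivity
    linarith
  · refine ((hdecay y (hRρ.trans_le hy)).2.2.2.trans (hCle y _)).trans
      (div_le_div_of_nonneg_right ?_ (by positivity))
    have : 0 ≤ n * C₁ := by positivity
    linarith

end Jang

namespace Jang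

variable {n : ℕ}

/-! ### Comparison of the radial quantities with an asymptotically flat chart -/

theorem sq_sum_nu_mul_le {x : E n} (hx : x ≠ 0) (w : E n) : (∑ i, nu x i * w i) ^ 2 ≤ ‖w‖ ^ 2 := by
  have h := Finset.sum_mul_sq_le_sq_mul_sq Finset.univ (nu x) w
  have h1 := sum_nu_sq hx
  simp only [← sq] at h1
  rwa [h1, one_mul, ← EuclideanSpace.real_norm_sq_eq] at h

theorem isPreconnected_lt_norm (hn : 3 ≤ n) {R : ℝ} (hR : 0 ≤ R) :
    IsPreconnected {y : E n | R < ‖y‖} := by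
  have hrank : 1 < Module.rank ℝ (E n) := by
    rw [← Module.finrank_eq_rank, finrank_euclideanSpace_fin]
    exact_mod_cast (by omega : 1 < n)
  have h := ((isPreconnected_Ioi (a := R)).prod (isPreconnected_sphere hrank (0 : E n) 1)).image
    (fun p : ℝ × E n => p.1 • p.2) (by fun_prop)
  convert h using 1
  ext y
  simp only [mem_ofPred_eq, mem_image, mem_prod, mem_Ioi, mem_sphere_zero_iff_norm, Prod.exists]
  constructor
  · intro hy
    have : ‖y‖ ≠ 0 := (hR.trans_lt hy).ne'
    refine ⟨‖y‖, ‖y‖⁻¹ • y, ⟨hy, ?_⟩, ?_⟩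
    · rw [norm_smul, norm_inv, norm_norm, inv_mul_cancel₀ this]
    · rw [smul_smul, mul_inv_cancel₀ this, one_smul]
  · rintro ⟨t, w, ⟨ht, hw⟩, rfl⟩
    rw [norm_smul, hw, mul_one, Real.norm_eq_abs]
    exact ht.trans_le (le_abs_self t)

/-- Two points on a sphere are joined by a great circle. -/
theorem exists_great_circle {r : ℝ} (hr : 0 < r) {i₀ i₁ : Fin n} (hne : i₁ ≠ i₀) {x : E n}
    (hx : ‖x‖ = r) : ∃ z : E n, ‖z‖ = r ∧ inner ℝ (EuclideanSpace.single i₀ r) z = 0 ∧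
      ∃ θ ∈ Icc (0 : ℝ) Real.pi,
        x = Real.cos θ • (EuclideanSpace.single i₀ r : E n) + Real.sin θ • z := by
  set e : E n := EuclideanSpace.single i₀ r with he
  have hen : ‖e‖ = r := by simp [he, abs_of_pos hr]
  set c := inner ℝ e x / r ^ 2 with hc
  have hc1 : |c| ≤ 1 := by
    rw [hc, abs_div, abs_of_pos (by positivity : 0 < r ^ 2), div_le_one (by positivity)]
    calc |inner ℝ e x| ≤ ‖e‖ * ‖x‖ := abs_real_inner_le_norm e x
      _ = r ^ 2 := by rw [hen, hx, sq]
  have hcos : Real.cos (Real.arccos c) = c := Real.cos_arccos (abs_le.1 hc1).1 (abs_le.1 hc1).2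
  have hsin := Real.sin_arccos c
  have hmem : Real.arccos c ∈ Icc 0 Real.pi := ⟨Real.arccos_nonneg c, Real.arccos_le_pi c⟩
  have hin : inner ℝ e x = c * r ^ 2 := by rw [hc]; field_simp
  have hnorm : ‖x - c • e‖ ^ 2 = (1 - c ^ 2) * r ^ 2 := by
    rw [norm_sub_sq_real, inner_smul_right, real_inner_comm, hin, norm_smul, hen, hx, mul_pow,
      Real.norm_eq_abs, sq_abs]
    ring
  have hc2 : 0 ≤ 1 - c ^ 2 := by nlinarith [abs_le.1 hc1, sq_abs c, abs_nonneg c]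
  rcases hc2.eq_or_lt with h0 | h0
  · refine ⟨EuclideanSpace.single i₁ r, by simp [abs_of_pos hr], ?_, Real.arccos c, hmem, ?_⟩
    · simp [he, EuclideanSpace.inner_single_left, hne.symm]
    · rw [← h0, zero_mul, sq_eq_zero_iff, norm_eq_zero, sub_eq_zero] at hnorm
      rw [hcos, hsin, ← h0, Real.sqrt_zero, zero_smul, add_zero, ← hnorm]
  · have hs : 0 < Real.sqrt (1 - c ^ 2) := Real.sqrt_pos.2 h0
    refine ⟨(Real.sqrt (1 - c ^ 2))⁻¹ • (x - c • e), ?_, ?_, Real.arccos c, hmem, ?_⟩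
    · have h1 : ‖x - c • e‖ = Real.sqrt (1 - c ^ 2) * r := by
        rw [← Real.sqrt_sq (norm_nonneg (x - c • e)), hnorm, Real.sqrt_mul hc2, Real.sqrt_sq hr.le]
      rw [norm_smul, h1, norm_inv, Real.norm_eq_abs, abs_of_pos hs, ← mul_assoc,
        inv_mul_cancel₀ hs.ne', one_mul]
    · rw [inner_smul_right, inner_sub_right, inner_smul_right, hin, real_inner_self_eq_norm_sq, hen]
      ring
    · rw [hcos, hsin, smul_smul, mul_inv_cancel₀ hs.ne', one_smul]; abel

namespace IsFlatEnd

variable {r₀ : ℝ} {g k : Tensor2 n} {φ : OpenPartialHomeomorph (E n) (E n)} {R₁ C : ℝ}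
  (F : IsFlatEnd n r₀ g k φ R₁ C)
include F

theorem hasFDerivAt {x : E n} (hx : x ∈ φ.source) : HasFDerivAt φ (fderiv ℝ φ x) x :=
  ((F.smooth.contDiffAt (φ.open_source.mem_nhds hx)).differentiableAt (by simp)).hasFDerivAt

theorem hasFDerivAt_symm {y : E n} (hy : y ∈ φ.target) :
    HasFDerivAt φ.symm (fderiv ℝ φ.symm y) y :=
  ((F.smooth_symm.contDiffAt (φ.open_target.mem_nhds hy)).differentiableAt (by simp)).hasFDerivAt

theorem fderiv_symm_fderiv {x : E n} (hx : x ∈ φ.source) (w : E n) :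
    fderiv ℝ φ.symm (φ x) (fderiv ℝ φ x w) = w := by
  have h1 := (F.hasFDerivAt_symm (φ.map_source hx)).comp x (F.hasFDerivAt hx)
  have h2 : HasFDerivAt (φ.symm ∘ φ) (ContinuousLinearMap.id ℝ (E n)) x := by
    refine (hasFDerivAt_id x).congr_of_eventuallyEq ?_
    filter_upwards [φ.open_source.mem_nhds hx] with y hy
    simp [φ.left_inv hy]
  have := congrArg (fun T : E n →L[ℝ] E n => T w) (h1.unique h2)
  simpa using this

theorem norm_fderiv_sq_le {x : E n} (hx : x ∈ φ.source) (hR : R₁ ≤ ‖φ x‖) (w : E n) :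
    ‖fderiv ℝ φ x w‖ ^ 2 ≤ 4 * quad (g x) w := by
  have := F.le_quad (φ x) hR (fderiv ℝ φ x w)
  rwa [F.fderiv_symm_fderiv hx, φ.left_inv hx] at this

theorem abs_quad_k_le {x : E n} (hx : x ∈ φ.source) (hR : R₁ ≤ ‖φ x‖) (w : E n) :
    |quad (k x) w| ≤ |C| / ‖φ x‖ ^ (n - 1) * (4 * quad (g x) w) := by
  have h1 := F.quad_k_le (φ x) hR (fderiv ℝ φ x w)
  rw [F.fderiv_symm_fderiv hx, φ.left_inv hx] at h1
  refine h1.trans (mul_le_mul ?_ (F.norm_fderiv_sq_le hx hR w) (by positivity) (by positivity))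
  exact div_le_div_of_nonneg_right (le_abs_self C) (by positivity)

section

variable {D G : ℝ → ℝ} (hg : IsRadialMetric g D G (Ioi r₀)) {s : ℝ → ℝ}
  (hs : ∀ r, r₀ < r → HasDerivAt s (Real.sqrt (D r)) r)
include hg hs

/-- The arclength grows at most linearly along the rays of the chart. -/
theorem exists_arclength_le : ∃ b, ∀ y, R₁ ≤ ‖y‖ → s ‖φ.symm y‖ ≤ b + 2 * ‖y‖ := by
  have hcont : ContinuousOn (fun y => s ‖φ.symm y‖) (Metric.sphere (0 : E n) R₁) := by
    intro y hy
    have hy : R₁ ≤ ‖y‖ := (mem_sphere_zero_iff_norm.1 hy).ge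
    have h1 : ContinuousAt (fun y => ‖φ.symm y‖) y :=
      ((F.hasFDerivAt_symm (F.mem_target y hy)).continuousAt).norm
    exact (ContinuousAt.comp (f := fun y => ‖φ.symm y‖)
      (hs _ (F.lt_norm y hy)).continuousAt h1).continuousWithinAt
  obtain ⟨b, hb⟩ := (isCompact_sphere (0 : E n) R₁).bddAbove_image hcont
  refine ⟨b, fun y hy => ?_⟩
  have hy0 : 0 < ‖y‖ := F.R₁_pos.trans_le hy
  set w : E n := ‖y‖⁻¹ • y with hw
  have hw1 : ‖w‖ = 1 := by rw [hw, norm_smul, norm_inv, norm_norm, inv_mul_cancel₀ hy0.ne']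
  have htw : ∀ t : ℝ, R₁ ≤ t → ‖t • w‖ = t := fun t ht => by
    rw [norm_smul, hw1, mul_one, Real.norm_eq_abs, abs_of_pos (F.R₁_pos.trans_le ht)]
  set S' : ℝ → ℝ := fun t => Real.sqrt (D ‖φ.symm (t • w)‖) *
    ∑ i, nu (φ.symm (t • w)) i * fderiv ℝ φ.symm (t • w) w i
  have hd : ∀ t, R₁ ≤ t → HasDerivAt (fun t : ℝ => s ‖φ.symm (t • w)‖) (S' t) t := by
    intro t ht
    have ht1 : R₁ ≤ ‖t • w‖ := ht.trans (htw t ht).ge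
    have hx := F.lt_norm _ ht1
    have h1 : HasDerivAt (fun t : ℝ => t • w) w t := by
      simpa using (hasDerivAt_id t).smul_const w
    have h2 := (F.hasFDerivAt_symm (F.mem_target _ ht1)).comp_hasDerivAt t h1
    have h3 := hasPD_radial (hg.ne_zero hx) (hs _ hx)
    have h4 := h3.1.hasFDerivAt.comp_hasDerivAt t h2
    refine h4.congr_deriv ?_
    rw [fderiv_apply_eq_sum]
    simp only [h3.2, S', Finset.mul_sum]
    exact Finset.sum_congr rfl fun i _ => by ring
  -- S'² is the radial part of the squared g-length of the image of the unit vector w, hence at most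
  -- 4.
  have hle : ∀ t, R₁ ≤ t → S' t ≤ 2 := by
    intro t ht
    have ht1 : R₁ ≤ ‖t • w‖ := ht.trans (htw t ht).ge
    have hx := F.lt_norm _ ht1
    have hq := F.quad_le _ ht1 w
    rw [hw1, quad_radial (hg.eq _ hx)] at hq
    have hD := hg.D_pos _ hx
    have hG := hg.G_pos _ hx
    have hc := sq_sum_nu_mul_le (hg.ne_zero hx) (fderiv ℝ φ.symm (t • w) w)
    refine le_of_sq_le_sq ?_ zero_le_two
    simp only [S', mul_pow, Real.sq_sqrt hD.le]
    nlinarith [mul_nonneg hG.le (sub_nonneg.2 hc)]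
  have h1 := le_of_hasDerivAt_nonpos (fun t ht => (hd t ht).sub ((hasDerivAt_id t).const_mul 2))
    (fun t ht => by linarith [hle t ht]) self_mem_Ici hy hy
  have h2 : s ‖φ.symm (R₁ • w)‖ ≤ b := hb ⟨R₁ • w, by
    rw [mem_sphere_zero_iff_norm]; exact htw R₁ le_rfl, rfl⟩
  have h3 : ‖y‖ • w = y := by rw [hw, smul_smul, mul_inv_cancel₀ hy0.ne', one_smul]
  simp only [Pi.sub_apply, h3, id] at h1
  linarith [F.R₁_pos]

omit hg hs in
theorem exists_far (R : ℝ) : ∃ r₂, r₀ < r₂ ∧ ∀ x, r₂ ≤ ‖x‖ →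
    x ∈ φ.source ∧ R₁ ≤ ‖φ x‖ ∧ R < ‖φ x‖ := by
  obtain ⟨r, hr⟩ := F.proper (max R R₁)
  refine ⟨max r (r₀ + 1), by linarith [le_max_right r (r₀ + 1)], fun x hx => ?_⟩
  obtain ⟨h1, h2⟩ := hr x ((le_max_left _ _).trans hx)
  exact ⟨h1, (le_max_right _ _).trans h2.le, (le_max_left _ _).trans_lt h2⟩

/-- Along a coordinate axis the chart image moves at most twice as fast as the arclength, and it
goes to infinity. -/
theorem tendsto_arclength (hr₀ : 0 ≤ r₀) (i₀ : Fin n) : Tendsto s atTop atTop := by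
  obtain ⟨r₂, hr₂, hfar⟩ := F.exists_far 0
  set e : ℝ → E n := fun r => EuclideanSpace.single i₀ r
  have hen : ∀ r, r₂ ≤ r → ‖e r‖ = r := fun r hr => by
    simp [e, abs_of_pos (hr₀.trans_lt (hr₂.trans_le hr))]
  set e1 : E n := EuclideanSpace.single i₀ 1
  have hed : ∀ r, HasDerivAt e e1 r := fun r => by
    have : e = fun r => r • e1 := by ext r j; simp [e, e1]
    rw [this]; simpa using (hasDerivAt_id r).smul_const e1
  have hnu : ∀ r, r₂ ≤ r → ∑ i, nu (e r) i * e1 i = 1 := fun r hr => by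
    have : 0 < r := hr₀.trans_lt (hr₂.trans_le hr)
    simp [e1, e, nu_single, PiLp.single_apply, abs_of_pos this, this.ne']
  have hy : ∀ r, r₂ ≤ r → HasDerivAt (fun r => φ (e r)) (fderiv ℝ φ (e r) e1) r := fun r hr =>
    (F.hasFDerivAt (hfar _ (hr.trans (hen r hr).ge)).1).comp_hasDerivAt r (hed r)
  have hle : ∀ r, r₂ ≤ r → ‖fderiv ℝ φ (e r) e1‖ ≤ 2 * Real.sqrt (D r) := fun r hr => by
    obtain ⟨h1, h2, -⟩ := hfar _ (hr.trans (hen r hr).ge)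
    have hx : ‖e r‖ ∈ Ioi r₀ := by rw [hen r hr]; exact hr₂.trans_le hr
    have h3 := F.norm_fderiv_sq_le h1 h2 e1
    rw [quad_radial (hg.eq _ hx), hnu r hr] at h3
    have h4 : ‖e1‖ = 1 := by simp [e1]
    have hD := hg.D_pos _ hx
    rw [h4, hen r hr] at h3
    rw [hen r hr] at hD
    refine le_of_sq_le_sq ?_ (by positivity)
    rw [mul_pow, Real.sq_sqrt hD.le]
    linarith
  have hbound : ∀ r, r₂ ≤ r → ‖φ (e r)‖ ≤ ‖φ (e r₂)‖ + 2 * (s r - s r₂) := fun r hr => by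
    have := image_norm_le_of_norm_deriv_right_le_deriv_boundary' (a := r₂) (b := r)
      (B := fun r => ‖φ (e r₂)‖ + 2 * (s r - s r₂)) (B' := fun r => 2 * Real.sqrt (D r))
      (fun t ht => (hy t ht.1).continuousAt.continuousWithinAt)
      (fun t ht => (hy t ht.1).hasDerivWithinAt) (by simp)
      (fun t ht => ?_) (fun t ht => ?_) (fun t ht => hle t ht.1) (right_mem_Icc.2 hr)
    · exact this
    · exact ((((hs t (hr₂.trans_le ht.1)).continuousAt).sub continuousAt_const).const_mul
        2 |>.const_add _).continuousWithinAt
    · exact ((((hs t (hr₂.trans_le ht.1)).sub_const _).const_mul 2).const_add _).hasDerivWithinAt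
  refine tendsto_atTop.2 fun b => ?_
  obtain ⟨r₃, hr₃, hfar₃⟩ := F.exists_far (‖φ (e r₂)‖ + 2 * (b - s r₂))
  filter_upwards [eventually_ge_atTop r₂, eventually_ge_atTop r₃] with r h1 h2
  have := (hfar₃ (e r) (by rwa [hen r h1])).2.2
  linarith [hbound r h1]

omit hs in
/-- The image of a symmetry sphere lies in a ball of radius comparable to the area radius. -/
theorem norm_sub_le (hr₀ : 0 ≤ r₀) {r₂ : ℝ} (hr₂ : r₀ < r₂)
    (hfar : ∀ x, r₂ ≤ ‖x‖ → x ∈ φ.source ∧ R₁ ≤ ‖φ x‖) {i₀ i₁ : Fin n} (hne : i₁ ≠ i₀)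
    {r : ℝ} (hr : r₂ ≤ r) {x : E n} (hx : ‖x‖ = r) :
    ‖φ x - φ (EuclideanSpace.single i₀ r)‖ ≤ 2 * Real.pi * (r * Real.sqrt (G r)) := by
  have hr0 : 0 < r := hr₀.trans_lt (hr₂.trans_le hr)
  obtain ⟨z, hz, hez, θ, hθ, hxθ⟩ := exists_great_circle hr0 hne hx
  set e : E n := EuclideanSpace.single i₀ r with he
  have hen : ‖e‖ = r := by simp [he, abs_of_pos hr0]
  have hinner : ∀ a b c d : ℝ, inner ℝ (a • e + b • z) (c • e + d • z) = (a * c + b * d) * r ^ 2 := by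
    intro a b c d
    rw [inner_add_left, inner_add_right, inner_add_right]
    simp only [inner_smul_left, inner_smul_right, real_inner_self_eq_norm_sq, hez,
      real_inner_comm e z, hen, hz, conj_trivial]
    ring
  set γ : ℝ → E n := fun t => Real.cos t • e + Real.sin t • z with hγ
  set γ' : ℝ → E n := fun t => (-Real.sin t) • e + Real.cos t • z with hγ'
  have hd : ∀ t, HasDerivAt γ (γ' t) t := fun t =>
    ((Real.hasDerivAt_cos t).smul_const e).add ((Real.hasDerivAt_sin t).smul_const z)
  have hγn : ∀ t, ‖γ t‖ = r := fun t => by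
    have : ‖γ t‖ ^ 2 = r ^ 2 := by
      rw [← real_inner_self_eq_norm_sq, hγ, hinner]
      nlinarith [Real.sin_sq_add_cos_sq t]
    exact (pow_left_inj₀ (norm_nonneg _) hr0.le two_ne_zero).1 this
  have hγ'n : ∀ t, ‖γ' t‖ ^ 2 = r ^ 2 := fun t => by
    rw [← real_inner_self_eq_norm_sq, hγ', hinner]
    nlinarith [Real.sin_sq_add_cos_sq t]
  have hnu : ∀ t, ∑ i, nu (γ t) i * γ' t i = 0 := fun t => by
    have h1 : inner ℝ (γ t) (γ' t) = 0 := by rw [hγ, hγ', hinner]; ring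
    rw [PiLp.inner_apply] at h1
    have : ∀ i, nu (γ t) i * γ' t i = inner ℝ (γ t i) (γ' t i) / r := fun i => by
      simp only [nu, hγn, RCLike.inner_apply, conj_trivial]; ring
    simp only [this]
    rw [← Finset.sum_div, h1, zero_div]
  have hrm : r ∈ Ioi r₀ := hr₂.trans_le hr
  have hG := hg.G_pos r hrm
  -- A great circle is tangential, so its g-speed is ρ = r√G; the chart at most doubles it, and θ ≤
  -- π.
  have hspeed : ∀ t, ‖fderiv ℝ φ (γ t) (γ' t)‖ ≤ 2 * (r * Real.sqrt (G r)) := fun t => by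
    obtain ⟨h1, h2⟩ := hfar (γ t) (by rw [hγn]; exact hr)
    have h3 := F.norm_fderiv_sq_le h1 h2 (γ' t)
    rw [quad_radial (hg.eq _ (by rw [hγn]; exact hrm)), hnu, hγ'n, hγn] at h3
    refine le_of_sq_le_sq ?_ (by positivity)
    rw [mul_pow, mul_pow, Real.sq_sqrt hG.le]
    linarith
  have hmv := (convex_univ (𝕜 := ℝ) (E := ℝ)).norm_image_sub_le_of_norm_hasDerivWithin_le
    (f := fun t => φ (γ t))
    (fun t _ => ((F.hasFDerivAt (hfar (γ t) (by rw [hγn]; exact hr)).1).comp_hasDerivAt t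
      (hd t)).hasDerivWithinAt) (fun t _ => hspeed t) (mem_univ 0) (mem_univ θ)
  have hγ0 : γ 0 = e := by simp [hγ]
  have hγθ : γ θ = x := hxθ.symm
  simp only [hγ0, hγθ, sub_zero] at hmv
  refine hmv.trans ?_
  rw [Real.norm_eq_abs, abs_of_nonneg hθ.1]
  have : 0 ≤ r * Real.sqrt (G r) := by positivity
  nlinarith [hθ.2, mul_le_mul_of_nonneg_left hθ.2 this]

-- The image of S_r has to surround the origin of the chart. If |p| > 2πρ for a point p of the
-- image, the whole image would lie in the ball |y - p| < |p|. Its complement, outside |y| < R₁,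
-- would then allow a path from the inner sphere to infinity without crossing S_r.
omit hs in
theorem exists_norm_le (hn : 3 ≤ n) (hr₀ : 0 ≤ r₀) {i₀ i₁ : Fin n} (hne : i₁ ≠ i₀) :
    ∃ r₂, ∀ r, r₂ ≤ r → ‖φ (EuclideanSpace.single i₀ r)‖ ≤ 2 * Real.pi * (r * Real.sqrt (G r)) := by
  obtain ⟨r₂, hr₂, hfar⟩ := F.exists_far 0
  have hψ : ∀ y, R₁ ≤ ‖y‖ → ContinuousAt (fun y => ‖φ.symm y‖) y := fun y hy =>
    ((F.hasFDerivAt_symm (F.mem_target y hy)).continuousAt).norm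
  obtain ⟨b, hb⟩ := (isCompact_sphere (0 : E n) R₁).bddAbove_image (f := fun y => ‖φ.symm y‖)
    fun y hy => (hψ y (mem_sphere_zero_iff_norm.1 hy).ge).continuousWithinAt
  refine ⟨max r₂ (b + 1), fun r hr => ?_⟩
  by_contra! hcon
  have hr2 : r₂ ≤ r := (le_max_left _ _).trans hr
  have hrb : b < r := by linarith [(le_max_right r₂ (b + 1)).trans hr]
  set p : E n := φ (EuclideanSpace.single i₀ r) with hp
  have hr0 : 0 < r := hr₀.trans_lt (hr₂.trans_le hr2)
  have hpR : R₁ ≤ ‖p‖ := (hfar _ (by simp [abs_of_pos hr0, hr2])).2.1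
  have hp0 : 0 < ‖p‖ := F.R₁_pos.trans_le hpR
  have hclose : ∀ y, R₁ ≤ ‖y‖ → ‖φ.symm y‖ = r → ‖y - p‖ < ‖p‖ := fun y hy hyr => by
    have := F.norm_sub_le hg hr₀ hr₂ (fun x hx => ⟨(hfar x hx).1, (hfar x hx).2.1⟩) hne hr2 hyr
    rw [φ.right_inv (F.mem_target y hy)] at this
    exact this.trans_lt hcon
  -- By the intermediate value theorem, a connected set that misses the ball |y - p| < |p| stays
  -- inside S_r once it has a point there.
  have hlt : ∀ A : Set (E n), IsPreconnected A → (∀ y ∈ A, R₁ ≤ ‖y‖ ∧ ‖p‖ ≤ ‖y - p‖) →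
      (∃ y ∈ A, ‖φ.symm y‖ < r) → ∀ y ∈ A, ‖φ.symm y‖ < r := by
    rintro A hA hAy ⟨y₁, hy₁, h1⟩ y hy
    by_contra! h2
    obtain ⟨y₂, hy₂, h3⟩ := hA.intermediate_value hy₁ hy
      (fun y hy => (hψ y (hAy y hy).1).continuousWithinAt) ⟨h1.le, h2⟩
    exact absurd (hclose y₂ (hAy y₂ hy₂).1 h3) (not_lt.2 (hAy y₂ hy₂).2)
  set u : E n := ‖p‖⁻¹ • p with hu
  have hu1 : ‖u‖ = 1 := by rw [hu, norm_smul, norm_inv, norm_norm, inv_mul_cancel₀ hp0.ne']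
  have hpu : p = ‖p‖ • u := by rw [hu, smul_smul, mul_inv_cancel₀ hp0.ne', one_smul]
  have hnorm : ∀ t : ℝ, R₁ ≤ t → ‖(-t) • u‖ = t := fun t ht => by
    rw [norm_smul, hu1, mul_one, norm_neg, Real.norm_eq_abs, abs_of_pos (F.R₁_pos.trans_le ht)]
  -- The ray opposite to p misses the ball and starts on |y| = R₁, which lies inside S_r because r >
  -- b.
  have hray := hlt ((fun t : ℝ => (-t) • u) '' Ici R₁)
    (isPreconnected_Ici.image _ (by fun_prop)) (by
      rintro _ ⟨t, ht, rfl⟩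
      have ht0 : 0 < t := F.R₁_pos.trans_le ht
      refine ⟨(show R₁ ≤ t from ht).trans (hnorm t ht).ge, ?_⟩
      have : (-t) • u - p = (-(t + ‖p‖)) • u := by
        conv_lhs => rw [hpu]
        rw [← sub_smul]; ring_nf
      simp only [this]
      rw [norm_smul, hu1, mul_one, norm_neg, Real.norm_eq_abs, abs_of_pos (by positivity)]
      linarith) ⟨(-R₁) • u, ⟨R₁, self_mem_Ici, rfl⟩, (hb ⟨(-R₁) • u, by
        rw [mem_sphere_zero_iff_norm]; exact hnorm R₁ le_rfl, rfl⟩).trans_lt hrb⟩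
  -- The connected region |y| > 2|p| also misses the ball and meets that ray, so it would lie inside
  -- S_r, contradicting properness.
  have hfarlt := hlt {y | 2 * ‖p‖ < ‖y‖} (isPreconnected_lt_norm hn (by positivity)) (fun y hy => by
      have hy : 2 * ‖p‖ < ‖y‖ := hy
      exact ⟨by linarith, by linarith [norm_sub_norm_le y p]⟩)
    ⟨(-(3 * ‖p‖)) • u, by
      rw [mem_ofPred_eq, hnorm _ (by linarith)]; linarith, hray _ ⟨3 * ‖p‖, by
        rw [mem_Ici]; linarith, rfl⟩⟩
  obtain ⟨r₃, -, hr₃⟩ := F.exists_far (2 * ‖p‖)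
  have hx : ‖(EuclideanSpace.single i₀ (max r r₃) : E n)‖ = max r r₃ := by
    simp [abs_of_pos (hr0.trans_le (le_max_left r r₃))]
  obtain ⟨h1, h2, h3⟩ := hr₃ (EuclideanSpace.single i₀ (max r r₃)) (by rw [hx]; exact le_max_right _ _)
  have := hfarlt _ h3
  rw [φ.left_inv h1, hx] at this
  linarith [le_max_left r r₃]

end

end IsFlatEnd

end Jang

namespace Jang

variable {n : ℕ}

/-! ### The end of spherically symmetric asymptotically flat data -/

theorem exists_hasDerivAt_of_continuousOn {r₀ : ℝ} {φ : ℝ → ℝ} (hφ : ContinuousOn φ (Ioi r₀)) :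
    ∃ s : ℝ → ℝ, ∀ r, r₀ < r → HasDerivAt s (φ r) r := by
  refine ⟨fun r => ∫ t in (r₀ + 1)..r, φ t, fun r hr => ?_⟩
  have hsub : uIcc (r₀ + 1) r ⊆ Ioi r₀ :=
    ordConnected_Ioi.uIcc_subset (by simp) hr
  exact intervalIntegral.integral_hasDerivAt_right ((hφ.mono hsub).intervalIntegrable)
    (hφ.stronglyMeasurableAtFilter isOpen_Ioi r hr) (hφ.continuousAt (Ioi_mem_nhds hr))

/-- The normal derivative `dρ/ds` of the area radius. -/
noncomputable def areaSlope (D G : ℝ → ℝ) (r : ℝ) : ℝ :=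
  r * Real.sqrt (G r) * (halfLogDeriv G r + 1 / r) / Real.sqrt (D r)

namespace IsRadialMetric

variable {g : Tensor2 n} {D G : ℝ → ℝ} {U : Set ℝ} (h : IsRadialMetric g D G U)
include h

theorem hasDerivAt_area {r : ℝ} (hr : r ∈ U) :
    HasDerivAt (fun r => r * Real.sqrt (G r)) (Real.sqrt (D r) * areaSlope D G r) r := by
  have hr0 := h.pos r hr
  have hG := h.G_pos r hr
  have hD := Real.sqrt_pos.2 (h.D_pos r hr)
  refine ((hasDerivAt_id r).mul ((h.hasDerivAt_G hr).sqrt hG.ne')).congr_deriv ?_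
  have h2 := Real.sqrt_pos.2 hG
  have h3 := Real.sq_sqrt hG.le
  unfold areaSlope halfLogDeriv
  set S := Real.sqrt (G r)
  rw [← h3]
  simp only [id]
  field_simp
  ring

/-- This is R = (n-1)((n-2)(1 - q²)/ρ² - 2 (dq/ds)/ρ) solved for dq/ds. -/
theorem hasDerivAt_areaSlope (hn : 3 ≤ n) {x : E n} (hx : ‖x‖ ∈ U) :
    HasDerivAt (areaSlope D G) (Real.sqrt (D ‖x‖) * (((n : ℝ) - 2) / 2
      * (1 - areaSlope D G ‖x‖ ^ 2) / (‖x‖ * Real.sqrt (G ‖x‖))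
      - scalarCurv g x * (‖x‖ * Real.sqrt (G ‖x‖)) / (2 * ((n : ℝ) - 1)))) ‖x‖ := by
  have hr0 := h.pos _ hx
  have hG := h.G_pos _ hx
  have hD := h.D_pos _ hx
  have hDs := Real.sqrt_pos.2 hD
  have hGs := Real.sqrt_pos.2 hG
  have h1 := (h.hasDerivAt_of_contDiffOn h.contDiffOn_a hx).add
    (h.hasDerivAt_of_contDiffOn h.contDiffOn_inv_r hx)
  have e : deriv (fun r : ℝ => 1 / r) ‖x‖ = -(1 / ‖x‖ ^ 2) := by simp
  rw [e] at h1
  refine (((h.hasDerivAt_area hx).mul h1).div ((h.hasDerivAt_D hx).sqrt hD.ne')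
    hDs.ne').congr_deriv ?_
  have hn1 : (n : ℝ) - 1 ≠ 0 := by
    have : (3 : ℝ) ≤ n := by exact_mod_cast hn
    linarith
  have hβ : deriv D ‖x‖ = halfLogDeriv D ‖x‖ * (2 * D ‖x‖) := by
    unfold halfLogDeriv; field_simp
  rw [h.scalarCurv_eq_area hx, hβ]
  unfold areaSlope
  simp only [Pi.mul_apply, Pi.add_apply]
  have h2 := Real.sq_sqrt hG.le
  have h3 := Real.sq_sqrt hD.le
  generalize halfLogDeriv G ‖x‖ = a
  generalize halfLogDeriv D ‖x‖ = β
  generalize deriv (halfLogDeriv G) ‖x‖ = a'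
  set S := Real.sqrt (G ‖x‖)
  set T := Real.sqrt (D ‖x‖)
  rw [← h2, ← h3]
  field_simp
  ring

end IsRadialMetric

/-- Spherically symmetric asymptotically flat data in terms of the arclength. -/
theorem exists_radialEnd (hn : 3 ≤ n) {r₀ : ℝ} (hr₀ : 0 ≤ r₀) {g k : Tensor2 n}
    {D G kn kt : ℝ → ℝ} (h : IsProfile n r₀ g k D G kn kt) (hflat : AsymptoticallyFlat n r₀ g k) :
    ∃ (s R : ℝ → ℝ) (r₁ c C : ℝ), r₀ < r₁ ∧
      RadialEnd n (fun r => Real.sqrt (D r)) s (fun r => r * Real.sqrt (G r)) (areaSlope D G)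
        kn kt R r₁ c C := by
  obtain ⟨φ, R₁, C, F⟩ := exists_isFlatEnd hn hflat
  have hg := h.isRadialMetric hr₀
  obtain ⟨s, hs⟩ := exists_hasDerivAt_of_continuousOn (r₀ := r₀) (φ := fun r => Real.sqrt (D r))
    (hg.D_smooth.continuousOn.sqrt)
  set i₀ : Fin n := ⟨0, by omega⟩ with hi₀
  set i₁ : Fin n := ⟨1, by omega⟩ with hi₁
  have hne : i₁ ≠ i₀ := by simp [hi₀, hi₁]
  set e : ℝ → E n := fun r => EuclideanSpace.single i₀ r with he
  obtain ⟨b, hb⟩ := F.exists_arclength_le hg hs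
  have htop := F.tendsto_arclength hg hs hr₀ i₀
  obtain ⟨r₂, hr₂⟩ := F.exists_norm_le hg hn hr₀ hne
  obtain ⟨r₃, hr₃, hfar⟩ := F.exists_far 0
  obtain ⟨r₄, hr₄⟩ := eventually_atTop.1 (htop.eventually_ge_atTop (max 1 (2 * b)))
  set r₁ := max (max r₂ r₃) r₄ with hr₁
  have hr02 : ∀ r, r₁ ≤ r → r₂ ≤ r := fun r hr =>
    ((le_max_left _ _).trans (le_max_left _ _)).trans hr
  have hr03 : ∀ r, r₁ ≤ r → r₃ ≤ r := fun r hr =>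
    ((le_max_right _ _).trans (le_max_left _ _)).trans hr
  have hr0 : ∀ r, r₁ ≤ r → r₀ < r := fun r hr => hr₃.trans_le (hr03 r hr)
  have hpos : ∀ r, r₁ ≤ r → 0 < r := fun r hr => hr₀.trans_lt (hr0 r hr)
  have hen : ∀ r, r₁ ≤ r → ‖e r‖ = r := fun r hr => by simp [he, abs_of_pos (hpos r hr)]
  have hs1 : ∀ r, r₁ ≤ r → 1 ≤ s r ∧ 2 * b ≤ s r := fun r hr =>
    max_le_iff.1 (hr₄ r ((le_max_right _ _).trans hr))
  have hfar' : ∀ r, r₁ ≤ r → e r ∈ φ.source ∧ R₁ ≤ ‖φ (e r)‖ := fun r hr => by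
    obtain ⟨h1, h2, -⟩ := hfar (e r) (by rw [hen r hr]; exact hr03 r hr)
    exact ⟨h1, h2⟩
  -- From s ≤ b + 2|y| and 2b ≤ s, the latter by the choice of r₄.
  have hsφ : ∀ r, r₁ ≤ r → s r / 4 ≤ ‖φ (e r)‖ := fun r hr => by
    have h1 := hb _ (hfar' r hr).2
    rw [φ.left_inv (hfar' r hr).1, hen r hr] at h1
    linarith [(hs1 r hr).2]
  have hpow : ∀ r, r₁ ≤ r → ∀ j, j ≤ n + 1 → ∀ m : ℝ, 0 ≤ m → m ≤ 4 →
      |C| / ‖φ (e r)‖ ^ j * m ≤ (4 ^ (n + 2) * |C| + 1) / s r ^ j := fun r hr j hj m hm hm4 => by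
    have hsp : 0 < s r := one_pos.trans_le (hs1 r hr).1
    have h1 : (s r / 4) ^ j ≤ ‖φ (e r)‖ ^ j := pow_le_pow_left₀ (by positivity) (hsφ r hr) j
    calc |C| / ‖φ (e r)‖ ^ j * m ≤ |C| / (s r / 4) ^ j * 4 :=
          mul_le_mul (div_le_div_of_nonneg_left (abs_nonneg C) (by positivity) h1) hm4 hm
            (by positivity)
      _ = 4 ^ (j + 1) * |C| / s r ^ j := by rw [div_pow]; field_simp; ring
      _ ≤ (4 ^ (n + 2) * |C| + 1) / s r ^ j := by
          refine div_le_div_of_nonneg_right ?_ (by positivity)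
          have : (4 : ℝ) ^ (j + 1) ≤ 4 ^ (n + 2) := pow_le_pow_right₀ (by norm_num) (by omega)
          nlinarith [abs_nonneg C]
  have hmem : ∀ r, r₁ ≤ r → ‖e r‖ ∈ Ioi r₀ := fun r hr => by rw [hen r hr]; exact hr0 r hr
  have hnu : ∀ r, r₁ ≤ r → ∀ j, nu (e r) j = if j = i₀ then 1 else 0 := fun r hr j => by
    simp only [he, nu_single, abs_of_pos (hpos r hr), div_self (hpos r hr).ne']
  have hquad : ∀ r, r₁ ≤ r → ∀ i, quad (g (e r)) (EuclideanSpace.single i 1) =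
      D r * (if i = i₀ then 1 else 0) + G r * (1 - if i = i₀ then 1 else 0) ∧
      quad (k (e r)) (EuclideanSpace.single i 1) =
      D r * kn r * (if i = i₀ then 1 else 0) + G r * kt r * (1 - if i = i₀ then 1 else 0) := by
    intro r hr i
    rw [quad_radial (hg.eq _ (hmem r hr)), quad_radial (h.k_eq' hr₀ _ (hmem r hr)), hen r hr]
    have : ∑ j, nu (e r) j * (EuclideanSpace.single i (1 : ℝ) : E n) j = if i = i₀ then 1 else 0 := by
      simp [hnu r hr, PiLp.single_apply]
    rw [this]
    split_ifs <;> simp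
  -- The constant 1/(8π) comes from s/4 ≤ |y| ≤ 2πρ.
  refine ⟨s, fun r => scalarCurv g (e r), r₁, 1 / (8 * Real.pi), 4 ^ (n + 2) * |C| + 1,
    hr0 r₁ le_rfl, ⟨hn, fun r hr => Real.sqrt_pos.2 (hg.D_pos r (hr0 r hr)),
    fun r hr => hs r (hr0 r hr), fun r hr => (hs1 r hr).1, htop,
    fun r hr => hg.hasDerivAt_area (hr0 r hr), fun r hr => ?_, by positivity, by positivity,
    fun r hr => ?_, fun r hr => ?_, fun r hr => ?_, fun r hr => ?_, fun r hr => ?_⟩⟩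
  · have := hg.hasDerivAt_areaSlope hn (hmem r hr)
    rwa [hen r hr] at this
  · have h1 := hsφ r hr
    have h2 := hr₂ r (hr02 r hr)
    rw [div_mul_eq_mul_div, one_mul, div_le_iff₀ (by positivity)]
    have h3 : ‖φ (e r)‖ ≤ 2 * Real.pi * (r * Real.sqrt (G r)) := h2
    nlinarith
  · have hD := hg.D_pos r (hr0 r hr)
    obtain ⟨h1, h2⟩ := hquad r hr i₀
    have h3 := F.abs_quad_k_le (hfar' r hr).1 (hfar' r hr).2 (EuclideanSpace.single i₀ 1)
    rw [h1, h2] at h3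
    simp only [if_true, mul_one, sub_self, mul_zero, add_zero, abs_mul, abs_of_pos hD] at h3
    refine le_trans ?_ (hpow r hr (n - 1) (by omega) 4 (by norm_num) le_rfl)
    refine le_of_mul_le_mul_left (h3.trans_eq ?_) hD
    ring
  · have hG := hg.G_pos r (hr0 r hr)
    obtain ⟨h1, h2⟩ := hquad r hr i₁
    have h3 := F.abs_quad_k_le (hfar' r hr).1 (hfar' r hr).2 (EuclideanSpace.single i₁ 1)
    rw [h1, h2] at h3
    simp only [if_neg hne, mul_one, sub_zero, mul_zero, zero_add, abs_mul, abs_of_pos hG] at h3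
    refine le_trans ?_ (hpow r hr (n - 1) (by omega) 4 (by norm_num) le_rfl)
    refine le_of_mul_le_mul_left (h3.trans_eq ?_) hG
    ring
  · have h1 := F.trace_le _ (hfar' r hr).2
    rw [φ.left_inv (hfar' r hr).1, h.trace_eq hr₀ (hmem r hr), hen r hr] at h1
    refine h1.trans (le_trans ?_ (hpow r hr n (by omega) 1 zero_le_one (by norm_num)))
    rw [mul_one]
    exact div_le_div_of_nonneg_right (le_abs_self C) (by positivity)
  · have h1 := F.scalarCurv_le _ (hfar' r hr).2
    rw [φ.left_inv (hfar' r hr).1] at h1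
    refine h1.trans (le_trans ?_ (hpow r hr (n + 1) le_rfl 1 zero_le_one (by norm_num)))
    rw [mul_one]
    exact div_le_div_of_nonneg_right (le_abs_self C) (by positivity)

end Jang

namespace Jang

variable {n : ℕ}

/-! ### The sign of the null expansions -/

/-- The null expansions `H + σ Tr_{S_r} k`, divided by `n - 1`. -/
noncomputable def expansion (r₀ : ℝ) (D G kt : ℝ → ℝ) (σ r : ℝ) : ℝ :=
  areaLogDeriv r₀ G r / Real.sqrt (D r) + σ * kt r

/-- Spherically symmetric asymptotically flat data without horizons in the interior. -/
structure IsHorizonFree (n : ℕ) (r₀ : ℝ) (g k : Tensor2 n) (D G kn kt : ℝ → ℝ) : Prop where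
  hn : 3 ≤ n
  hr₀ : 0 ≤ r₀
  profile : IsProfile n r₀ g k D G kn kt
  exists_end : ∃ (s R : ℝ → ℝ) (r₁ c C : ℝ), r₀ < r₁ ∧
      RadialEnd n (fun r => Real.sqrt (D r)) s (fun r => r * Real.sqrt (G r)) (areaSlope D G)
        kn kt R r₁ c C
  expansion_pos : ∀ r, r₀ < r → 0 < expansion r₀ D G kt 1 r ∧ 0 < expansion r₀ D G kt (-1) r

theorem IsProfile.contDiffOn_areaLogDeriv {r₀ : ℝ} (hr₀ : 0 ≤ r₀) {g k : Tensor2 n}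
    {D G kn kt : ℝ → ℝ} (h : IsProfile n r₀ g k D G kn kt) :
    ContDiffOn ℝ ∞ (areaLogDeriv r₀ G) (Ici r₀ ∩ Ioi 0) := by
  have hG := h.G_smooth.mono (Ici_subset_profileLine hr₀)
  have h1 : ContDiffOn ℝ ∞ (derivWithin G (Ici r₀)) (Ici r₀) :=
    hG.derivWithin (uniqueDiffOn_Ici r₀) (by simp)
  refine ContDiffOn.add (((h1.div (contDiffOn_const.mul hG) fun r hr => ?_)).mono inter_subset_left)
    (contDiffOn_const.div contDiffOn_id fun r hr => (mem_Ioi.1 hr.2).ne')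
  have := h.G_pos r (Ici_subset_profileLine hr₀ hr)
  positivity

/-- The sign is constant by connectedness. A negative expansion would give q/ρ ≤ |kₜ| on the whole
end, which `not_forall_le` excludes. -/
theorem expansion_pos (hr₀ : 0 ≤ r₀) {g k : Tensor2 n} {D G kn kt : ℝ → ℝ}
    (h : IsProfile n r₀ g k D G kn kt) {s R : ℝ → ℝ} {r₁ c C : ℝ} (hr₁ : r₀ < r₁)
    (hend : RadialEnd n (fun r => Real.sqrt (D r)) s (fun r => r * Real.sqrt (G r)) (areaSlope D G)
      kn kt R r₁ c C) {σ : ℝ} (hσ : |σ| = 1) (hne : ∀ r, r₀ < r → expansion r₀ D G kt σ r ≠ 0)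
    {r : ℝ} (hr : r₀ < r) : 0 < expansion r₀ D G kt σ r := by
  have hg := h.isRadialMetric hr₀
  have hcont : ContinuousOn (expansion r₀ D G kt σ) (Ioi r₀) := by
    refine ContinuousOn.add (ContinuousOn.div
      ((h.contDiffOn_areaLogDeriv hr₀).continuousOn.mono fun r hr => ⟨mem_Ici.2 (le_of_lt hr), hr₀.trans_lt hr⟩)
      hg.D_smooth.continuousOn.sqrt fun r hr => (Real.sqrt_pos.2 (hg.D_pos r hr)).ne')
      (continuousOn_const.mul (h.kt_smooth.continuousOn.mono
        (Ioi_subset_Ici_self.trans (Ici_subset_profileLine hr₀))))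
  by_contra! hle
  have hneg : ∀ r', r₀ < r' → expansion r₀ D G kt σ r' < 0 := by
    intro r' hr'
    by_contra! hge
    obtain ⟨z, hz, h0⟩ := isPreconnected_Ioi.intermediate_value hr hr' hcont ⟨hle, hge⟩
    exact hne z hz h0
  refine hend.not_forall_le fun r' hr' => ?_
  have hr0' := hr₁.trans_le hr'
  have hlt := hneg r' hr0'
  have hρ := hend.ρ_pos hr'
  have e : areaSlope D G r' / (r' * Real.sqrt (G r')) = areaLogDeriv r₀ G r' / Real.sqrt (D r') := by
    rw [areaLogDeriv_eq G hr0']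
    unfold areaSlope
    rw [div_div, mul_comm (Real.sqrt (D r')), mul_div_mul_left _ _ hρ.ne']
  simp only [e]
  unfold expansion at hlt
  have : |σ * kt r'| = |kt r'| := by rw [abs_mul, hσ, one_mul]
  rw [← this]
  linarith [neg_abs_le (σ * kt r')]

/-! ### Primitives of radial functions -/

theorem exists_primitive {r₀ : ℝ} {φ : ℝ → ℝ} (hφ : ContDiffOn ℝ ∞ φ (radii r₀))
    (ho : r₀ = 0 → Function.Odd φ) : ∃ F : ℝ → ℝ, ContDiffOn ℝ ∞ F (radii r₀) ∧
      (r₀ = 0 → Function.Even F) ∧ ∀ r ∈ radii r₀, HasDerivAt F (φ r) r := by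
  have hd : ∃ F : ℝ → ℝ, ∀ r ∈ radii r₀, HasDerivAt F (φ r) r := by
    by_cases h0 : r₀ = 0
    · have hc : Continuous φ := by
        have := hφ.continuousOn
        rwa [show radii r₀ = univ by simp [radii, h0], continuousOn_univ] at this
      exact ⟨fun r => ∫ t in (0:ℝ)..r, φ t, fun r _ =>
        intervalIntegral.integral_hasDerivAt_right (hc.intervalIntegrable _ _)
          (hc.stronglyMeasurableAtFilter _ _) hc.continuousAt⟩
    · have e : radii r₀ = Ioi r₀ := by ext r; simp [radii, h0]
      rw [e] at hφ ⊢
      exact exists_hasDerivAt_of_continuousOn hφ.continuousOn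
  obtain ⟨F, hF⟩ := hd
  refine ⟨F, ?_, fun h0 r => ?_, hF⟩
  · rw [contDiffOn_infty_iff_deriv_of_isOpen (isOpen_radii r₀)]
    exact ⟨fun r hr => (hF r hr).differentiableAt.differentiableWithinAt,
      hφ.congr fun r hr => (hF r hr).deriv⟩
  · have hall : ∀ r, HasDerivAt F (φ r) r := fun r => hF r (Or.inl h0)
    have h1 : ∀ r, HasDerivAt (fun r => F (-r) - F r) 0 r := fun r => by
      refine (((hall (-r)).comp r (hasDerivAt_neg r)).sub (hall r)).congr_deriv ?_
      rw [ho h0 r]; ring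
    have h2 := is_const_of_deriv_eq_zero (fun r => (h1 r).differentiableAt)
      (fun r => (h1 r).deriv) r 0
    simp only [neg_zero, sub_self] at h2
    linarith

/-! ### Blow-up at the horizon -/

/-- Comparison with -c log(r - a). -/
theorem tendsto_atTop_of_deriv_le {F F' : ℝ → ℝ} {a b c : ℝ} (hab : a < b) (hc : 0 < c)
    (hF : ∀ r ∈ Ioc a b, HasDerivAt F (F' r) r) (hle : ∀ r ∈ Ioc a b, F' r ≤ -(c / (r - a))) :
    Tendsto F (𝓝[>] a) atTop := by
  have hd : ∀ r ∈ Ioc a b, HasDerivAt (fun r => F r + c * Real.log (r - a))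
      (F' r + c * (1 / (r - a))) r := fun r hr =>
    (hF r hr).add ((((hasDerivAt_id r).sub_const a).log (sub_pos.2 hr.1).ne').const_mul c)
  have hanti : AntitoneOn (fun r => F r + c * Real.log (r - a)) (Ioc a b) := by
    refine antitoneOn_of_deriv_nonpos (convex_Ioc a b)
      (fun r hr => (hd r hr).continuousAt.continuousWithinAt) ?_ ?_ <;> rw [interior_Ioc]
    · exact fun r hr => (hd r ⟨hr.1, hr.2.le⟩).differentiableAt.differentiableWithinAt
    · intro r hr
      rw [(hd r ⟨hr.1, hr.2.le⟩).deriv]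
      have := hle r ⟨hr.1, hr.2.le⟩
      rw [mul_one_div]; linarith
  have hlog : Tendsto (fun r => Real.log (r - a)) (𝓝[>] a) atBot := by
    refine Real.tendsto_log_nhdsGT_zero.comp (tendsto_nhdsWithin_iff.2 ⟨?_, ?_⟩)
    · have : Tendsto (fun r => r - a) (𝓝 a) (𝓝 (a - a)) := (continuous_id.sub continuous_const).tendsto a
      rw [sub_self] at this
      exact this.mono_left nhdsWithin_le_nhds
    · filter_upwards [self_mem_nhdsWithin] with r hr using sub_pos.2 (mem_Ioi.1 hr)
  have h1 : Tendsto (fun r => (F b + c * Real.log (b - a)) + -(c * Real.log (r - a))) (𝓝[>] a) atTop :=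
    tendsto_atTop_add_const_left _ _ (tendsto_neg_atBot_atTop.comp (hlog.const_mul_atBot hc))
  refine tendsto_atTop_mono' _ ?_ h1
  filter_upwards [Ioc_mem_nhdsGT hab] with r hr
  have := hanti hr (right_mem_Ioc.2 hab) hr.2
  simp only at this
  linarith

/-- At v = -1 the right side is q₀ - q₁ + q₂, which vanishes at a and so is O(r - a). Hence w = v +
1 satisfies w' ≤ L(r - a) + K w with w(a) = 0, so w = O((r - a)²). Thus √(1 - v²) = O(r - a) and F'
≤ -c/(r - a). -/
theorem tendsto_atTop_of_riccati {a : ℝ} {v q₀ q₁ q₂ α F : ℝ → ℝ} (hv : ContinuousOn v (Ici a))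
    (hva : v a = -1) (hv1 : ∀ r, a < r → -1 < v r ∧ v r < 1)
    (hd : ∀ r, a < r → HasDerivAt v (q₀ r + q₁ r * v r + q₂ r * v r ^ 2) r)
    (h₀ : DifferentiableWithinAt ℝ q₀ (Ici a) a) (h₁ : DifferentiableWithinAt ℝ q₁ (Ici a) a)
    (h₂ : DifferentiableWithinAt ℝ q₂ (Ici a) a) (hq : q₀ a - q₁ a + q₂ a = 0)
    (hα : ContinuousWithinAt α (Ici a) a) (hαa : 0 < α a)
    (hF : ∀ r, a < r → HasDerivAt F (α r * (v r / Real.sqrt (1 - v r ^ 2))) r) :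
    Tendsto F (𝓝[>] a) atTop := by
  have hA : ∃ L, 0 < L ∧ ∀ᶠ r in 𝓝[≥] a, |q₀ r - q₁ r + q₂ r| ≤ L * (r - a) := by
    have h1 := ((h₀.sub h₁).add h₂).hasDerivWithinAt.isBigO_sub
    obtain ⟨L, hL, h2⟩ := h1.exists_pos
    refine ⟨L, hL, ?_⟩
    rw [prod_pure, Asymptotics.isBigOWith_map] at h2
    filter_upwards [h2.bound, self_mem_nhdsWithin] with r h3 hr
    have hr : a ≤ r := hr
    simp only [Function.comp, Pi.add_apply, Pi.sub_apply, hq, sub_zero, Real.norm_eq_abs] at h3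
    rwa [abs_of_nonneg (sub_nonneg.2 hr)] at h3
  obtain ⟨L, hL, hA⟩ := hA
  have hK : ∀ q : ℝ → ℝ, ContinuousWithinAt q (Ici a) a → ∀ᶠ r in 𝓝[≥] a, |q r| ≤ |q a| + 1 :=
    fun q hq => by
      filter_upwards [hq.abs.eventually (gt_mem_nhds (lt_add_one |q a|))] with r hr using le_of_lt hr
  have hv2 : ∀ᶠ r in 𝓝[≥] a, v r < -(1 / 2) :=
    (hv a self_mem_Ici).eventually (gt_mem_nhds (by rw [hva]; norm_num))
  have hα2 : ∀ᶠ r in 𝓝[≥] a, α a / 2 < α r := hα.eventually (lt_mem_nhds (by linarith))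
  have hall := ((hA.and (hK q₁ h₁.continuousWithinAt)).and
    ((hK q₂ h₂.continuousWithinAt).and (hv2.and hα2)))
  obtain ⟨b, hab, hb⟩ := mem_nhdsGE_iff_exists_Icc_subset.1 hall
  -- The cap r - a ≤ 1 bounds e^{K(r - a)} by the constant e^K.
  set b' := min b (a + 1)
  have hab' : a < b' := lt_min hab (lt_add_one a)
  have hmem : ∀ r ∈ Icc a b', r ∈ Icc a b := fun r hr => ⟨hr.1, hr.2.trans (min_le_left _ _)⟩
  set K := (|q₁ a| + 1) + 3 * (|q₂ a| + 1) with hKdef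
  have hK0 : 0 < K := by positivity
  have hw : ∀ r ∈ Icc a b', (v r + 1) * Real.exp (-(K * (r - a))) ≤ L * (r - a) ^ 2 := by
    have hcont : ContinuousOn (fun r => (v r + 1) * Real.exp (-(K * (r - a))) - L * (r - a) ^ 2)
        (Icc a b') := by
      have := hv.mono (Icc_subset_Ici_self : Icc a b' ⊆ Ici a)
      fun_prop
    have hder : ∀ r ∈ Ioo a b', HasDerivAt
        (fun r => (v r + 1) * Real.exp (-(K * (r - a))) - L * (r - a) ^ 2)
        ((q₀ r + q₁ r * v r + q₂ r * v r ^ 2 - K * (v r + 1)) * Real.exp (-(K * (r - a)))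
          - 2 * L * (r - a)) r := fun r hr => by
      have e1 : HasDerivAt (fun r => -(K * (r - a))) (-(K * 1)) r :=
        (((hasDerivAt_id r).sub_const a).const_mul K).neg
      have e2 := (((hd r hr.1).add_const 1).mul e1.exp).sub
        ((((hasDerivAt_id r).sub_const a).pow 2).const_mul L)
      refine e2.congr_deriv ?_
      simp only [id]
      push_cast
      ring
    have hanti : AntitoneOn (fun r => (v r + 1) * Real.exp (-(K * (r - a))) - L * (r - a) ^ 2)
        (Icc a b') := by
      refine antitoneOn_of_deriv_nonpos (convex_Icc a b') hcont ?_ ?_ <;> rw [interior_Icc]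
      · exact fun r hr => (hder r hr).differentiableAt.differentiableWithinAt
      · intro r hr
        rw [(hder r hr).deriv]
        obtain ⟨⟨h1, h2⟩, h3, h4, -⟩ := hb (hmem r ⟨hr.1.le, hr.2.le⟩)
        obtain ⟨h5, h6⟩ := hv1 r hr.1
        have h7 : q₀ r + q₁ r * v r + q₂ r * v r ^ 2 - K * (v r + 1) ≤ L * (r - a) := by
          have e : q₀ r + q₁ r * v r + q₂ r * v r ^ 2 = (q₀ r - q₁ r + q₂ r)
            + (q₁ r + q₂ r * (v r - 1)) * (v r + 1) := by ring
          have h8 : q₁ r + q₂ r * (v r - 1) ≤ K := by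
            have : |q₂ r * (v r - 1)| ≤ (|q₂ a| + 1) * 2 := by
              rw [abs_mul]
              exact mul_le_mul h3 (by rw [abs_le]; constructor <;> linarith) (abs_nonneg _)
                (by positivity)
            linarith [le_abs_self (q₁ r), le_abs_self (q₂ r * (v r - 1)), abs_nonneg (q₂ a)]
          rw [e]
          nlinarith [le_abs_self (q₀ r - q₁ r + q₂ r)]
        have h8 : Real.exp (-(K * (r - a))) ≤ 1 := by
          rw [Real.exp_le_one_iff]
          have := mul_nonneg hK0.le (sub_nonneg.2 hr.1.le)
          linarith
        have h9 := Real.exp_pos (-(K * (r - a)))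
        have h10 : 0 ≤ L * (r - a) := mul_nonneg hL.le (sub_nonneg.2 hr.1.le)
        nlinarith [mul_le_mul_of_nonneg_right h7 h9.le, mul_le_mul_of_nonneg_left h8 h10]
    intro r hr
    have := hanti (left_mem_Icc.2 hab'.le) hr hr.1
    simp only [hva] at this
    linarith [this, (by simp : ((-1 : ℝ) + 1) * Real.exp (-(K * (a - a))) - L * (a - a) ^ 2 = 0)]
  set B := Real.sqrt (2 * (L * Real.exp K)) with hB
  have hB0 : 0 < B := Real.sqrt_pos.2 (by positivity)
  refine tendsto_atTop_of_deriv_le (c := α a / 4 / B) hab' (by positivity)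
    (fun r hr => hF r hr.1) fun r hr => ?_
  have hrI : r ∈ Icc a b' := ⟨hr.1.le, hr.2⟩
  obtain ⟨-, -, h4, h5⟩ := hb (hmem r hrI)
  obtain ⟨h6, h7⟩ := hv1 r hr.1
  have hra : 0 < r - a := sub_pos.2 hr.1
  have hw1 : v r + 1 ≤ L * Real.exp K * (r - a) ^ 2 := by
    have h8 := hw r hrI
    have h9 : Real.exp (-K) ≤ Real.exp (-(K * (r - a))) := by
      refine Real.exp_le_exp.2 (neg_le_neg ?_)
      have : r ≤ a + 1 := hr.2.trans (min_le_right _ _)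
      nlinarith
    have h10 : (v r + 1) * Real.exp (-K) ≤ L * (r - a) ^ 2 :=
      (mul_le_mul_of_nonneg_left h9 (by linarith)).trans h8
    rw [Real.exp_neg, ← div_eq_mul_inv, div_le_iff₀ (Real.exp_pos K)] at h10
    linarith
  have hsq : Real.sqrt (1 - v r ^ 2) ≤ B * (r - a) := by
    rw [hB, ← Real.sqrt_sq hra.le, ← Real.sqrt_mul (by positivity)]
    refine Real.sqrt_le_sqrt ?_
    nlinarith
  have hsq0 : 0 < Real.sqrt (1 - v r ^ 2) := Real.sqrt_pos.2 (by nlinarith)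
  have hprod : α a / 4 ≤ α r * -v r := by nlinarith
  have e : -(α a / 4 / B / (r - a)) = -(α a / 4 / (B * (r - a))) := by rw [div_div]
  have e2 : α r * (v r / Real.sqrt (1 - v r ^ 2)) = -(α r * -v r / Real.sqrt (1 - v r ^ 2)) := by
    ring
  rw [e, e2]
  exact neg_le_neg (div_le_div₀ (by linarith) hprod hsq0 hsq)

end Jang

namespace Jang

variable {n : ℕ}

/-! ### Solutions of Jang's equation -/

theorem radii_of_pos {r₀ : ℝ} (h : r₀ ≠ 0) : radii r₀ = Ioi r₀ := by ext r; simp [radii, h]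

theorem radii_zero {r₀ : ℝ} (h : r₀ = 0) : radii r₀ = univ := by ext r; simp [radii, h]

theorem bulk_subset_M {r₀ : ℝ} : bulk n r₀ ⊆ M n r₀ := fun x hx => by
  rcases hx with h | h
  · change r₀ ≤ ‖x‖; rw [h]; exact norm_nonneg x
  · exact le_of_lt h

/-- Identities are computed in polar form, for x ≠ 0. When r₀ = 0 they extend to the origin by
continuity, which is what the smoothness of the curvature operators provides. -/
theorem eqOn_bulk (hn : 3 ≤ n) {r₀ : ℝ} {H K : E n → ℝ}
    (hH : ContinuousOn H (bulk n r₀)) (hK : ContinuousOn K (bulk n r₀))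
    (h : ∀ x : E n, ‖x‖ ∈ Ioi r₀ → H x = K x) : EqOn H K (bulk n r₀) := by
  intro x hx
  by_cases hx0 : r₀ < ‖x‖
  · exact h x hx0
  have h0 : r₀ = 0 := hx.resolve_right hx0
  have hx1 : x = 0 := norm_eq_zero.1 (le_antisymm (by rw [← h0]; exact not_lt.1 hx0) (norm_nonneg x))
  have : Nontrivial (E n) := by
    have : Nonempty (Fin n) := ⟨⟨0, by omega⟩⟩
    infer_instance
  have hnhds := (isOpen_bulk n r₀).mem_nhds hx
  refine tendsto_nhds_unique (((hH.continuousAt hnhds).tendsto.mono_left nhdsWithin_le_nhds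
    : Tendsto H (𝓝[≠] x) _)) (((hK.continuousAt hnhds).tendsto.mono_left
    nhdsWithin_le_nhds).congr' ?_)
  filter_upwards [self_mem_nhdsWithin] with y hy
  refine (h y ?_).symm
  rw [mem_Ioi, h0]
  rw [hx1] at hy
  exact norm_pos_iff.2 hy

/-- The slope of a solution of Jang's equation. -/
structure IsJangSlope (n : ℕ) (r₀ : ℝ) (D G kn kt v : ℝ → ℝ) : Prop where
  smooth : ContDiffOn ℝ ∞ v (radii r₀)
  odd : r₀ = 0 → Function.Odd v
  sq_lt : ∀ r ∈ radii r₀, v r ^ 2 < 1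
  ode : ∀ r, r₀ < r → HasDerivAt v (-(((n : ℝ) - 1) * (halfLogDeriv G r + 1 / r)) * v r
    + Real.sqrt (D r) * ((1 - v r ^ 2) * kn r + ((n : ℝ) - 1) * kt r)) r

theorem expansion_mul {r₀ : ℝ} {D G kt : ℝ → ℝ} {r : ℝ} (hD : 0 < D r) (σ : ℝ) :
    Real.sqrt (D r) * expansion r₀ D G kt σ r =
      areaLogDeriv r₀ G r + σ * (Real.sqrt (D r) * kt r) := by
  have := Real.sqrt_pos.2 hD
  unfold expansion
  field_simp

/-- The damping (n-1)ρ'/ρ splits into the singular part (n-1)/r and the smooth odd part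
(n-1)G'/(2G). The two barrier conditions are the positivity of θ₋ and θ₊. -/
theorem IsHorizonFree.exists_slope_of_zero {r₀ : ℝ} {g k : Tensor2 n} {D G kn kt : ℝ → ℝ}
    (h : IsHorizonFree n r₀ g k D G kn kt) (h0 : r₀ = 0) :
    ∃ v, IsJangSlope n r₀ D G kn kt v := by
  have hp := h.profile
  have hline : profileLine r₀ = univ := by simp [profileLine, h0]
  have hn3 : (3 : ℝ) ≤ n := by exact_mod_cast h.hn
  have hcast : ((n - 1 : ℕ) : ℝ) = (n : ℝ) - 1 := by
    rw [Nat.cast_sub (by have := h.hn; omega)]; simp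
  have hDs := hp.D_smooth
  have hGs := hp.G_smooth
  have hns := hp.kn_smooth
  have hts := hp.kt_smooth
  rw [hline, contDiffOn_univ] at hDs hGs hns hts
  have hDp : ∀ r, 0 < D r := fun r => hp.D_pos r (by rw [hline]; trivial)
  have hGp : ∀ r, 0 < G r := fun r => hp.G_pos r (by rw [hline]; trivial)
  have hα : ContDiff ℝ ∞ fun r => Real.sqrt (D r) := hDs.sqrt fun r => (hDp r).ne'
  have ha : ContDiff ℝ ∞ (halfLogDeriv G) := (contDiff_infty_iff_deriv.1 hGs).2.div
    (contDiff_const.mul hGs) fun r => by have := hGp r; positivity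
  have key : ∀ r, 0 < r → ∀ σ, Real.sqrt (D r) * expansion r₀ D G kt σ r =
      halfLogDeriv G r + 1 / r + σ * (Real.sqrt (D r) * kt r) := fun r hr σ => by
    rw [expansion_mul (hDp r), areaLogDeriv_eq G (by rwa [h0])]
  obtain ⟨v, hv, hvo, hvr⟩ := exists_riccati_singular (m := n - 1)
    (q₀ := fun r => Real.sqrt (D r) * (kn r + ((n : ℝ) - 1) * kt r))
    (q₁ := fun r => -(((n : ℝ) - 1) * halfLogDeriv G r))
    (q₂ := fun r => -(Real.sqrt (D r) * kn r))
    (hα.mul (hns.add (contDiff_const.mul hts))) (contDiff_const.mul ha).neg (hα.mul hns).neg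
    (fun r => by simp only [hp.D_even h0 r, hp.kn_even h0 r, hp.kt_even h0 r])
    (fun r => by
      simp only [halfLogDeriv, deriv_neg_of_even (hp.G_even h0), hp.G_even h0 r]; ring)
    (fun r => by simp only [hp.D_even h0 r, hp.kn_even h0 r])
    (fun r hr => by
      have h1 := mul_pos (Real.sqrt_pos.2 (hDp r)) (h.expansion_pos r (by rwa [h0])).2
      rw [key r hr] at h1
      rw [hcast]
      have h2 := mul_pos (by linarith : 0 < (n : ℝ) - 1) h1
      have e : ((n : ℝ) - 1) * (halfLogDeriv G r + 1 / r + -1 * (Real.sqrt (D r) * kt r)) =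
        ((n : ℝ) - 1) * halfLogDeriv G r + ((n : ℝ) - 1) / r
          - ((n : ℝ) - 1) * (Real.sqrt (D r) * kt r) := by ring
      rw [e] at h2
      linarith)
    (fun r hr => by
      have h1 := mul_pos (Real.sqrt_pos.2 (hDp r)) (h.expansion_pos r (by rwa [h0])).1
      rw [key r hr] at h1
      rw [hcast]
      have h2 := mul_pos (by linarith : 0 < (n : ℝ) - 1) h1
      have e : ((n : ℝ) - 1) * (halfLogDeriv G r + 1 / r + 1 * (Real.sqrt (D r) * kt r)) =
        ((n : ℝ) - 1) * halfLogDeriv G r + ((n : ℝ) - 1) / r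
          + ((n : ℝ) - 1) * (Real.sqrt (D r) * kt r) := by ring
      rw [e] at h2
      linarith)
  refine ⟨v, hv.contDiffOn, fun _ => hvo, fun r _ => ?_, fun r hr => ?_⟩
  · rcases lt_trichotomy r 0 with hr | hr | hr
    · have := (hvr (-r) (by linarith)).1
      rw [hvo] at this
      nlinarith
    · have h1 := hvo 0
      rw [neg_zero] at h1
      have : v 0 = 0 := by linarith
      rw [hr, this]; norm_num
    · have := (hvr r hr).1
      nlinarith
  · refine (hvr r (by rwa [h0] at hr)).2.congr_deriv ?_
    rw [hcast]; ring

/-- The initial value v(r₀) = -σ is the barrier at which the horizon condition θ_σ(r₀) = 0 makes the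
right side vanish; this degeneracy produces the blow-up of F. -/
theorem IsHorizonFree.exists_slope_of_pos {r₀ : ℝ} {g k : Tensor2 n} {D G kn kt : ℝ → ℝ}
    (h : IsHorizonFree n r₀ g k D G kn kt) (h0 : 0 < r₀) {σ : ℝ} (hσ : |σ| = 1)
    (hb : expansion r₀ D G kt σ r₀ = 0) :
    ∃ v, IsJangSlope n r₀ D G kn kt v ∧ ∀ F : ℝ → ℝ, (∀ r, r₀ < r → HasDerivAt F
      (Real.sqrt (D r) * (v r / Real.sqrt (1 - v r ^ 2))) r) →
      Tendsto (fun r => σ * F r) (𝓝[>] r₀) atTop := by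
  have hp := h.profile
  have hn3 : (3 : ℝ) ≤ n := by exact_mod_cast h.hn
  have hsub := Ici_subset_profileLine h.hr₀
  have hDp : ∀ r, r₀ ≤ r → 0 < D r := fun r hr => hp.D_pos r (hsub hr)
  have hα : ContDiffOn ℝ ∞ (fun r => Real.sqrt (D r)) (Ici r₀) :=
    (hp.D_smooth.mono hsub).sqrt fun r hr => (hDp r hr).ne'
  have hns := hp.kn_smooth.mono hsub
  have hts := hp.kt_smooth.mono hsub
  have ha : ContDiffOn ℝ ∞ (areaLogDeriv r₀ G) (Ici r₀) :=
    (hp.contDiffOn_areaLogDeriv h.hr₀).mono fun r hr => ⟨hr, h0.trans_le hr⟩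
  set q₀ : ℝ → ℝ := fun r => Real.sqrt (D r) * (kn r + ((n : ℝ) - 1) * kt r)
  set q₁ : ℝ → ℝ := fun r => -(((n : ℝ) - 1) * areaLogDeriv r₀ G r)
  set q₂ : ℝ → ℝ := fun r => -(Real.sqrt (D r) * kn r)
  have hq₀ : ContDiffOn ℝ ∞ q₀ (Ici r₀) := hα.mul (hns.add (contDiffOn_const.mul hts))
  have hq₁ : ContDiffOn ℝ ∞ q₁ (Ici r₀) := (contDiffOn_const.mul ha).neg
  have hq₂ : ContDiffOn ℝ ∞ q₂ (Ici r₀) := (hα.mul hns).neg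
  have key : ∀ r, r₀ ≤ r → ∀ τ, ((n : ℝ) - 1) * (Real.sqrt (D r) * expansion r₀ D G kt τ r) =
      ((n : ℝ) - 1) * areaLogDeriv r₀ G r + τ * (((n : ℝ) - 1) * (Real.sqrt (D r) * kt r)) :=
    fun r hr τ => by rw [expansion_mul (hDp r hr)]; ring
  have hlo' : ∀ r, r₀ ≤ r → q₀ r - q₁ r + q₂ r =
      ((n : ℝ) - 1) * (Real.sqrt (D r) * expansion r₀ D G kt 1 r) := fun r hr => by
    rw [key r hr]; simp only [q₀, q₁, q₂]; ring
  have hup' : ∀ r, r₀ ≤ r → q₀ r + q₁ r + q₂ r =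
      -(((n : ℝ) - 1) * (Real.sqrt (D r) * expansion r₀ D G kt (-1) r)) := fun r hr => by
    rw [key r hr]; simp only [q₀, q₁, q₂]; ring
  have hlo : ∀ r, r₀ < r → 0 < q₀ r - q₁ r + q₂ r := fun r hr => by
    rw [hlo' r hr.le]
    exact mul_pos (by linarith) (mul_pos (Real.sqrt_pos.2 (hDp r hr.le)) (h.expansion_pos r hr).1)
  have hup : ∀ r, r₀ < r → q₀ r + q₁ r + q₂ r < 0 := fun r hr => by
    rw [hup' r hr.le]
    exact neg_neg_of_pos (mul_pos (by linarith)
      (mul_pos (Real.sqrt_pos.2 (hDp r hr.le)) (h.expansion_pos r hr).2))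
  obtain ⟨v, hvc, hva, hvr⟩ := exists_riccati (c := -σ) (by rw [abs_neg, hσ]) hq₀.continuousOn
    hq₁.continuousOn hq₂.continuousOn hup hlo
  have hd : ∀ {q : ℝ → ℝ}, ContDiffOn ℝ ∞ q (Ici r₀) → DifferentiableWithinAt ℝ q (Ici r₀) r₀ :=
    fun hq => (hq r₀ self_mem_Ici).differentiableWithinAt (by simp)
  refine ⟨v, ⟨?_, fun h => absurd h h0.ne', fun r hr => ?_, fun r hr => ?_⟩, fun F hF => ?_⟩
  · rw [radii_of_pos h0.ne']
    exact contDiffOn_of_riccati isOpen_Ioi (hq₀.mono Ioi_subset_Ici_self)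
      (hq₁.mono Ioi_subset_Ici_self) (hq₂.mono Ioi_subset_Ici_self) fun r hr => (hvr r hr).2
  · rw [radii_of_pos h0.ne'] at hr
    have := (hvr r hr).1
    nlinarith
  · refine (hvr r hr).2.congr_deriv ?_
    simp only [q₀, q₁, q₂, areaLogDeriv_eq G hr]
    ring
  · rcases (abs_eq zero_le_one).1 hσ with rfl | rfl
    · simp only [one_mul]
      refine tendsto_atTop_of_riccati hvc hva (fun r hr => (hvr r hr).1) (fun r hr => (hvr r hr).2)
        (hd hq₀) (hd hq₁) (hd hq₂) ?_ (hα.continuousOn r₀ self_mem_Ici)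
        (Real.sqrt_pos.2 (hDp r₀ le_rfl)) hF
      rw [hlo' r₀ le_rfl, hb, mul_zero, mul_zero]
    -- The substitution v ↦ -v changes the signs of q₀ and q₂ and keeps q₁, reducing σ = -1 to σ =
    -- 1.
    · refine tendsto_atTop_of_riccati (v := fun r => -v r) (q₀ := fun r => -q₀ r) (q₁ := q₁)
        (q₂ := fun r => -q₂ r) hvc.neg (by rw [hva, neg_neg]) (fun r hr => ?_) (fun r hr => ?_)
        (hd hq₀).neg (hd hq₁) (hd hq₂).neg ?_ (hα.continuousOn r₀ self_mem_Ici)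
        (Real.sqrt_pos.2 (hDp r₀ le_rfl)) (fun r hr => ?_)
      · have := (hvr r hr).1
        constructor <;> linarith
      · refine (hvr r hr).2.neg.congr_deriv ?_
        ring
      · have := hup' r₀ le_rfl
        rw [hb, mul_zero, mul_zero, neg_zero] at this
        linarith
      · refine ((hF r hr).const_mul (-1)).congr_deriv ?_
        rw [neg_sq]; ring

theorem IsHorizonFree.exists_sq_le {r₀ : ℝ} {g k : Tensor2 n} {D G kn kt v : ℝ → ℝ}
    (h : IsHorizonFree n r₀ g k D G kn kt) (hv : IsJangSlope n r₀ D G kn kt v) :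
    ∃ (s R : ℝ → ℝ) (r₁ c C B : ℝ), r₀ < r₁ ∧
      RadialEnd n (fun r => Real.sqrt (D r)) s (fun r => r * Real.sqrt (G r)) (areaSlope D G)
        kn kt R r₁ c C ∧ 0 < B ∧ (∀ r, r₁ ≤ r → 0 < areaSlope D G r) ∧
        ∀ r, r₁ ≤ r → v r ^ 2 ≤ B / s r ^ 3 := by
  obtain ⟨s, R, r₁, c, C, hr₁, hend⟩ := h.exists_end
  -- The sum of the two normalised expansions is 2q/ρ, so q > 0.
  have hq : ∀ r, r₁ ≤ r → 0 < areaSlope D G r := fun r hr => by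
    have hr0 := hr₁.trans_le hr
    obtain ⟨h1, h2⟩ := h.expansion_pos r hr0
    have hD := hend.α_pos r hr
    have hρ := hend.ρ_pos hr
    unfold expansion at h1 h2
    rw [areaLogDeriv_eq G hr0] at h1 h2
    unfold areaSlope
    rw [mul_div_assoc]
    exact mul_pos hρ (by linarith)
  obtain ⟨B, hB, hvB⟩ := hend.exists_slope_sq_le hq
    (fun r hr => hv.sq_lt r (Or.inr (hr₁.trans_le hr))) fun r hr => by
      refine (hv.ode r (hr₁.trans_le hr)).congr_deriv ?_
      have hD := hend.α_pos r hr
      have hρ := hend.ρ_pos hr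
      have e : Real.sqrt (D r) * areaSlope D G r / (r * Real.sqrt (G r)) =
          halfLogDeriv G r + 1 / r := by
        unfold areaSlope
        rw [mul_div_cancel₀ _ hD.ne', mul_div_cancel_left₀ _ hρ.ne']
      rw [e]
  exact ⟨s, R, r₁, c, C, B, hr₁, hend, hB, hq, hvB⟩

theorem sqrt_div_one_sub {D v : ℝ} (hD : 0 < D) (hv : v ^ 2 < 1) :
    D + (Real.sqrt D * (v / Real.sqrt (1 - v ^ 2))) ^ 2 = D / (1 - v ^ 2) := by
  have h1 : 0 < 1 - v ^ 2 := by linarith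
  rw [mul_pow, div_pow, Real.sq_sqrt hD.le, Real.sq_sqrt h1.le]
  field_simp
  ring

theorem slope_eq_of_deriv {D F : ℝ → ℝ} {v r : ℝ} (hD : 0 < D r) (hv : v ^ 2 < 1)
    (hF : deriv F r = Real.sqrt (D r) * (v / Real.sqrt (1 - v ^ 2))) : slope D F r = v := by
  have h1 : 0 < 1 - v ^ 2 := by linarith
  have h2 := Real.sqrt_pos.2 h1
  have h3 := Real.sqrt_pos.2 hD
  unfold slope
  rw [hF, sqrt_div_one_sub hD hv, Real.sqrt_div hD.le]
  field_simp

theorem IsHorizonFree.exists_radial_solution {r₀ : ℝ} {g k : Tensor2 n} {D G kn kt v : ℝ → ℝ}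
    (h : IsHorizonFree n r₀ g k D G kn kt) (hv : IsJangSlope n r₀ D G kn kt v) :
    ∃ F : ℝ → ℝ, ContDiffOn ℝ ∞ F (radii r₀) ∧ (r₀ = 0 → Function.Even F) ∧
      (∀ r ∈ radii r₀, HasDerivAt F (Real.sqrt (D r) * (v r / Real.sqrt (1 - v r ^ 2))) r) ∧
      Tendsto F atTop (𝓝 0) := by
  have hp := h.profile
  have hDs := hp.D_smooth.mono radii_subset_profileLine
  obtain ⟨F, hF, he, hd⟩ := exists_primitive (r₀ := r₀)
    (φ := fun r => Real.sqrt (D r) * (v r / Real.sqrt (1 - v r ^ 2)))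
    ((hDs.sqrt fun r hr => (hp.D_pos r (radii_subset_profileLine hr)).ne').mul
      (hv.smooth.div ((contDiffOn_const.sub (hv.smooth.pow 2)).sqrt
        fun r hr => (sub_pos.2 (hv.sq_lt r hr)).ne')
        fun r hr => (Real.sqrt_pos.2 (sub_pos.2 (hv.sq_lt r hr))).ne'))
    (fun h0 r => by simp only [hp.D_even h0 r, hv.odd h0 r, neg_sq]; ring)
  obtain ⟨s, R, r₁, c, C, B, hr₁, hend, hB, -, hvB⟩ := h.exists_sq_le hv
  obtain ⟨l, hl⟩ := hend.exists_tendsto_of_slope hB hvB fun r hr =>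
    hd r (Or.inr (hr₁.trans_le hr))
  refine ⟨fun r => F r - l, hF.sub contDiffOn_const, fun h0 r => by simp only [he h0 r],
    fun r hr => (hd r hr).sub_const l, ?_⟩
  simpa using hl.sub_const l

theorem IsHorizonFree.jangOperator_eq_zero {r₀ : ℝ} {g k : Tensor2 n} {D G kn kt v F : ℝ → ℝ}
    (h : IsHorizonFree n r₀ g k D G kn kt) (hv : IsJangSlope n r₀ D G kn kt v)
    (hFs : ContDiffOn ℝ ∞ F (radii r₀))
    (hF : ∀ r ∈ radii r₀, HasDerivAt F (Real.sqrt (D r) * (v r / Real.sqrt (1 - v r ^ 2))) r)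
    {x : E n} (hx : ‖x‖ ∈ Ioi r₀) : jangOperator g k (fun x => F ‖x‖) x = 0 := by
  have hg := h.profile.isRadialMetric h.hr₀
  have hsl : ∀ r, r₀ < r → slope D F r = v r := fun r hr =>
    slope_eq_of_deriv (hg.D_pos r hr) (hv.sq_lt r (Or.inr hr)) (hF r (Or.inr hr)).deriv
  have hder : deriv (slope D F) ‖x‖ = _ := ((hv.ode ‖x‖ hx).congr_of_eventuallyEq (by
    filter_upwards [Ioi_mem_nhds hx] with r hr using hsl r hr)).deriv
  rw [hg.jangOperator_eq (h.profile.k_eq' h.hr₀) (hFs.mono (Ioi_subset_radii r₀)) (fun _ _ => rfl) hx,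
    hder, hsl _ hx]
  have := Real.sqrt_pos.2 (hg.D_pos _ hx)
  have hx0 : ‖x‖ ≠ 0 := (hg.pos _ hx).ne'
  field_simp
  ring

/-- Existence for Jang's equation. -/
theorem IsHorizonFree.exists_jangSolution {r₀ : ℝ} {g k : Tensor2 n} {D G kn kt g₁₁ ρ kₜ : ℝ → ℝ}
    (h : IsHorizonFree n r₀ g k D G kn kt) (hdata : IsInitialData n r₀ g k)
    (hexp : 0 < r₀ → ∀ σ, nullExpansion n r₀ g₁₁ ρ kₜ σ r₀ = 0 ↔ expansion r₀ D G kt σ r₀ = 0)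
    (hb : 0 < r₀ → nullExpansion n r₀ g₁₁ ρ kₜ 1 r₀ = 0 ∨ nullExpansion n r₀ g₁₁ ρ kₜ (-1) r₀ = 0) :
    ∃ f, IsJangSolution n r₀ g k g₁₁ ρ kₜ f := by
  have hslope : ∃ v, IsJangSlope n r₀ D G kn kt v ∧ (0 < r₀ → ∀ F : ℝ → ℝ,
      (∀ r, r₀ < r → HasDerivAt F (Real.sqrt (D r) * (v r / Real.sqrt (1 - v r ^ 2))) r) →
      (nullExpansion n r₀ g₁₁ ρ kₜ 1 r₀ = 0 ∧ Tendsto F (𝓝[>] r₀) atTop) ∨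
      (nullExpansion n r₀ g₁₁ ρ kₜ (-1) r₀ = 0 ∧ Tendsto F (𝓝[>] r₀) atBot)) := by
    rcases h.hr₀.eq_or_lt with h0 | h0
    · obtain ⟨v, hv⟩ := h.exists_slope_of_zero h0.symm
      exact ⟨v, hv, fun h1 => absurd h0 h1.ne⟩
    · rcases hb h0 with h1 | h1
      · obtain ⟨v, hv, hvF⟩ := h.exists_slope_of_pos h0 (σ := 1) (by simp) ((hexp h0 1).1 h1)
        exact ⟨v, hv, fun _ F hF => Or.inl ⟨h1, by simpa using hvF F hF⟩⟩
      · obtain ⟨v, hv, hvF⟩ := h.exists_slope_of_pos h0 (σ := -1) (by simp) ((hexp h0 (-1)).1 h1)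
        exact ⟨v, hv, fun _ F hF => Or.inr ⟨h1, by simpa using tendsto_neg_atTop_iff.1 (by simpa using hvF F hF)⟩⟩
  obtain ⟨v, hv, hvF⟩ := hslope
  obtain ⟨F, hFs, hFe, hFd, hF0⟩ := h.exists_radial_solution hv
  have hsmooth : ContDiffOn ℝ ∞ (fun x : E n => F ‖x‖) (bulk n r₀) :=
    contDiffOn_comp_norm h.hr₀ hFs hFe
  refine ⟨fun x => F ‖x‖, hsmooth, fun x _ y _ hxy => by simp only [hxy], fun x hx => ?_,
    hF0.comp tendsto_norm_cobounded_atTop, fun h0 => ?_⟩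
  · exact eqOn_bulk h.hn (contDiffOn_jangOperator (isOpen_bulk n r₀)
      (fun i j => (hdata.smooth_g i j).mono bulk_subset_M)
      (fun x hx => hdata.posDef_g x (bulk_subset_M hx))
      (fun i j => (hdata.smooth_k i j).mono bulk_subset_M) hsmooth).continuousOn continuousOn_const
      (fun x hx => h.jangOperator_eq_zero hv hFs hFd hx) hx
  · refine (hvF h0 F fun r hr => hFd r (Or.inr hr)).imp (fun h1 => ⟨h1.1, ?_⟩) fun h1 => ⟨h1.1, ?_⟩
    · exact h1.2.comp tendsto_comap
    · exact h1.2.comp tendsto_comap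

end Jang

namespace Jang

variable {n : ℕ}

/-! ### The radial profile of a solution of Jang's equation -/

/-- The profile `F` of a spherically symmetric solution of Jang's equation and its slope `v`. -/
structure IsJangProfile (n : ℕ) (r₀ : ℝ) (D G kn kt F v : ℝ → ℝ) : Prop where
  smooth : ContDiffOn ℝ ∞ F (radii r₀)
  even : r₀ = 0 → Function.Even F
  slope : IsJangSlope n r₀ D G kn kt v
  hasDerivAt : ∀ r ∈ radii r₀,
    HasDerivAt F (Real.sqrt (D r) * (v r / Real.sqrt (1 - v r ^ 2))) r
  blowup : 0 < r₀ → Tendsto F (𝓝[>] r₀) atTop ∨ Tendsto F (𝓝[>] r₀) atBot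

theorem slope_sq {D F : ℝ → ℝ} {r : ℝ} (hD : 0 < D r) :
    1 - slope D F r ^ 2 = D r / (D r + deriv F r ^ 2) := by
  have hp : 0 < D r + deriv F r ^ 2 := by positivity
  unfold slope
  rw [div_pow, Real.sq_sqrt hp.le]
  field_simp
  ring

theorem deriv_eq_slope {D F : ℝ → ℝ} {r : ℝ} (hD : 0 < D r) :
    deriv F r = Real.sqrt (D r) * (slope D F r / Real.sqrt (1 - slope D F r ^ 2)) := by
  have hp : 0 < D r + deriv F r ^ 2 := by positivity
  rw [slope_sq hD, Real.sqrt_div hD.le]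
  unfold slope
  have h1 := Real.sqrt_pos.2 hp
  have h2 := Real.sqrt_pos.2 hD
  field_simp

/-- Parts (b) and (c) concern every solution, not only the constructed one. Restricting f to an axis
gives its profile, and `jangOperator_eq` read backwards gives the slope equation. -/
theorem IsHorizonFree.exists_jangProfile {r₀ : ℝ} {g k : Tensor2 n} {D G kn kt g₁₁ ρ kₜ : ℝ → ℝ}
    (h : IsHorizonFree n r₀ g k D G kn kt) {f : E n → ℝ}
    (hf : IsJangSolution n r₀ g k g₁₁ ρ kₜ f) :
    ∃ F v, IsJangProfile n r₀ D G kn kt F v ∧ ∀ x ∈ bulk n r₀, f x = F ‖x‖ := by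
  have hp := h.profile
  have hg := hp.isRadialMetric h.hr₀
  set i₀ : Fin n := ⟨0, by have := h.hn; omega⟩
  set e : ℝ → E n := fun r => EuclideanSpace.single i₀ r with he
  have hen : ∀ r, ‖e r‖ = |r| := fun r => by simp [he]
  have hmem : ∀ r ∈ radii r₀, e r ∈ bulk n r₀ := fun r hr =>
    hr.imp id fun h1 => by rw [hen]; exact h1.trans_le (le_abs_self r)
  set F : ℝ → ℝ := fun r => f (e r) with hF
  have hfF : ∀ x ∈ bulk n r₀, f x = F ‖x‖ := fun x hx =>
    hf.radial x hx _ (hmem _ hx) (by rw [hen, abs_norm])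
  have hFs : ContDiffOn ℝ ∞ F (radii r₀) := hf.smooth.comp (contDiff_single i₀).contDiffOn hmem
  have hFe : r₀ = 0 → Function.Even F := fun h0 r =>
    hf.radial _ (Or.inl h0) _ (Or.inl h0) (by rw [hen, hen, abs_neg])
  have hDp : ∀ r ∈ radii r₀, 0 < D r := fun r hr => hp.D_pos r (radii_subset_profileLine hr)
  have hDs := hp.D_smooth.mono (radii_subset_profileLine (r₀ := r₀))
  have hF' := ((contDiffOn_infty_iff_deriv_of_isOpen (isOpen_radii r₀)).1 hFs).2
  have hpos : ∀ r ∈ radii r₀, 0 < D r + deriv F r ^ 2 := fun r hr => by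
    have := hDp r hr; positivity
  refine ⟨F, Jang.slope D F, ⟨hFs, hFe, ⟨?_, fun h0 r => ?_, fun r hr => ?_, fun r hr => ?_⟩,
    fun r hr => ?_, fun h0 => ?_⟩, hfF⟩
  · exact hF'.div ((hDs.add (hF'.pow 2)).sqrt fun r hr => (hpos r hr).ne')
      fun r hr => (Real.sqrt_pos.2 (hpos r hr)).ne'
  · unfold Jang.slope
    rw [deriv_neg_of_even (hFe h0), hp.D_even h0 r, neg_sq, neg_div]
  · have h1 := slope_sq (F := F) (hDp r hr)
    have := div_pos (hDp r hr) (hpos r hr)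
    linarith
  · have hx : ‖e r‖ ∈ Ioi r₀ := by rw [hen]; exact lt_of_lt_of_le hr (le_abs_self r)
    have her : ‖e r‖ = r := by rw [hen, abs_of_pos (h.hr₀.trans_lt hr)]
    have h1 := hg.jangOperator_eq (hp.k_eq' h.hr₀) (hFs.mono (Ioi_subset_radii r₀))
      (fun y hy => hfF y (Or.inr hy)) hx
    rw [hf.equation _ (Or.inr hx), her, eq_comm, sub_eq_zero,
      div_eq_iff (Real.sqrt_pos.2 (hg.D_pos r hr)).ne'] at h1
    have h2 := hg.hasDerivAt_slope (hFs.mono (Ioi_subset_radii r₀)) hr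
    rw [← h2.deriv] at h2
    refine h2.congr_deriv ?_
    linarith
  · have := (hFs.contDiffAt ((isOpen_radii r₀).mem_nhds hr)).differentiableAt (by simp)
    rw [← deriv_eq_slope (hDp r hr)]
    exact this.hasDerivAt
  · have ht : Tendsto e (𝓝[>] r₀) (towardsBoundary n r₀) := by
      refine tendsto_comap_iff.2 (tendsto_id.congr' ?_)
      filter_upwards [self_mem_nhdsWithin] with r hr
      simp only [Function.comp, hen, id]
      rw [abs_of_pos (h0.trans hr)]
    exact (hf.blowup h0).imp (fun h1 => h1.2.comp ht) fun h1 => h1.2.comp ht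

/-! ### The conformal factor -/

/-- The exponent `ℓ` for which `e^{2ℓ}(D̄ dr² + ρ² g_{S^{n-1}})` is flat, with `D̄ = D + F'²`. -/
structure IsConformalExponent (r₀ : ℝ) (D G F ℓ : ℝ → ℝ) : Prop where
  smooth : ContDiffOn ℝ ∞ ℓ (radii r₀)
  even : r₀ = 0 → Function.Even ℓ
  hasDerivAt : ∀ r, r₀ < r → HasDerivAt ℓ
    (Real.sqrt (D r + deriv F r ^ 2) / (r * Real.sqrt (G r)) - (halfLogDeriv G r + 1 / r)) r
  tendsto_zero : Tendsto ℓ atTop (𝓝 0)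
  tendsto_boundary : 0 < r₀ → Tendsto (fun r => Real.log (r * Real.sqrt (G r)) + ℓ r) (𝓝[>] r₀) atBot

/-- If F → +∞, then cL + F is increasing, so cL is at most a constant minus F near a; otherwise F is
replaced by -F. -/
theorem tendsto_atBot_of_abs_deriv_le {a b c : ℝ} (hab : a < b) (hc : 0 < c) {F F' L L' : ℝ → ℝ}
    (hF : ∀ r ∈ Ioc a b, HasDerivAt F (F' r) r) (hL : ∀ r ∈ Ioc a b, HasDerivAt L (L' r) r)
    (hle : ∀ r ∈ Ioc a b, |F' r| ≤ c * L' r)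
    (ht : Tendsto F (𝓝[>] a) atTop ∨ Tendsto F (𝓝[>] a) atBot) : Tendsto L (𝓝[>] a) atBot := by
  wlog htop : Tendsto F (𝓝[>] a) atTop generalizing F F'
  · refine this (F := fun r => -F r) (F' := fun r => -F' r) (fun r hr => (hF r hr).neg)
      (fun r hr => by rw [abs_neg]; exact hle r hr) ?_ ?_ <;>
    have := tendsto_neg_atBot_atTop.comp (ht.resolve_left htop)
    · exact Or.inl this
    · exact this
  have hd : ∀ r ∈ Ioc a b, HasDerivAt (fun r => c * L r + F r) (c * L' r + F' r) r := fun r hr =>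
    ((hL r hr).const_mul c).add (hF r hr)
  have hmono : MonotoneOn (fun r => c * L r + F r) (Ioc a b) := by
    refine monotoneOn_of_deriv_nonneg (convex_Ioc a b)
      (fun r hr => (hd r hr).continuousAt.continuousWithinAt) ?_ ?_ <;> rw [interior_Ioc]
    · exact fun r hr => (hd r ⟨hr.1, hr.2.le⟩).differentiableAt.differentiableWithinAt
    · intro r hr
      rw [(hd r ⟨hr.1, hr.2.le⟩).deriv]
      linarith [hle r ⟨hr.1, hr.2.le⟩, neg_abs_le (F' r)]
  have h1 : Tendsto (fun r => (1 / c) * ((c * L b + F b) + -F r)) (𝓝[>] a) atBot :=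
    (tendsto_atBot_add_const_left _ _ (tendsto_neg_atTop_atBot.comp htop)).const_mul_atBot
      (by positivity)
  refine tendsto_atBot_mono' _ ?_ h1
  filter_upwards [Ioc_mem_nhdsGT hab] with r hr
  have := hmono hr (right_mem_Ioc.2 hab) hr.2
  simp only at this
  rw [one_div, inv_mul_eq_div, le_div_iff₀ hc]
  linarith

theorem IsRadialMetric.hasDerivAt_log_area {g : Tensor2 n} {D G : ℝ → ℝ} {U : Set ℝ}
    (h : IsRadialMetric g D G U) {r : ℝ} (hr : r ∈ U) :
    HasDerivAt (fun r => Real.log (r * Real.sqrt (G r))) (halfLogDeriv G r + 1 / r) r := by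
  have hρ : 0 < r * Real.sqrt (G r) := mul_pos (h.pos r hr) (Real.sqrt_pos.2 (h.G_pos r hr))
  have hD := Real.sqrt_pos.2 (h.D_pos r hr)
  refine ((h.hasDerivAt_area hr).log hρ.ne').congr_deriv ?_
  unfold areaSlope
  rw [mul_div_cancel₀ _ hD.ne', mul_div_cancel_left₀ _ hρ.ne']

theorem exists_odd_of_even {N : ℝ → ℝ} (hN : ContDiff ℝ ∞ N) (he : Function.Even N) (h0 : N 0 = 0) :
    ∃ h : ℝ → ℝ, ContDiff ℝ ∞ h ∧ Function.Odd h ∧ ∀ r, N r = r * h r := by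
  obtain ⟨h, hs, hr⟩ := exists_eq_mul_of_contDiff hN h0
  refine ⟨h, hs, fun r => ?_, hr⟩
  by_cases hr0 : r = 0
  · have h1 := (hasDerivAt_id (0 : ℝ)).mul (hs.differentiable (by simp) 0).hasDerivAt
    have h2 : HasDerivAt N (h 0) 0 := by
      refine (h1.congr_deriv (by simp)).congr_of_eventuallyEq (Eventually.of_forall fun r => ?_)
      exact hr r
    have h3 := h2.deriv
    rw [deriv_zero_of_even he] at h3
    rw [hr0, neg_zero, ← h3, neg_zero]
  · have h1 := he r
    rw [hr, hr] at h1
    have : r * (h (-r) + h r) = 0 := by linarith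
    rcases mul_eq_zero.1 this with h2 | h2
    · exact absurd h2 hr0
    · linarith

section

variable {r₀ : ℝ} {g k : Tensor2 n} {D G kn kt F v : ℝ → ℝ}
  (h : IsHorizonFree n r₀ g k D G kn kt) (hF : IsJangProfile n r₀ D G kn kt F v)
include h hF

omit h in
theorem IsJangProfile.contDiffOn_deriv : ContDiffOn ℝ ∞ (deriv F) (radii r₀) :=
  ((contDiffOn_infty_iff_deriv_of_isOpen (isOpen_radii r₀)).1 hF.smooth).2

/-- At r = 0 the two 1/r poles must cancel. The expression is (√(D̄/G) - 1)/r - G'/(2G), and √(D̄/G)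
- 1 is even and vanishes at 0 because D(0) = G(0) and F'(0) = 0; dividing by r leaves a smooth odd
function. -/
theorem IsHorizonFree.exists_exponent_deriv : ∃ φ : ℝ → ℝ, ContDiffOn ℝ ∞ φ (radii r₀) ∧
    (r₀ = 0 → Function.Odd φ) ∧ ∀ r, r₀ < r → φ r =
      Real.sqrt (D r + deriv F r ^ 2) / (r * Real.sqrt (G r)) - (halfLogDeriv G r + 1 / r) := by
  have hp := h.profile
  have hg := hp.isRadialMetric h.hr₀
  have hF' := hF.contDiffOn_deriv
  by_cases h0 : r₀ = 0
  · have hline : profileLine r₀ = univ := by simp [profileLine, h0]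
    have hDs := hp.D_smooth
    have hGs := hp.G_smooth
    rw [hline, contDiffOn_univ] at hDs hGs
    rw [radii_zero h0, contDiffOn_univ] at hF'
    have hDp : ∀ r, 0 < D r := fun r => hp.D_pos r (by rw [hline]; trivial)
    have hGp : ∀ r, 0 < G r := fun r => hp.G_pos r (by rw [hline]; trivial)
    have hpos : ∀ r, 0 < (D r + deriv F r ^ 2) / G r := fun r => by
      have := hDp r; have := hGp r; positivity
    have hd := deriv_neg_of_even (hF.even h0)
    obtain ⟨N, hN, hNo, hNr⟩ := exists_odd_of_even
      (N := fun r => Real.sqrt ((D r + deriv F r ^ 2) / G r) - 1)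
      ((((hDs.add (hF'.pow 2)).div hGs fun r => (hGp r).ne').sqrt fun r => (hpos r).ne').sub
        contDiff_const)
      (fun r => by simp only [hd r, hp.D_even h0 r, hp.G_even h0 r, neg_sq])
      (by
        rw [deriv_zero_of_even (hF.even h0), hp.D_zero h0]
        have := (hGp 0).ne'
        simp [this])
    refine ⟨fun r => N r - halfLogDeriv G r, ?_, fun _ r => ?_, fun r hr => ?_⟩
    · rw [radii_zero h0, contDiffOn_univ]
      exact hN.sub ((contDiff_infty_iff_deriv.1 hGs).2.div (contDiff_const.mul hGs) fun r => by
        have := hGp r; positivity)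
    · simp only [hNo r, halfLogDeriv, deriv_neg_of_even (hp.G_even h0), hp.G_even h0 r]
      ring
    · have hr0 : r ≠ 0 := (hg.pos r hr).ne'
      have h1 := hNr r
      rw [Real.sqrt_div (by have := hDp r; positivity)] at h1
      have h2 := Real.sqrt_pos.2 (hGp r)
      have h3 : N r = (Real.sqrt (D r + deriv F r ^ 2) / Real.sqrt (G r) - 1) / r := by
        rw [h1]; field_simp
      simp only [h3]
      field_simp
      ring
  · rw [radii_of_pos h0] at hF' ⊢
    have hpos : ∀ r ∈ Ioi r₀, 0 < D r + deriv F r ^ 2 := fun r hr => by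
      have := hg.D_pos r hr; positivity
    refine ⟨_, ?_, fun h1 => absurd h1 h0, fun r hr => rfl⟩
    refine (((hg.D_smooth.add (hF'.pow 2)).sqrt fun r hr => (hpos r hr).ne').div
      (contDiffOn_id.mul (hg.G_smooth.sqrt fun r hr => (hg.G_pos r hr).ne')) fun r hr =>
        (mul_pos (hg.pos r hr) (Real.sqrt_pos.2 (hg.G_pos r hr))).ne').sub
      (hg.contDiffOn_a.add hg.contDiffOn_inv_r)

theorem IsHorizonFree.sqrt_jang_eq {r : ℝ} (hr : r₀ < r) :
    Real.sqrt (D r + deriv F r ^ 2) = Real.sqrt (D r) / Real.sqrt (1 - v r ^ 2) := by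
  have hD := (h.profile.isRadialMetric h.hr₀).D_pos r hr
  rw [(hF.hasDerivAt r (Or.inr hr)).deriv, sqrt_div_one_sub hD (hF.slope.sq_lt r (Or.inr hr)),
    Real.sqrt_div hD.le]

theorem IsHorizonFree.exists_conformalExponent : ∃ ℓ, IsConformalExponent r₀ D G F ℓ := by
  have hp := h.profile
  have hg := hp.isRadialMetric h.hr₀
  obtain ⟨φ, hφ, hφo, hφr⟩ := h.exists_exponent_deriv hF
  obtain ⟨ℓ, hℓ, hℓe, hℓd⟩ := exists_primitive hφ hφo
  obtain ⟨s, R, r₁, c, C, B, hr₁, hend, hB, hq, hvB⟩ := h.exists_sq_le hF.slope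
  obtain ⟨l, hl⟩ := hend.exists_tendsto_of_conformal hB hvB hq (F := ℓ) fun r hr => by
    have hr0 := hr₁.trans_le hr
    refine (hℓd r (Or.inr hr0)).congr_deriv ?_
    have hD := hend.α_pos r hr
    have hρ := hend.ρ_pos hr
    have e : Real.sqrt (D r) * areaSlope D G r / (r * Real.sqrt (G r)) =
        halfLogDeriv G r + 1 / r := by
      unfold areaSlope
      rw [mul_div_cancel₀ _ hD.ne', mul_div_cancel_left₀ _ hρ.ne']
    rw [hφr r hr0, h.sqrt_jang_eq hF hr0, ← e]
    ring
  have hd : ∀ r, r₀ < r → HasDerivAt (fun r => ℓ r - l) (Real.sqrt (D r + deriv F r ^ 2) /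
      (r * Real.sqrt (G r)) - (halfLogDeriv G r + 1 / r)) r := fun r hr => by
    rw [← hφr r hr]
    exact (hℓd r (Or.inr hr)).sub_const l
  refine ⟨fun r => ℓ r - l, hℓ.sub contDiffOn_const, fun h0 r => by simp only [hℓe h0 r], hd,
    by simpa using hl.sub_const l, fun h0 => ?_⟩
  have hcont : ContinuousOn (fun r => r * Real.sqrt (G r)) (Icc r₀ (r₀ + 1)) := by
    have := (hp.G_smooth.continuousOn.mono (Ici_subset_profileLine h.hr₀)).mono
      (Icc_subset_Ici_self : Icc r₀ (r₀ + 1) ⊆ Ici r₀)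
    exact continuousOn_id.mul this.sqrt
  obtain ⟨m, hm⟩ := isCompact_Icc.bddAbove_image hcont
  have hρ : ∀ r, r₀ < r → 0 < r * Real.sqrt (G r) := fun r hr =>
    mul_pos (hg.pos r hr) (Real.sqrt_pos.2 (hg.G_pos r hr))
  have hm1 : ∀ r ∈ Ioc r₀ (r₀ + 1), r * Real.sqrt (G r) ≤ m := fun r hr =>
    hm ⟨r, ⟨hr.1.le, hr.2⟩, rfl⟩
  have hm0 : 0 < m := (hρ (r₀ + 1) (lt_add_one r₀)).trans_le
    (hm1 _ (right_mem_Ioc.2 (lt_add_one r₀)))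
  -- The derivative of log ρ + ℓ is √D̄/ρ ≥ |F'|/m, where m bounds ρ near the horizon; so the
  -- blow-up of F forces divergence.
  refine tendsto_atBot_of_abs_deriv_le (lt_add_one r₀) hm0 (F := F) (F' := deriv F)
    (fun r hr => (hF.hasDerivAt r (Or.inr hr.1)).differentiableAt.hasDerivAt)
    (fun r hr => (hg.hasDerivAt_log_area hr.1).add (hd r hr.1)) (fun r hr => ?_) (hF.blowup h0)
  have hD := hg.D_pos r hr.1
  have h1 : |deriv F r| ≤ Real.sqrt (D r + deriv F r ^ 2) := by
    rw [← Real.sqrt_sq_eq_abs]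
    exact Real.sqrt_le_sqrt (by linarith)
  refine h1.trans ?_
  rw [add_sub_cancel, ← mul_div_assoc, le_div_iff₀ (hρ r hr.1), mul_comm]
  exact mul_le_mul_of_nonneg_right (hm1 r hr) (Real.sqrt_nonneg _)

end

end Jang

/-! ### Existence and uniqueness of the conformal factor. -/

namespace Jang

variable {n : ℕ}

/-- The conformal factor that flattens the Jang metric. -/
noncomputable def flatFactor (n : ℕ) (ℓ : ℝ → ℝ) (x : E n) : ℝ :=
  Real.exp (((n : ℝ) - 2) / 2 * ℓ ‖x‖)

theorem exists_isCompact_of_eventually {r₀ : ℝ} {p : E n → Prop}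
    (h₁ : ∀ᶠ x in cobounded (E n), p x) (h₂ : ∀ᶠ x in towardsBoundary n r₀, p x) :
    ∃ K ⊆ {x : E n | ‖x‖ ∈ Ioi r₀}, IsCompact K ∧ ∀ x ∈ {x : E n | ‖x‖ ∈ Ioi r₀}, x ∉ K → p x := by
  obtain ⟨b, hb⟩ : ∃ b : ℝ, ∀ x : E n, b < ‖x‖ → p x := by
    obtain ⟨b, -, hb⟩ := (Metric.hasBasis_cobounded_compl_closedBall (0 : E n)).eventually_iff.1 h₁
    exact ⟨b, fun x hx => hb (by simpa using hx)⟩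
  obtain ⟨a, ha, hra⟩ := mem_nhdsGT_iff_exists_Ioo_subset.1 (eventually_comap.1 h₂)
  have ha : r₀ < a := ha
  refine ⟨{x | a ≤ ‖x‖} ∩ Metric.closedBall 0 b, fun x hx => ha.trans_le hx.1,
    (isCompact_closedBall 0 b).inter_left (isClosed_le continuous_const continuous_norm),
    fun x hx hxK => ?_⟩
  by_cases h : ‖x‖ < a
  · exact hra ⟨hx, h⟩ x rfl
  · refine hb x ?_
    by_contra! hle
    exact hxK ⟨not_lt.1 h, by simpa using hle⟩

theorem contDiffOn_jangMetric_bulk {r₀ : ℝ} {g k : Tensor2 n} {f : E n → ℝ} (hdata : IsInitialData n r₀ g k)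
    (hf : ContDiffOn ℝ ∞ f (bulk n r₀)) (i j : Fin n) :
    ContDiffOn ℝ ∞ (fun x => jangMetric g f x i j) (bulk n r₀) :=
  contDiffOn_jangMetric (isOpen_bulk n r₀) (fun i j => (hdata.smooth_g i j).mono bulk_subset_M) hf i j

section

variable {r₀ : ℝ} {g k : Tensor2 n} {D G kn kt F v ℓ : ℝ → ℝ} {f : E n → ℝ}
  (h : IsHorizonFree n r₀ g k D G kn kt) (hF : IsJangProfile n r₀ D G kn kt F v)
  (hfF : ∀ x ∈ bulk n r₀, f x = F ‖x‖) (hℓ : IsConformalExponent r₀ D G F ℓ)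

include h hF hfF

theorem IsHorizonFree.isRadialMetric_jangMetric :
    IsRadialMetric (jangMetric g f) (fun r => D r + deriv F r ^ 2) G (Ioi r₀) :=
  (h.profile.isRadialMetric h.hr₀).jangMetric (hF.smooth.mono (Ioi_subset_radii r₀))
    fun x hx => hfF x (Or.inr hx)

include hℓ

theorem IsHorizonFree.flatFactor_equation {x : E n} (hx : ‖x‖ ∈ Ioi r₀) :
    laplacian (jangMetric g f) (flatFactor n ℓ) x - ((n : ℝ) - 2) / (4 * ((n : ℝ) - 1)) *
      scalarCurv (jangMetric g f) x * flatFactor n ℓ x = 0 := by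
  rw [(h.isRadialMetric_jangMetric hF hfF).conformalLaplacian_exp h.hn 1 (m := ℓ) (f := flatFactor n ℓ)
    (fun r hr => by simpa only [one_mul] using hℓ.hasDerivAt r hr)
    (hℓ.smooth.mono (Ioi_subset_radii r₀)) (fun _ _ => rfl) hx]
  simp

theorem IsHorizonFree.isConformalFactor_flatFactor (hdata : IsInitialData n r₀ g k)
    (hf : ContDiffOn ℝ ∞ f (bulk n r₀)) :
    IsConformalFactor n r₀ (jangMetric g f) (flatFactor n ℓ) := by
  have hp := h.profile
  have hg := hp.isRadialMetric h.hr₀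
  have ha : 0 < ((n : ℝ) - 2) / 2 := by
    have : (3 : ℝ) ≤ n := by exact_mod_cast h.hn
    linarith
  have hu : ContDiffOn ℝ ∞ (flatFactor n ℓ) (bulk n r₀) :=
    contDiffOn_comp_norm h.hr₀ (F := fun r => Real.exp (((n : ℝ) - 2) / 2 * ℓ r))
      (contDiffOn_const.mul hℓ.smooth).exp fun h0 r => by simp only [hℓ.even h0 r]
  have hgb := contDiffOn_jangMetric_bulk hdata hf
  have hd : ∀ x ∈ bulk n r₀, (jangMetric g f x).PosDef := fun x hx =>
    posDef_jangMetric (U := bulk n r₀) (fun x hx => hdata.posDef_g x (bulk_subset_M hx)) hx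
  refine ⟨hu, fun x _ => Real.exp_pos _, fun x hx => ?_, ?_, fun h0 => ?_⟩
  · refine eqOn_bulk h.hn (ContinuousOn.sub
      (contDiffOn_laplacian (isOpen_bulk n r₀) hgb hd hu).continuousOn
      ((continuousOn_const.mul (contDiffOn_scalarCurv (isOpen_bulk n r₀) hgb hd).continuousOn).mul
        hu.continuousOn)) continuousOn_const
      (fun x hx => h.flatFactor_equation hF hfF hℓ hx) hx
  · have h1 := (Real.continuous_exp.tendsto _).comp
      ((hℓ.tendsto_zero.const_mul (((n : ℝ) - 2) / 2)).comp
        (tendsto_norm_cobounded_atTop (E := E n)))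
    rw [mul_zero, Real.exp_zero] at h1
    exact h1
  -- Since log ρ has a finite limit at the horizon, ℓ itself tends to -∞ and u to 0.
  · have hG := hp.G_pos r₀ (Ici_subset_profileLine h.hr₀ self_mem_Ici)
    have hlog : Tendsto (fun r => -Real.log (r * Real.sqrt (G r))) (𝓝[>] r₀)
        (𝓝 (-Real.log (r₀ * Real.sqrt (G r₀)))) := by
      have h1 : ContinuousWithinAt G (Ici r₀) r₀ :=
        (hp.G_smooth.mono (Ici_subset_profileLine h.hr₀)).continuousOn r₀ self_mem_Ici
      exact (((continuousWithinAt_id.mul h1.sqrt).log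
        (mul_pos h0 (Real.sqrt_pos.2 hG)).ne').neg.mono Ioi_subset_Ici_self).tendsto
    have h1 : Tendsto ℓ (𝓝[>] r₀) atBot :=
      ((hℓ.tendsto_boundary h0).atBot_add hlog).congr fun r => by ring
    exact (Real.tendsto_exp_atBot.comp (h1.const_mul_atBot ha)).comp tendsto_comap

/-- Uniqueness of the conformal factor. -/
theorem IsHorizonFree.eq_flatFactor (hdata : IsInitialData n r₀ g k)
    (hf : ContDiffOn ℝ ∞ f (bulk n r₀)) {u : E n → ℝ}
    (hu : IsConformalFactor n r₀ (jangMetric g f) u) : EqOn u (flatFactor n ℓ) (bulk n r₀) := by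
  have hp := h.profile
  have hg := hp.isRadialMetric h.hr₀
  have hgb := h.isRadialMetric_jangMetric hF hfF
  have hu0 := h.isConformalFactor_flatFactor hF hfF hℓ hdata hf
  set u0 := flatFactor n ℓ with hu0d
  set a : ℝ := ((n : ℝ) - 2) / 2 with ha
  have ha0 : 0 < a := by
    have : (3 : ℝ) ≤ n := by exact_mod_cast h.hn
    rw [ha]; linarith
  set U : Set (E n) := {x | ‖x‖ ∈ Ioi r₀} with hU
  have hUo : IsOpen U := isOpen_Ioi.preimage continuous_norm
  have hUb : U ⊆ bulk n r₀ := fun x hx => Or.inr hx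
  have hρ : ∀ r, r₀ < r → 0 < r * Real.sqrt (G r) := fun r hr =>
    mul_pos (hg.pos r hr) (Real.sqrt_pos.2 (hg.G_pos r hr))
  -- The case ε = 0 of `conformalLaplacian_exp`: w = ρ^{-(n-2)/2} is a strict supersolution.
  set m : ℝ → ℝ := fun r => -Real.log (r * Real.sqrt (G r)) with hm
  have hms : ContDiffOn ℝ ∞ m (Ioi r₀) :=
    ((contDiffOn_id.mul (hg.G_smooth.sqrt fun r hr => (hg.G_pos r hr).ne')).log
      fun r hr => (hρ r hr).ne').neg
  set w : E n → ℝ := fun x => Real.exp (a * m ‖x‖) with hw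
  have hws : ContDiffOn ℝ ∞ w U := by
    intro x hx
    have hx' : ‖x‖ ∈ Ioi r₀ := hx
    have hx0 := hg.ne_zero hx'
    exact (((contDiffOn_const.mul hms).exp.contDiffAt (isOpen_Ioi.mem_nhds hx')).comp x
      (contDiffAt_norm ℝ hx0)).contDiffWithinAt
  have hwL : ∀ x ∈ U, laplacian (jangMetric g f) w x - ((n : ℝ) - 2) / (4 * ((n : ℝ) - 1)) *
      scalarCurv (jangMetric g f) x * w x < 0 := fun x hx => by
    rw [hgb.conformalLaplacian_exp h.hn 0 (m := m) (f := w)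
      (fun r hr => (hg.hasDerivAt_log_area hr).neg.congr_deriv (by ring)) hms (fun _ _ => rfl) hx]
    have h1 := hg.pos _ hx
    have h2 := hg.G_pos _ hx
    have h3 : 0 < a ^ 2 / (‖x‖ ^ 2 * G ‖x‖) * w x :=
      mul_pos (div_pos (by positivity) (by positivity)) (Real.exp_pos _)
    have e : ((0 : ℝ) ^ 2 - 1) * a ^ 2 / (‖x‖ ^ 2 * G ‖x‖) * w x =
      -(a ^ 2 / (‖x‖ ^ 2 * G ‖x‖) * w x) := by ring
    rw [e]
    linarith
  -- H = u₀ + w, written as a difference to match `laplacian_sub_mul`. The summand u₀ → 1 keeps H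
  -- from vanishing at infinity, where w tends to 0. The summand w controls the inner end, where u₀
  -- may tend to 0.
  set H : E n → ℝ := fun x => u0 x - (-1) * w x with hH
  have hu0p : ∀ x, 0 < u0 x := fun x => Real.exp_pos _
  have hwp : ∀ x, 0 < w x := fun x => Real.exp_pos _
  have hHp : ∀ x, 0 < H x := fun x => by
    have := hu0p x; have := hwp x; simp only [hH]; linarith
  have hHs : ContDiffOn ℝ ∞ H U := (hu0.smooth.mono hUb).sub (contDiffOn_const.mul hws)
  have hHL : ∀ x ∈ U, laplacian (jangMetric g f) H x - ((n : ℝ) - 2) / (4 * ((n : ℝ) - 1)) *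
      scalarCurv (jangMetric g f) x * H x < 0 := fun x hx => by
    rw [laplacian_sub_mul hUo _ (hu0.smooth.mono hUb) hws _ hx]
    have h1 := hwL x hx
    have h2 := hu0.equation x (hUb hx)
    simp only [hH]
    linarith
  have hinf : Tendsto (fun x => |u x - u0 x| / H x) (cobounded (E n)) (𝓝 0) := by
    have h1 := ((hu.asymptotic.sub hu0.asymptotic).abs).div hu0.asymptotic one_ne_zero
    simp only [sub_self, abs_zero, zero_div] at h1
    refine squeeze_zero (fun x => div_nonneg (abs_nonneg _) (hHp x).le) (fun x => ?_) h1
    refine div_le_div_of_nonneg_left (abs_nonneg _) (hu0p x) ?_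
    have := hwp x
    simp only [hH]; linarith
  have hbdry : Tendsto (fun x => |u x - u0 x| / H x) (towardsBoundary n r₀) (𝓝 0) := by
    have h1 : Tendsto (fun x => |u x - u0 x| * Real.exp (a * Real.log (‖x‖ * Real.sqrt (G ‖x‖))))
        (towardsBoundary n r₀) (𝓝 0) := by
      have hcont : Tendsto (fun r => r * Real.sqrt (G r)) (𝓝[>] r₀) (𝓝 (r₀ * Real.sqrt (G r₀))) := by
        have h1 : ContinuousWithinAt G (Ici r₀) r₀ :=
          (hp.G_smooth.mono (Ici_subset_profileLine h.hr₀)).continuousOn r₀ self_mem_Ici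
        exact ((continuousWithinAt_id.mul h1.sqrt).mono Ioi_subset_Ici_self).tendsto
      rcases h.hr₀.eq_or_lt with h0 | h0
      -- If r₀ = 0 the domain is punctured at the origin, where u - u₀ stays bounded while w → ∞.
      · have hz : (0 : E n) ∈ bulk n r₀ := Or.inl h0.symm
        have hnb := (isOpen_bulk n r₀).mem_nhds hz
        have hle : towardsBoundary n r₀ ≤ 𝓝 (0 : E n) := by
          rw [← comap_norm_nhds_zero, ← h0]
          exact comap_mono nhdsWithin_le_nhds
        have h2 : Tendsto (fun x => |u x - u0 x|) (towardsBoundary n r₀) (𝓝 |u 0 - u0 0|) :=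
          (((hu.smooth.continuousOn.continuousAt hnb).sub
            (hu0.smooth.continuousOn.continuousAt hnb)).abs.tendsto).mono_left hle
        have h3 : Tendsto (fun r => Real.log (r * Real.sqrt (G r))) (𝓝[>] r₀) atBot := by
          refine Real.tendsto_log_nhdsGT_zero.comp (tendsto_nhdsWithin_iff.2 ⟨?_, ?_⟩)
          · rw [← h0, zero_mul] at hcont; rwa [← h0]
          · filter_upwards [self_mem_nhdsWithin] with r hr using hρ r hr
        have h4 := (Real.tendsto_exp_atBot.comp (h3.const_mul_atBot ha0)).comp
          (tendsto_comap (f := fun x : E n => ‖x‖))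
        have h5 := h2.mul h4
        rwa [mul_zero] at h5
      · have hG := hp.G_pos r₀ (Ici_subset_profileLine h.hr₀ self_mem_Ici)
        have h2 := ((hu.cylindrical h0).sub (hu0.cylindrical h0)).abs
        have h3 := (Real.continuous_exp.tendsto _).comp ((hcont.log
          (mul_pos h0 (Real.sqrt_pos.2 hG)).ne').const_mul a)
        have h4 := h2.mul (h3.comp (tendsto_comap (f := fun x : E n => ‖x‖)))
        rwa [sub_self, abs_zero, zero_mul] at h4
    refine squeeze_zero (fun x => div_nonneg (abs_nonneg _) (hHp x).le) (fun x => ?_) h1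
    have e : Real.exp (a * Real.log (‖x‖ * Real.sqrt (G ‖x‖))) = (w x)⁻¹ := by
      rw [hw, ← Real.exp_neg]; simp only [hm]; ring_nf
    rw [e, ← div_eq_mul_inv]
    refine div_le_div_of_nonneg_left (abs_nonneg _) (hwp x) ?_
    have := hu0p x
    simp only [hH]; linarith
  have hd : ∀ x ∈ U, (jangMetric g f x).PosDef := fun x hx =>
    posDef_jangMetric (U := U) (fun x hx => hdata.posDef_g x (bulk_subset_M (hUb hx))) hx
  have hle : ∀ u₁ u₂ : E n → ℝ, IsConformalFactor n r₀ (jangMetric g f) u₁ →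
      IsConformalFactor n r₀ (jangMetric g f) u₂ → (∀ x, u₁ x - u₂ x ≤ |u x - u0 x|) →
      ∀ x ∈ U, u₁ x ≤ u₂ x := fun u₁ u₂ h₁ h₂ h12 => by
    refine le_of_supersolution hUo hd (h₁.smooth.mono hUb) (h₂.smooth.mono hUb) hHs
      (fun x _ => hHp x) (fun x hx => h₁.equation x (hUb hx)) (fun x hx => h₂.equation x (hUb hx))
      hHL fun ε hε => ?_
    refine exists_isCompact_of_eventually ?_ ?_
    · filter_upwards [hinf.eventually (gt_mem_nhds hε)] with x hx
      exact (div_le_div_of_nonneg_right (h12 x) (hHp x).le).trans_lt hx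
    · filter_upwards [hbdry.eventually (gt_mem_nhds hε)] with x hx
      exact (div_le_div_of_nonneg_right (h12 x) (hHp x).le).trans_lt hx
  refine eqOn_bulk h.hn hu.smooth.continuousOn hu0.smooth.continuousOn fun x hx => le_antisymm ?_ ?_
  · exact hle u u0 hu hu0 (fun x => le_abs_self _) x hx
  · exact hle u0 u hu0 hu (fun x => by rw [abs_sub_comm]; exact le_abs_self _) x hx

end

end Jang

namespace Jang

variable {n : ℕ}

/-! ### The isometry with Euclidean space -/

theorem pd_coord {Ψ : E n → E n} {x : E n} (hΨ : DifferentiableAt ℝ Ψ x) (i a : Fin n) :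
    pd i (fun y => Ψ y a) x = fderiv ℝ Ψ x (EuclideanSpace.single i 1) a := by
  have h := (EuclideanSpace.proj a : E n →L[ℝ] ℝ).hasFDerivAt.comp x hΨ.hasFDerivAt
  have e : fderiv ℝ (fun y => Ψ y a) x = _ := h.fderiv
  unfold pd
  rw [e]
  simp

theorem pullback_one {Ψ : E n → E n} {x : E n} (hΨ : DifferentiableAt ℝ Ψ x) (i j : Fin n) :
    pullback Ψ (fun _ => 1) x i j =
      ∑ a, pd i (fun y => Ψ y a) x * pd j (fun y => Ψ y a) x := by
  simp only [pullback, Matrix.one_apply, ite_mul, one_mul, zero_mul, Finset.sum_ite_eq,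
    Finset.mem_univ, if_true, pd_coord hΨ]

/-- The map which stretches the sphere of radius `r` by the factor `S r`. -/
noncomputable def stretch (n : ℕ) (S : ℝ → ℝ) (x : E n) : E n := S ‖x‖ • x

theorem contDiffOn_stretch {r₀ : ℝ} (hr₀ : 0 ≤ r₀) {S : ℝ → ℝ} (hS : ContDiffOn ℝ ∞ S (radii r₀))
    (he : r₀ = 0 → Function.Even S) : ContDiffOn ℝ ∞ (stretch n S) (bulk n r₀) :=
  (contDiffOn_comp_norm hr₀ hS he).smul contDiffOn_id

/-- Radial lengths are multiplied by t' and tangential ones by S = t/r, with t = S r. -/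
theorem pullback_stretch {x : E n} (hx : x ≠ 0) {S : ℝ → ℝ} {t' : ℝ}
    (ht : HasDerivAt (fun r => S r * r) t' ‖x‖) (hΨ : DifferentiableAt ℝ (stretch n S) x)
    (i j : Fin n) : pullback (stretch n S) (fun _ => 1) x i j =
      t' ^ 2 * (nu x i * nu x j) + S ‖x‖ ^ 2 * proj x i j := by
  have hx0 : ‖x‖ ≠ 0 := norm_ne_zero_iff.2 hx
  have h1 : ∀ a, HasPD (fun y => stretch n S y a)
      (fun l => t' * nu x l * nu x a + S ‖x‖ * proj x l a) x := fun a => by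
    refine (((hasPD_radial hx ht).mul (hasPD_nu hx a)).congr ?_).congr_pd fun l => ?_
    · filter_upwards [isOpen_ne.mem_nhds hx] with y hy
      have : ‖y‖ ≠ 0 := norm_ne_zero_iff.2 hy
      simp only [stretch, PiLp.smul_apply, smul_eq_mul, nu]
      field_simp
    · rw [proj_comm x l a]; field_simp; ring
  rw [pullback_one hΨ]
  simp only [(h1 _).pd_eq]
  have h2 : ∀ a, (t' * nu x i * nu x a + S ‖x‖ * proj x i a) *
      (t' * nu x j * nu x a + S ‖x‖ * proj x j a) =
      t' ^ 2 * (nu x i * nu x j) * (nu x a * nu x a) + S ‖x‖ ^ 2 * (proj x i a * proj x j a)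
      + t' * S ‖x‖ * nu x i * (proj x j a * nu x a)
      + t' * S ‖x‖ * nu x j * (proj x i a * nu x a) := fun a => by ring
  simp only [h2, Finset.sum_add_distrib, ← Finset.mul_sum, sum_nu_sq hx, sum_proj_nu hx,
    sum_proj_proj hx]
  ring

theorem bijOn_stretch {r₀ : ℝ} (hr₀ : 0 ≤ r₀) {S : ℝ → ℝ} (hS : ∀ r, r₀ < r → 0 < S r)
    (hc : ContinuousOn (fun r => S r * r) (Ioi r₀)) (hmono : StrictMonoOn (fun r => S r * r) (Ioi r₀))
    (h0 : Tendsto (fun r => S r * r) (𝓝[>] r₀) (𝓝 0))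
    (htop : Tendsto (fun r => S r * r) atTop atTop) :
    BijOn (stretch n S) {x | ‖x‖ ∈ Ioi r₀} {0}ᶜ := by
  have hnorm : ∀ x : E n, ‖x‖ ∈ Ioi r₀ → ‖stretch n S x‖ = S ‖x‖ * ‖x‖ := fun x hx => by
    rw [stretch, norm_smul, Real.norm_eq_abs, abs_of_pos (hS _ hx)]
  refine ⟨fun x hx => ?_, fun x hx y hy hxy => ?_, fun y hy => ?_⟩
  · have hx' : ‖x‖ ∈ Ioi r₀ := hx
    rw [mem_compl_singleton_iff, ← norm_ne_zero_iff, hnorm x hx']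
    exact (mul_pos (hS _ hx') (hr₀.trans_lt hx')).ne'
  · have hx' : ‖x‖ ∈ Ioi r₀ := hx
    have hy' : ‖y‖ ∈ Ioi r₀ := hy
    have h1 := congrArg norm hxy
    rw [hnorm x hx', hnorm y hy'] at h1
    have h2 : ‖x‖ = ‖y‖ := hmono.injOn hx' hy' h1
    unfold stretch at hxy
    rw [h2] at hxy
    exact smul_right_injective (E n) (hS _ hy').ne' hxy
  · have hy0 : 0 < ‖y‖ := norm_pos_iff.2 hy
    obtain ⟨a, ha, hra⟩ := ((h0.eventually (gt_mem_nhds hy0)).and self_mem_nhdsWithin).exists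
    obtain ⟨b, hb, hrb⟩ := ((htop.eventually_ge_atTop ‖y‖).and (eventually_gt_atTop r₀)).exists
    obtain ⟨r, hr, hry⟩ := isPreconnected_Ioi.intermediate_value hra hrb hc ⟨ha.le, hb⟩
    have hr0 : 0 < r := hr₀.trans_lt hr
    have hn : ‖(r / ‖y‖) • y‖ = r := by
      rw [norm_smul, Real.norm_eq_abs, abs_of_pos (by positivity), div_mul_cancel₀ _ hy0.ne']
    refine ⟨(r / ‖y‖) • y, by rw [mem_ofPred_eq, hn]; exact hr, ?_⟩
    have hry : S r * r = ‖y‖ := hry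
    rw [stretch, hn, smul_smul, mul_div_assoc', hry, div_self hy0.ne', one_smul]

section

variable {r₀ : ℝ} {g k : Tensor2 n} {D G kn kt F v ℓ : ℝ → ℝ} {f : E n → ℝ}
  (h : IsHorizonFree n r₀ g k D G kn kt) (hF : IsJangProfile n r₀ D G kn kt F v)
  (hfF : ∀ x ∈ bulk n r₀, f x = F ‖x‖) (hℓ : IsConformalExponent r₀ D G F ℓ)
include h hℓ

/-- The flat radius is t = ρ e^ℓ. Since (log t)' = √D̄/ρ by the choice of ℓ, t' = e^ℓ √D̄, the
radial length element of e^{2ℓ}ḡ. -/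
theorem IsHorizonFree.hasDerivAt_stretchedRadius {r : ℝ} (hr : r₀ < r) :
    HasDerivAt (fun r => Real.sqrt (G r) * Real.exp (ℓ r) * r)
      (Real.exp (ℓ r) * Real.sqrt (D r + deriv F r ^ 2)) r := by
  have hg := h.profile.isRadialMetric h.hr₀
  have hρ : 0 < r * Real.sqrt (G r) :=
    mul_pos (hg.pos r hr) (Real.sqrt_pos.2 (hg.G_pos r hr))
  have h1 := (hg.hasDerivAt_log_area hr).add (hℓ.hasDerivAt r hr)
  refine (h1.exp.congr_deriv ?_).congr_of_eventuallyEq ?_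
  · simp only [Pi.add_apply]
    rw [Real.exp_add, Real.exp_log hρ, add_sub_cancel, mul_comm (r * Real.sqrt (G r)), mul_assoc,
      mul_div_cancel₀ _ hρ.ne']
  · filter_upwards [Ioi_mem_nhds hr] with s hs
    have hs0 : 0 < s * Real.sqrt (G s) :=
      mul_pos (hg.pos s hs) (Real.sqrt_pos.2 (hg.G_pos s hs))
    simp only [Pi.add_apply]
    rw [Real.exp_add, Real.exp_log hs0]
    ring

theorem IsHorizonFree.tendsto_stretchedRadius_boundary :
    Tendsto (fun r => Real.sqrt (G r) * Real.exp (ℓ r) * r) (𝓝[>] r₀) (𝓝 0) := by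
  have hg := h.profile.isRadialMetric h.hr₀
  rcases h.hr₀.eq_or_lt with h0 | h0
  · have hG : ContinuousAt G r₀ := by
      have := h.profile.G_smooth.continuousOn
      rw [show profileLine r₀ = univ by simp [profileLine, ← h0], continuousOn_univ] at this
      exact this.continuousAt
    have hl : ContinuousAt ℓ r₀ :=
      hℓ.smooth.continuousOn.continuousAt ((isOpen_radii r₀).mem_nhds (Or.inl h0.symm))
    have : Tendsto (fun r => Real.sqrt (G r) * Real.exp (ℓ r) * r) (𝓝[>] r₀)
        (𝓝 (Real.sqrt (G r₀) * Real.exp (ℓ r₀) * r₀)) :=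
      ((hG.sqrt.mul hl.rexp).mul continuousAt_id).tendsto.mono_left nhdsWithin_le_nhds
    rw [← h0, mul_zero] at this
    rwa [← h0]
  · refine (Real.tendsto_exp_atBot.comp (hℓ.tendsto_boundary h0)).congr' ?_
    filter_upwards [self_mem_nhdsWithin] with s hs
    have hs0 : 0 < s * Real.sqrt (G s) :=
      mul_pos (hg.pos s hs) (Real.sqrt_pos.2 (hg.G_pos s hs))
    simp only [Function.comp]
    rw [Real.exp_add, Real.exp_log hs0]
    ring

theorem IsHorizonFree.tendsto_stretchedRadius_atTop :
    Tendsto (fun r => Real.sqrt (G r) * Real.exp (ℓ r) * r) atTop atTop := by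
  obtain ⟨s, R, r₁, c, C, hr₁, hend⟩ := h.exists_end
  have h1 : Tendsto (fun r => r * Real.sqrt (G r)) atTop atTop := by
    refine tendsto_atTop_mono' _ ?_ (hend.s_top.const_mul_atTop hend.c_pos)
    filter_upwards [eventually_ge_atTop r₁] with r hr using hend.le_ρ r hr
  have h2 := (Real.continuous_exp.tendsto 0).comp hℓ.tendsto_zero
  rw [Real.exp_zero] at h2
  exact (h1.atTop_mul_pos one_pos h2).congr fun r => by simp only [Function.comp]; ring

include hF hfF

/-- The conformally transformed Jang deformation is flat. -/
theorem IsHorizonFree.isometricToEuclidean (hdata : IsInitialData n r₀ g k)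
    (hf : ContDiffOn ℝ ∞ f (bulk n r₀)) {u : E n → ℝ}
    (hu : IsConformalFactor n r₀ (jangMetric g f) u) :
    IsometricToEuclidean n r₀ (conformalMetric u (jangMetric g f)) := by
  have hp := h.profile
  have hg := hp.isRadialMetric h.hr₀
  have hgb := h.isRadialMetric_jangMetric hF hfF
  have heq := h.eq_flatFactor hF hfF hℓ hdata hf hu
  set S : ℝ → ℝ := fun r => Real.sqrt (G r) * Real.exp (ℓ r) with hS
  have hSs : ContDiffOn ℝ ∞ S (radii r₀) :=
    ((hp.G_smooth.mono radii_subset_profileLine).sqrt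
      fun r hr => (hp.G_pos r (radii_subset_profileLine hr)).ne').mul hℓ.smooth.exp
  have hSe : r₀ = 0 → Function.Even S := fun h0 r => by
    simp only [hS, hp.G_even h0 r, hℓ.even h0 r]
  have hSp : ∀ r, r₀ < r → 0 < S r := fun r hr =>
    mul_pos (Real.sqrt_pos.2 (hg.G_pos r hr)) (Real.exp_pos _)
  have hd : ∀ r, r₀ < r → HasDerivAt (fun r => S r * r)
      (Real.exp (ℓ r) * Real.sqrt (D r + deriv F r ^ 2)) r := fun r hr =>
    h.hasDerivAt_stretchedRadius hℓ hr
  have hbij : BijOn (stretch n S) {x | ‖x‖ ∈ Ioi r₀} {0}ᶜ := by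
    refine bijOn_stretch h.hr₀ hSp (fun r hr => (hd r hr).continuousAt.continuousWithinAt) ?_
      (h.tendsto_stretchedRadius_boundary hℓ) (h.tendsto_stretchedRadius_atTop hℓ)
    refine strictMonoOn_of_deriv_pos (convex_Ioi r₀)
      (fun r hr => (hd r hr).continuousAt.continuousWithinAt) ?_
    rw [interior_Ioi]
    intro r hr
    rw [(hd r hr).deriv]
    exact mul_pos (Real.exp_pos _) (Real.sqrt_pos.2 (hgb.D_pos r hr))
  have hΨ := contDiffOn_stretch (n := n) h.hr₀ hSs hSe
  have hΨd : ∀ x ∈ bulk n r₀, DifferentiableAt ℝ (stretch n S) x := fun x hx =>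
    (hΨ.contDiffAt ((isOpen_bulk n r₀).mem_nhds hx)).differentiableAt (by simp)
  -- By uniqueness u = e^{(n-2)ℓ/2}, and the exponents multiply to 2.
  have hconf : ∀ x ∈ bulk n r₀, u x ^ (4 / ((n : ℝ) - 2)) = Real.exp (2 * ℓ ‖x‖) := fun x hx => by
    have hn2 : (n : ℝ) - 2 ≠ 0 := by
      have : (3 : ℝ) ≤ n := by exact_mod_cast h.hn
      linarith
    rw [heq hx, flatFactor, ← Real.exp_mul]
    congr 1
    field_simp
    ring
  refine ⟨stretch n S, hΨ, fun x hx i j => ?_, fun h0 => ?_, fun h0 => ⟨?_, ?_⟩⟩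
  · have hcoord : ∀ a, ContDiffOn ℝ ∞ (fun x => stretch n S x a) (bulk n r₀) := fun a =>
      (EuclideanSpace.proj a : E n →L[ℝ] ℝ).contDiff.comp_contDiffOn hΨ
    have hleft : ContinuousOn (fun x => ∑ a, pd i (fun y => stretch n S y a) x *
        pd j (fun y => stretch n S y a) x) (bulk n r₀) :=
      continuousOn_finsetSum _ fun a _ =>
        (contDiffOn_pd (isOpen_bulk n r₀) (hcoord a) i).continuousOn.mul
          (contDiffOn_pd (isOpen_bulk n r₀) (hcoord a) j).continuousOn
    have hright : ContinuousOn (fun x => Real.exp (2 * ℓ ‖x‖) * jangMetric g f x i j)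
        (bulk n r₀) :=
      (contDiffOn_comp_norm h.hr₀ (F := fun r => Real.exp (2 * ℓ r))
        (contDiffOn_const.mul hℓ.smooth).exp
        fun h0 r => by simp only [hℓ.even h0 r]).continuousOn.mul
        (contDiffOn_jangMetric_bulk hdata hf i j).continuousOn
    rw [conformalMetric, Matrix.smul_apply, smul_eq_mul, hconf x hx, pullback_one (hΨd x hx)]
    refine eqOn_bulk h.hn hleft hright (fun x hx => ?_) hx
    have hx0 := hg.ne_zero hx
    rw [← pullback_one (hΨd x (Or.inr hx)), pullback_stretch hx0 (hd _ hx) (hΨd x (Or.inr hx)),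
      hgb.eq x hx, mul_pow, Real.sq_sqrt (hgb.D_pos _ hx).le, hS, mul_pow,
      Real.sq_sqrt (hg.G_pos _ hx).le, ← Real.exp_nat_mul]
    push_cast
    ring
  · have hset : ({x | ‖x‖ ∈ Ioi r₀} : Set (E n)) = {0}ᶜ := by
      ext x; simp [h0]
    have hzero : stretch n S 0 = 0 := by simp [stretch]
    -- The bijection is known off the origin, which is fixed, so the origin is inserted on both
    -- sides.
    have h1 := (hset ▸ hbij : BijOn (stretch n S) {0}ᶜ {0}ᶜ).insert (a := 0) (by rw [hzero]; simp)
    have hbulk : bulk n r₀ = univ := by ext x; simp [bulk, h0]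
    have hins : insert (0 : E n) {0}ᶜ = univ := by ext x; simp [em]
    rw [hzero, hins] at h1
    rwa [hbulk]
  · have hbulk : bulk n r₀ = {x | ‖x‖ ∈ Ioi r₀} := by ext x; simp [bulk, h0.ne']
    rwa [hbulk]
  · rw [tendsto_zero_iff_norm_tendsto_zero]
    refine ((h.tendsto_stretchedRadius_boundary hℓ).comp
      (tendsto_comap (f := fun x : E n => ‖x‖))).congr' ?_
    have : ∀ᶠ x in towardsBoundary n r₀, ‖x‖ ∈ Ioi r₀ :=
      tendsto_comap.eventually self_mem_nhdsWithin
    filter_upwards [this] with x hx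
    rw [stretch, norm_smul, Real.norm_eq_abs, abs_of_pos (hSp _ hx)]
    rfl

end

end Jang

/-- Spherically symmetric asymptotically flat initial data: existence for Jang's equation, and
flatness of the conformally transformed Jang deformation. The dominant energy condition is not
needed. -/
theorem mainTheorem8 (n : ℕ) (hn : 3 ≤ n) (r₀ : ℝ) (hr₀ : 0 ≤ r₀)
    (g k : Jang.Tensor2 n) (g₁₁ ρ kₙ kₜ : ℝ → ℝ)
    (hdata : Jang.IsInitialData n r₀ g k)
    (hsym : Jang.IsSphericallySymmetric n r₀ g k g₁₁ ρ kₙ kₜ)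
    (hflat : Jang.AsymptoticallyFlat n r₀ g k)
    (hdec : Jang.DominantEnergy n r₀ g k)
    (hhor : Jang.CompleteOrOutermostHorizon n r₀ g₁₁ ρ kₜ) :
    (∃ f : Jang.E n → ℝ, Jang.IsJangSolution n r₀ g k g₁₁ ρ kₜ f) ∧
    ∀ f : Jang.E n → ℝ, Jang.IsJangSolution n r₀ g k g₁₁ ρ kₜ f →
      (∃ u : Jang.E n → ℝ, Jang.IsConformalFactor n r₀ (Jang.jangMetric g f) u) ∧
      ∀ u : Jang.E n → ℝ, Jang.IsConformalFactor n r₀ (Jang.jangMetric g f) u →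
        Jang.IsometricToEuclidean n r₀ (Jang.conformalMetric u (Jang.jangMetric g f)) := by
  obtain ⟨D, G, kn, kt, hprof, hrel⟩ := Jang.exists_profile hn hdata hsym
  have hn1 : (n : ℝ) - 1 ≠ 0 := by
    have : (3 : ℝ) ≤ n := by exact_mod_cast hn
    linarith
  have hnull : ∀ σ r, r₀ ≤ r → 0 < r → (Jang.nullExpansion n r₀ g₁₁ ρ kₜ σ r = 0 ↔
      Jang.expansion r₀ D G kt σ r = 0) := fun σ r hr hr0 => by
    rw [hprof.nullExpansion_eq hr₀ hrel σ hr hr0, mul_eq_zero, or_iff_right hn1]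
    rfl
  obtain ⟨s, R, r₁, c, C, hr₁, hend⟩ := Jang.exists_radialEnd hn hr₀ hprof hflat
  have hne : ∀ r, r₀ < r → Jang.expansion r₀ D G kt 1 r ≠ 0 ∧
      Jang.expansion r₀ D G kt (-1) r ≠ 0 := fun r hr =>
    ⟨fun h => (hhor.1 r hr).1 ((hnull 1 r hr.le (hr₀.trans_lt hr)).2 h),
      fun h => (hhor.1 r hr).2 ((hnull (-1) r hr.le (hr₀.trans_lt hr)).2 h)⟩
  have h : Jang.IsHorizonFree n r₀ g k D G kn kt := ⟨hn, hr₀, hprof, ⟨s, R, r₁, c, C, hr₁, hend⟩,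
    fun r hr => ⟨Jang.expansion_pos hr₀ hprof hr₁ hend (by simp) (fun r hr => (hne r hr).1) hr,
      Jang.expansion_pos hr₀ hprof hr₁ hend (by simp) (fun r hr => (hne r hr).2) hr⟩⟩
  refine ⟨h.exists_jangSolution hdata (fun h0 σ => hnull σ r₀ le_rfl h0) hhor.2, fun f hf => ?_⟩
  obtain ⟨F, v, hF, hfF⟩ := h.exists_jangProfile hf
  obtain ⟨ℓ, hℓ⟩ := h.exists_conformalExponent hF
  exact ⟨⟨_, h.isConformalFactor_flatFactor hF hfF hℓ hdata hf.smooth⟩,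
    fun u hu => h.isometricToEuclidean hF hfF hℓ hdata hf.smooth hu⟩
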